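/- Let $f$ be a real, statistically homogeneous random field of mean zero with finite moments of all orders, in a periodic box of $\mathbb{R}^d$ with side lengths $L_1,\dots,L_d$ and volume $V=L_1\cdots L_d$. Put $f_{\mathbf k}=V^{-1/2}\int f(\mathbf x)e^{-i\mathbf k\cdot\mathbf x}\,d^dx$ for $\mathbf k\in\prod_i \frac{2\pi}{L_i}\mathbb Z$, $P(\mathbf k)=\langle|f_{\mathbf k}|^2\rangle$, $\alpha_{\mathbf k}=f_{\mathbf k}/\sqrt{P(\mathbf k)}=A_{\mathbf k}e^{i\theta_{\mathbf k}}$, and let the normalized polyspectra be defined by $\langle\alpha_{\mathbf k_1}\cdots\alpha_{\mathbf k_N}\rangle_{\rm c}=V^{1-N/2}p^{(N)}(\mathbf k_1,\dots,\mathbf k_N)$, where $\langle\cdots\rangle_{\rm c}$ is the joint cumulant. Let $\mathbf k_1\ne\mathbf k_2$ be nonzero wavevectors with $P(\mathbf k_1),P(\mathbf k_2)>0$ and $n\mathbf k_1=m\mathbf k_2$, where $n,m$ are coprime positive integers, and let $$C_2(\theta_1,\theta_2)=(2\pi)^2P_2(\theta_1,\theta_2)-1$$ be the deviation of the joint density $P_2$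 of the two phases $(\theta_{\mathbf k_1},\theta_{\mathbf k_2})$ from the uniform one. Let $$\Lambda(\theta_1,\theta_2)=\frac{2\,\Gamma(1+\frac n2)\Gamma(1+\frac m2)}{n!\,m!}\,\mathrm{Re}\Bigl[p^{(n+m)}(\underbrace{\mathbf k_1,\dots,\mathbf k_1}_{n},\underbrace{-\mathbf k_2,\dots,-\mathbf k_2}_{m})\,e^{-i(n\theta_1-m\theta_2)}\Bigr]$$ (for a real polyspectrum, $\mathrm{Re}[\cdots]=p^{(n+m)}\cos(n\theta_1-m\theta_2)$). (1) Consider the formal expansion in powers of $V^{-1/2}$ of the joint distribution of the two modes, $$\mathcal P=\exp\Bigl[\sum_{N\ge3}\frac{(-1)^N}{N!\,V^{N/2-1}}\sum_{\mathbf q_1,\dots,\mathbf q_N\in\{\pm\mathbf k_1,\pm\mathbf k_2\}}p^{(N)}(\mathbf q_1,\dots,\mathbf q_N)\frac{\partial}{\partial\alpha_{\mathbf q_1}}\cdots\frac{\partial}{\partial\alpha_{\mathbf q_N}}\Bigr]\mathcal P_{\rm G},\qquad \mathcal P_{\rm G}\propto e^{-\alpha_{\mathbf k_1}\alpha_{-\mathbf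 k_1}-\alpha_{\mathbf k_2}\alpha_{-\mathbf k_2}},$$ with $\mathcal P_{\rm G}$ normalized, and the resulting formal expansion $C_2=\sum_{j\ge0}c_j(\theta_1,\theta_2)V^{-j/2}$, obtained by integrating over the moduli term by term. Then $c_j=0$ for all $j<n+m-2$, and $c_{n+m-2}=\Lambda$. Thus the deviation from random phases is of order $V^{-(n+m-2)/2}$ or smaller, and the leading term involves only the polyspectrum $p^{(n+m)}(\mathbf k_1,\dots,\mathbf k_1,-\mathbf k_2,\dots,-\mathbf k_2)$. (2) Consider a family of such fields, in boxes with $V\to\infty$, with $\mathbf k_1,\mathbf k_2$ fixed and with polyspectra $p^{(N)}$ ($N\ge3$) of the modes $\pm\mathbf k_1,\pm\mathbf k_2$ that do not depend on the member of the family. Suppose that $(\alpha_{\mathbf k_1},\alpha_{\mathbf k_2})$ has a density $\rho_V$ on $\mathbb C^2$ with an asymptotic expansion $\rho_V\sim\sum_{j\ge0}V^{-j/2}q_j\,\mathcal P_{\rm G}$ with some polynomials $q_j$ in $\alpha_{\pm\mathbf k_1},\alpha_{\pm\mathbf k_2}$, the remainder after the term $j=J$ being $O\bigl(V^{-(J+1)/2}(1+|\alpha|)^{-M}\bigr)$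 uniformly on $\mathbb C^2$, for all $J$ and $M$. Then, uniformly in $\theta_1,\theta_2$, $$C_2=O\bigl(V^{-(n+m-2)/2}\bigr),\qquad C_2=V^{-(n+m-2)/2}\,\Lambda+O\bigl(V^{-(n+m-1)/2}\bigr).$$ -/

import Mathlib

open MeasureTheory Filter

noncomputable section

namespace FourierModes

/-! ### Joint cumulants -/

/-- The joint cumulant belonging to a family of joint moments `m S` (`S` a finite set of labels).
It is the solution of the moment-cumulant relation
`m S = ∑ over all partitions π of S, ∏ over the blocks B of π, (cumulant of B)`,
solved recursively for the cumulant of the one-block partition. -/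
def cumulantOf {κ : Type*} [DecidableEq κ] (m : Finset κ → ℂ) (S : Finset κ) : ℂ :=
  m S - ∑ π ∈ {π : Finpartition S | π.parts ≠ {S}}.toFinset.attach,
    ∏ B ∈ π.1.parts.attach, cumulantOf m B.1
termination_by S.card
decreasing_by
  have hπ : π.1.parts ≠ {S} := by simpa using π.2
  have hB := B.2
  refine Finset.card_lt_card (lt_of_le_of_ne (π.1.le hB) ?_)
  intro h
  apply hπ
  have hS : S ∈ π.1.parts := by rw [h] at hB; exact hB
  refine Finset.eq_singleton_iff_unique_mem.2 ⟨hS, fun C hC => ?_⟩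
  by_contra hne
  have hd : Disjoint C S := π.1.disjoint hC hS hne
  exact π.1.ne_bot hC (hd.eq_bot_of_le (π.1.le hC))

/-- The moment-cumulant relation. -/
theorem moment_eq_sum_cumulantOf {κ : Type*} [DecidableEq κ] (m : Finset κ → ℂ)
    (S : Finset κ) (hS : S.Nonempty) :
    m S = ∑ π : Finpartition S, ∏ B ∈ π.parts, cumulantOf m B := by
  have hne : S ≠ ⊥ := hS.ne_empty
  have hu : ∀ π : Finpartition S, π.parts = {S} → π = Finpartition.indiscrete hne := by
    intro π h
    ext1
    simpa using h
  have hind : (Finpartition.indiscrete hne).parts = {S} := by simp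
  rw [← Finset.sum_filter_add_sum_filter_not Finset.univ
    (fun π : Finpartition S => π.parts = {S})]
  have h1 : Finset.univ.filter (fun π : Finpartition S => π.parts = {S})
      = {Finpartition.indiscrete hne} := by
    ext π
    simp only [Finset.mem_filter, Finset.mem_univ, true_and, Finset.mem_singleton]
    exact ⟨hu π, fun h => h ▸ hind⟩
  rw [h1, Finset.sum_singleton, hind, Finset.prod_singleton]
  conv_rhs => rw [cumulantOf]
  have h2 : ({π : Finpartition S | π.parts ≠ {S}}.toFinset)
      = Finset.univ.filter (fun π : Finpartition S => ¬ π.parts = {S}) := by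
    ext π; simp
  rw [h2, Finset.sum_attach _ (fun π : Finpartition S =>
    ∏ B ∈ π.parts.attach, cumulantOf m B.1)]
  have h3 : ∀ π : Finpartition S, ∏ B ∈ π.parts.attach, cumulantOf m B.1
      = ∏ B ∈ π.parts, cumulantOf m B := fun π => Finset.prod_attach _ _
  simp only [h3]
  ring

/-- The joint cumulant `⟨X₁ ⋯ X_N⟩_c` of complex random variables. -/
def jointCumulant {Ω : Type*} [MeasurableSpace Ω] (μ : Measure Ω) {N : ℕ}
    (X : Fin N → Ω → ℂ) : ℂ :=
  cumulantOf (fun S : Finset (Fin N) => ∫ ω, ∏ i ∈ S, X i ω ∂μ) Finset.univ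

/-! ### Homogeneous random fields in a periodic box, Fourier modes and polyspectra -/

/-- A real, statistically homogeneous random field of mean zero and with moments of every order,
in the box with side lengths `L` and periodic boundary conditions. -/
structure IsHomogeneousField {d : ℕ} (L : Fin d → ℝ) {Ω : Type*} [MeasurableSpace Ω]
    (μ : Measure Ω) (f : Ω → (Fin d → ℝ) → ℝ) : Prop where
  measurable : Measurable (Function.uncurry f)
  periodic : ∀ ω x i, f ω (x + Pi.single i (L i)) = f ω x
  moments : ∀ (x : Fin d → ℝ) (N : ℕ), Integrable (fun ω => f ω x ^ N) μ
  mean_zero : ∀ x, ∫ ω, f ω x ∂μ = 0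
  homogeneous : ∀ (a : Fin d → ℝ) (N : ℕ) (x : Fin N → Fin d → ℝ),
    μ.map (fun ω i => f ω (x i + a)) = μ.map (fun ω i => f ω (x i))

/-- The fundamental box. -/
def box {d : ℕ} (L : Fin d → ℝ) : Set (Fin d → ℝ) :=
  {x | ∀ i, x i ∈ Set.Ico 0 (L i)}

/-- The volume `V = L₁ ⋯ L_d` of the box. -/
def boxVolume {d : ℕ} (L : Fin d → ℝ) : ℝ := ∏ i, L i

/-- The wavevectors of the box: `kᵢ ∈ (2π / Lᵢ) ℤ`. -/
def IsWavevector {d : ℕ} (L : Fin d → ℝ) (k : Fin d → ℝ) : Prop :=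
  ∃ z : Fin d → ℤ, ∀ i, k i = 2 * Real.pi * z i / L i

/-- The volume-normalized Fourier coefficient `f_k = V^{-1/2} ∫ f(x) e^{-i k·x} dx`. -/
def fourierMode {d : ℕ} (L : Fin d → ℝ) {Ω : Type*} (f : Ω → (Fin d → ℝ) → ℝ)
    (k : Fin d → ℝ) (ω : Ω) : ℂ :=
  ((Real.sqrt (boxVolume L))⁻¹ : ℝ) *
    ∫ x in box L, (f ω x : ℂ) * Complex.exp (-Complex.I * ((k ⬝ᵥ x : ℝ) : ℂ))

/-- The power spectrum `P(k) = ⟨|f_k|²⟩`. -/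
def powerSpectrum {d : ℕ} (L : Fin d → ℝ) {Ω : Type*} [MeasurableSpace Ω] (μ : Measure Ω)
    (f : Ω → (Fin d → ℝ) → ℝ) (k : Fin d → ℝ) : ℝ :=
  ∫ ω, ‖fourierMode L f k ω‖ ^ 2 ∂μ

/-- The normalized Fourier coefficient `α_k = f_k / √P(k)`. -/
def normalizedMode {d : ℕ} (L : Fin d → ℝ) {Ω : Type*} [MeasurableSpace Ω] (μ : Measure Ω)
    (f : Ω → (Fin d → ℝ) → ℝ) (k : Fin d → ℝ) (ω : Ω) : ℂ :=
  fourierMode L f k ω / (Real.sqrt (powerSpectrum L μ f k) : ℝ)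

/-- The polyspectrum of order `N`, Kronecker delta included:
`⟨f_{k₁} ⋯ f_{k_N}⟩_c = V^{1 - N/2} δ_{k₁ + ⋯ + k_N} P^{(N)}`. -/
def polyspectrum {d : ℕ} (L : Fin d → ℝ) {Ω : Type*} [MeasurableSpace Ω] (μ : Measure Ω)
    (f : Ω → (Fin d → ℝ) → ℝ) {N : ℕ} (k : Fin N → Fin d → ℝ) : ℂ :=
  ((boxVolume L ^ ((N : ℝ) / 2 - 1) : ℝ) : ℂ) *
    jointCumulant μ (fun i => fourierMode L f (k i))

/-- The normalized polyspectrum `p^{(N)} = P^{(N)} / √(P(k₁) ⋯ P(k_N))`. -/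
def normalizedPolyspectrum {d : ℕ} (L : Fin d → ℝ) {Ω : Type*} [MeasurableSpace Ω]
    (μ : Measure Ω) (f : Ω → (Fin d → ℝ) → ℝ) {N : ℕ} (k : Fin N → Fin d → ℝ) : ℂ :=
  polyspectrum L μ f k / (Real.sqrt (∏ i, powerSpectrum L μ f (k i)) : ℝ)

/-! ### Two modes and the expansion in powers of `V^{-1/2}` -/

/-- Labels of the four modes `k₁, -k₁, k₂, -k₂`: `(j, true)` stands for `k_j` and
`(j, false)` for `-k_j`. -/
abbrev Mode : Type := Fin 2 × Bool

/-- The label of the opposite wavevector. -/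
def Mode.opp (s : Mode) : Mode := (s.1, !s.2)

/-- The wavevector with a given label. -/
def Mode.vec {d : ℕ} (k : Fin 2 → Fin d → ℝ) (s : Mode) : Fin d → ℝ :=
  if s.2 then k s.1 else -k s.1

/-- Values of the variables `α_{±k₁}, α_{±k₂}` at a point `(α_{k₁}, α_{k₂}) ∈ ℂ²`. -/
def modeValue (z : ℂ × ℂ) (s : Mode) : ℂ :=
  let w : ℂ := if s.1 = 0 then z.1 else z.2
  if s.2 then w else (starRingEnd ℂ) w

/-- The Gaussian density of `(α_{k₁}, α_{k₂})` with respect to Lebesgue measure on `ℂ²`. -/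
def gaussDensity (z : ℂ × ℂ) : ℝ :=
  (Real.pi ^ 2)⁻¹ * Real.exp (-‖z.1‖ ^ 2 - ‖z.2‖ ^ 2)

/-- `q ↦ P_G⁻¹ ∂/∂α_s (q P_G)` for `P_G ∝ exp (-α_{k₁} α_{-k₁} - α_{k₂} α_{-k₂})`, where the
four variables `α_{±k₁}, α_{±k₂}` are treated as independent. -/
def gaussDeriv (s : Mode) : Module.End ℂ (MvPolynomial Mode ℂ) :=
  (MvPolynomial.pderiv s).toLinearMap - LinearMap.mulLeft ℂ (MvPolynomial.X s.opp)

/-- `(-1)^N / N! ∑_{s₁, …, s_N} p^{(N)}(s₁, …, s_N) ∂/∂α_{s₁} ⋯ ∂/∂α_{s_N}`, acting on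
polynomials times `P_G`. -/
def cumulantOp (p : (N : ℕ) → (Fin N → Mode) → ℂ) (N : ℕ) :
    Module.End ℂ (MvPolynomial Mode ℂ) :=
  ((-1 : ℂ) ^ N / (N.factorial : ℂ)) •
    ∑ s : Fin N → Mode, p N s • (List.ofFn fun i => gaussDeriv (s i)).prod

/-- The formal power series `∑_{N ≥ 3} ε^{N - 2} cumulantOp p N` in `ε = V^{-1/2}`. -/
def cumulantSeries (p : (N : ℕ) → (Fin N → Mode) → ℂ) :
    PowerSeries (Module.End ℂ (MvPolynomial Mode ℂ)) :=
  PowerSeries.mk fun j => if j = 0 then 0 else cumulantOp p (j + 2)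

/-- The polynomial `Q_j` in the formal expansion
`P = exp (cumulantSeries p) P_G = (∑_j V^{-j/2} Q_j) P_G` of the joint distribution of the two
modes. As `cumulantSeries p` has no constant term, only its powers `r ≤ j` contribute. -/
def expansionCoeff (p : (N : ℕ) → (Fin N → Mode) → ℂ) (j : ℕ) : MvPolynomial Mode ℂ :=
  (∑ r ∈ Finset.range (j + 1),
    ((r.factorial : ℂ)⁻¹) • PowerSeries.coeff j (cumulantSeries p ^ r)) 1

/-- The function `q(α_{k₁}, α_{k₂}) P_G(α_{k₁}, α_{k₂})` on `ℂ²`. -/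
def polyGauss (q : MvPolynomial Mode ℂ) (z : ℂ × ℂ) : ℂ :=
  MvPolynomial.eval (modeValue z) q * (gaussDensity z : ℂ)

/-- Integration over the moduli of a function on `ℂ²`, in polar coordinates
`α_{k_j} = A_j e^{iθ_j}`: for a density on `ℂ²` this is the density of the phases. -/
def phaseMarginal {E : Type*} [NormedAddCommGroup E] [NormedSpace ℝ E] (F : ℂ × ℂ → E)
    (θ₁ θ₂ : ℝ) : E :=
  ∫ A₁ in Set.Ioi (0 : ℝ), ∫ A₂ in Set.Ioi (0 : ℝ),
    (A₁ * A₂) • F ((A₁ : ℂ) * Complex.exp (Complex.I * θ₁), (A₂ : ℂ) * Complex.exp (Complex.I * θ₂))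

/-- `C₂ = (2π)² P₂(θ₁, θ₂) - 1`, the deviation from random phases, for a density `ρ` of
`(α_{k₁}, α_{k₂})`. -/
def phaseDeviation (ρ : ℂ × ℂ → ℝ) (θ₁ θ₂ : ℝ) : ℝ :=
  (2 * Real.pi) ^ 2 * phaseMarginal ρ θ₁ θ₂ - 1

/-- The coefficient of `V^{-j/2}` in the formal expansion of the deviation `C₂`. -/
def phaseDeviationCoeff (p : (N : ℕ) → (Fin N → Mode) → ℂ) (j : ℕ) (θ₁ θ₂ : ℝ) : ℂ :=
  (2 * Real.pi : ℂ) ^ 2 * phaseMarginal (polyGauss (expansionCoeff p j)) θ₁ θ₂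
    - if j = 0 then 1 else 0

/-- `2 Γ(1 + n/2) Γ(1 + m/2) / (n! m!) * Re (P e^{-i(nθ₁ - mθ₂)})`; for real `P` the last factor
is `P cos (nθ₁ - mθ₂)`. -/
def leadingTerm (n m : ℕ) (P : ℂ) (θ₁ θ₂ : ℝ) : ℝ :=
  2 * Real.Gamma (1 + (n : ℝ) / 2) * Real.Gamma (1 + (m : ℝ) / 2) / (n.factorial * m.factorial) *
    (P * Complex.exp (-Complex.I * (n * θ₁ - m * θ₂))).re

/-- The densities `ρ i` have an asymptotic expansion in powers of `V_i^{-1/2}`, as `V_i → ∞` along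
`l`, of the form `P_G` times (unspecified) polynomials `q_j`; the remainders are uniform and decay
faster than any power of the modulus. -/
def HasVolumeExpansion {ι : Type*} (l : Filter ι) (V : ι → ℝ) (ρ : ι → ℂ × ℂ → ℝ)
    (q : ℕ → MvPolynomial Mode ℂ) : Prop :=
  ∀ J M : ℕ, ∃ K : ℝ, ∀ᶠ i in l, ∀ z : ℂ × ℂ,
    ‖(ρ i z : ℂ) - ∑ j ∈ Finset.range (J + 1),
        ((V i ^ (-((j : ℝ) / 2)) : ℝ) : ℂ) * polyGauss (q j) z‖
      ≤ K * V i ^ (-(((J : ℝ) + 1) / 2)) * ((1 + ‖z‖) ^ M)⁻¹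

end FourierModes

end

/-! Give the mode `±k₁` the charge `(±1, 0)` and `±k₂` the charge `(0, ±1)`. A monomial of charge
`c` depends on the phases only through `e^{i c·θ}`, so a neutral polynomial times the Gaussian has
uniform phases. By homogeneity a cumulant can be nonzero only if its momenta add up to zero; as `n
k₁ = m k₂` with `n`, `m` coprime, its charge is then `t (n, -m)` with an integer `t`. Each mode
carries one unit of `|c₁| + |c₂|`, so a charged cumulant has order at least `n + m`, and at order `n
+ m` only `t = ±1` is possible (`le_card_of_isResonant`, `eq_resonantCharge`). Since the cumulant of
order `N` comes with `V^{-(N-2)/2}`, the deviation starts at `V^{-(n+m-2)/2}`.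

Formal expansion: the cumulant operators of order below `n + m` preserve the charge. In the
coefficient of `V^{-(n+m-2)/2}` a product of two or more operators involves only these, so the
charged part comes from the linear term alone. It is `leadingPoly` (`exists_cumulantOp_eq`), and its
radial integrals are the Gamma functions. The neutral parts enter only through their Gaussian
expectations, which vanish for `j > 0` because they are expectations of total derivatives.

Actual densities: the polynomials `q_j` are not given, so they are identified by moments. With `ε =
V^{-1/2}`, the moments of the modes are exactly polynomials in `ε` (`modeMoment_eq_eval`);
integrating the expansion of the density against a monomial and comparing coefficients yields the
Gaussian moments of `q_j`. The charged ones vanish for `j < n + m - 2`, and for `j = n + m - 2` they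
are those of `leadingPoly`, since both sides obey the same Wick recursion
(`coeff_momentOf_eq_gaussExpect`). This determines the phase density of `q_j`: a polynomial of mass
zero orthogonal to all charged monomials has a charged part orthogonal to itself, hence zero, and
its neutral part sees only the mass (`marginalFunctional_eq_zero`). Neutral moments other than the
mass are never needed. -/

noncomputable section

namespace FourierModes

/-! ### Moments and cumulants -/

section Partitions

variable {κ R : Type*} [DecidableEq κ] [CommRing R]

/-- The moments belonging to a family of cumulants. -/
def momentOf (c : Finset κ → R) (S : Finset κ) : R :=
  ∑ π : Finpartition S, ∏ B ∈ π.parts, c B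

theorem momentOf_empty (c : Finset κ → R) : momentOf c ∅ = 1 := by
  have : Subsingleton (Finpartition (∅ : Finset κ)) :=
    inferInstanceAs (Subsingleton (Finpartition (⊥ : Finset κ)))
  unfold momentOf
  let π₀ : Finpartition (∅ : Finset κ) := Finpartition.empty (Finset κ)
  rw [Finset.sum_eq_single π₀ (fun π _ h => absurd (Subsingleton.elim π π₀) h)
    (fun h => absurd (Finset.mem_univ π₀) h)]
  rfl

theorem parts_avoid_of_mem {S B : Finset κ} (π : Finpartition S) (hB : B ∈ π.parts) :
    (π.avoid B).parts = π.parts.erase B := by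
  ext C
  rw [Finpartition.mem_avoid, Finset.mem_erase]
  constructor
  · rintro ⟨D, hD, hDB, rfl⟩
    have hne : D ≠ B := by rintro rfl; exact hDB le_rfl
    have hd : Disjoint D B := π.disjoint hD hB hne
    rw [Finset.sdiff_eq_self_of_disjoint hd]
    exact ⟨hne, hD⟩
  · rintro ⟨hne, hC⟩
    have hd : Disjoint C B := π.disjoint hC hB hne
    exact ⟨C, hC, fun h => π.ne_bot hC (hd.eq_bot_of_le h), Finset.sdiff_eq_self_of_disjoint hd⟩

/-- Deleting the block `B` and adjoining it again are inverse bijections between these partitions of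
`S` and the partitions of `S \ B`. -/
theorem sum_part_eq (c : Finset κ → R) {S B : Finset κ} {x : κ} (hx : x ∈ B) (hB : B ⊆ S) :
    ∑ π : Finpartition S with π.part x = B, ∏ C ∈ π.parts, c C
      = c B * momentOf c (S \ B) := by
  have hmem : ∀ π : Finpartition S, π.part x = B → B ∈ π.parts := fun π h => by
    rw [← h]; exact π.part_mem.2 (hB hx)
  have hne : B ≠ ⊥ := Finset.ne_empty_of_mem hx
  have hnot : ∀ π : Finpartition (S \ B), B ∉ π.parts := fun π h =>
    (Finset.mem_sdiff.1 (π.subset h hx)).2 hx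
  have hsup : S \ B ⊔ B = S := Finset.sdiff_union_of_subset hB
  unfold momentOf
  rw [Finset.mul_sum]
  refine Finset.sum_bij' (fun π _ => π.avoid B)
    (fun π _ => π.extend hne Finset.sdiff_disjoint hsup) ?_ ?_ ?_ ?_ ?_
  · intro π _; exact Finset.mem_univ _
  · intro π _
    rw [Finset.mem_filter]
    refine ⟨Finset.mem_univ _, Finpartition.part_eq_of_mem _ ?_ hx⟩
    simp
  · intro π h
    have h' := hmem π (Finset.mem_filter.1 h).2
    ext1
    simp [parts_avoid_of_mem π h', Finset.insert_erase h']
  · intro π _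
    ext1
    rw [parts_avoid_of_mem _ (by simp)]
    simp [Finset.erase_insert (hnot π)]
  · intro π h
    have h' := hmem π (Finset.mem_filter.1 h).2
    rw [parts_avoid_of_mem π h', Finset.mul_prod_erase _ _ h']

/-- The moment-cumulant recursion: sum over the block that contains a given label. -/
theorem momentOf_eq_sum (c : Finset κ → R) {S : Finset κ} {x : κ} (hx : x ∈ S) :
    momentOf c S = ∑ B ∈ S.powerset with x ∈ B, c B * momentOf c (S \ B) := by
  conv_lhs => unfold momentOf
  rw [← Finset.sum_fiberwise_of_maps_to (t := {B ∈ S.powerset | x ∈ B})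
    (g := fun π : Finpartition S => π.part x)]
  · refine Finset.sum_congr rfl fun B hB => ?_
    rw [Finset.mem_filter, Finset.mem_powerset] at hB
    exact sum_part_eq c hB.2 hB.1
  · intro π _
    rw [Finset.mem_filter, Finset.mem_powerset]
    exact ⟨π.part_subset x, π.mem_part_self.2 hx⟩

theorem map_momentOf {R' : Type*} [CommRing R'] (φ : R →+* R') (c : Finset κ → R)
    (S : Finset κ) : φ (momentOf c S) = momentOf (fun B => φ (c B)) S := by
  simp [momentOf, map_sum, map_prod]

theorem momentOf_congr {c c' : Finset κ → R} {S : Finset κ}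
    (h : ∀ B ⊆ S, B.Nonempty → c B = c' B) : momentOf c S = momentOf c' S :=
  Finset.sum_congr rfl fun π _ => Finset.prod_congr rfl fun _ hB =>
    h _ (π.subset hB) (π.nonempty_of_mem_parts hB)

theorem eq_momentOf_cumulantOf {m : Finset κ → ℂ} (h0 : m ∅ = 1) (S : Finset κ) :
    m S = momentOf (cumulantOf m) S := by
  rcases S.eq_empty_or_nonempty with rfl | hS
  · rw [h0, momentOf_empty]
  · exact moment_eq_sum_cumulantOf m S hS

theorem cumulantOf_recursion {m : Finset κ → ℂ} (h0 : m ∅ = 1) {S : Finset κ} {x : κ}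
    (hx : x ∈ S) : m S = ∑ B ∈ S.powerset with x ∈ B, cumulantOf m B * m (S \ B) := by
  rw [eq_momentOf_cumulantOf h0 S, momentOf_eq_sum _ hx]
  exact Finset.sum_congr rfl fun B _ => by rw [eq_momentOf_cumulantOf h0 (S \ B)]

/-- The cumulants are the unique solution of the recursion. -/
theorem cumulantOf_unique {m c : Finset κ → ℂ} (h0 : m ∅ = 1)
    (hc : ∀ S : Finset κ, ∀ x ∈ S, m S = ∑ B ∈ S.powerset with x ∈ B, c B * m (S \ B))
    {S : Finset κ} (hS : S.Nonempty) : cumulantOf m S = c S := by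
  induction S using Finset.strongInduction with
  | H S ih =>
    obtain ⟨x, hx⟩ := hS
    have e := (cumulantOf_recursion h0 hx).symm.trans (hc S x hx)
    have hmem : S ∈ {B ∈ S.powerset | x ∈ B} := by simp [hx]
    -- The term `B = S` holds the unknown cumulant with factor `m ∅ = 1`; all the others are known
    -- by induction.
    rw [← Finset.add_sum_erase _ _ hmem, ← Finset.add_sum_erase _ _ hmem, Finset.sdiff_self,
      h0, mul_one, mul_one] at e
    have e' : ∀ B ∈ ({B ∈ S.powerset | x ∈ B}).erase S,
        cumulantOf m B * m (S \ B) = c B * m (S \ B) := by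
      intro B hB
      simp only [Finset.mem_erase, Finset.mem_filter, Finset.mem_powerset] at hB
      rw [ih B (hB.2.1.ssubset_of_ne hB.1) ⟨x, hB.2.2⟩]
    rw [Finset.sum_congr rfl e'] at e
    exact add_right_cancel e

/-- Relabelling lets the cumulant of a block inside a larger label set be read as a cumulant of a
tuple indexed by `Fin N`. -/
theorem cumulantOf_map {κ' : Type*} [DecidableEq κ'] (e : κ ↪ κ') {m : Finset κ' → ℂ}
    (h0 : m ∅ = 1) {S : Finset κ} (hS : S.Nonempty) :
    cumulantOf (fun T : Finset κ => m (T.map e)) S = cumulantOf m (S.map e) := by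
  refine cumulantOf_unique (c := fun T => cumulantOf m (T.map e)) (by simpa using h0) ?_ hS
  intro S x hx
  rw [cumulantOf_recursion h0 (Finset.mem_map_of_mem e hx)]
  symm
  refine Finset.sum_bij (fun B _ => B.map e) ?_ ?_ ?_ ?_
  · intro B hB
    simpa using hB
  · intro B _ B' _ h
    exact Finset.map_injective e h
  · intro B hB
    simp only [Finset.mem_filter, Finset.mem_powerset] at hB
    obtain ⟨T, hT, rfl⟩ := Finset.subset_map_iff.1 hB.1
    exact ⟨T, by simpa [hT] using hB.2, rfl⟩
  · intro B _
    rw [Finset.map_sdiff]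

/-- The weights factor through the recursion; this carries the normalization from `f_k` to `α_k`. -/
theorem cumulantOf_smul {m : Finset κ → ℂ} (h0 : m ∅ = 1) (w : κ → ℂ) {S : Finset κ}
    (hS : S.Nonempty) :
    cumulantOf (fun T => (∏ i ∈ T, w i) * m T) S = (∏ i ∈ S, w i) * cumulantOf m S := by
  refine cumulantOf_unique (c := fun T => (∏ i ∈ T, w i) * cumulantOf m T)
    (by simpa using h0) ?_ hS
  intro S x hx
  rw [cumulantOf_recursion h0 hx, Finset.mul_sum]
  refine Finset.sum_congr rfl fun B hB => ?_
  simp only [Finset.mem_filter, Finset.mem_powerset] at hB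
  rw [← Finset.prod_sdiff hB.1]
  ring

theorem cumulantOf_conj {m : Finset κ → ℂ} (h0 : m ∅ = 1) {S : Finset κ} (hS : S.Nonempty) :
    cumulantOf (fun T => (starRingEnd ℂ) (m T)) S = (starRingEnd ℂ) (cumulantOf m S) := by
  refine cumulantOf_unique (c := fun T => (starRingEnd ℂ) (cumulantOf m T))
    (by simp [h0]) ?_ hS
  intro S x hx
  rw [cumulantOf_recursion h0 hx]
  simp [map_sum]

/-- If the moments of labels with nonvanishing total momentum vanish, so do the cumulants. -/
theorem cumulantOf_eq_zero {G : Type*} [AddCommGroup G] {m : Finset κ → ℂ} (h0 : m ∅ = 1)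
    (v : κ → G) (hm : ∀ S, ∑ i ∈ S, v i ≠ 0 → m S = 0) {S : Finset κ}
    (hS : ∑ i ∈ S, v i ≠ 0) : cumulantOf m S = 0 := by
  induction S using Finset.strongInduction with
  | H S ih =>
    have hne : S.Nonempty := by
      rw [Finset.nonempty_iff_ne_empty]; rintro rfl; simp at hS
    obtain ⟨x, hx⟩ := hne
    have e := cumulantOf_recursion h0 hx
    have hmem : S ∈ {B ∈ S.powerset | x ∈ B} := by simp [hx]
    rw [← Finset.add_sum_erase _ _ hmem, Finset.sdiff_self, h0, mul_one, hm S hS,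
      Finset.sum_eq_zero, add_zero] at e
    · exact e.symm
    · intro B hB
      simp only [Finset.mem_erase, Finset.mem_filter, Finset.mem_powerset] at hB
      -- Momentum is additive: either the block or its complement has nonvanishing momentum.
      by_cases hv : ∑ i ∈ B, v i = 0
      · rw [hm (S \ B), mul_zero]
        rw [← Finset.sum_sdiff hB.2.1, hv, add_zero] at hS
        exact hS
      · rw [ih B (hB.2.1.ssubset_of_ne hB.1) hv, zero_mul]

end Partitions

/-! ### Functions of two modes of rapid decay and their phase marginals -/

/-- A weight on `ℂ²` that makes moduli integrable. -/
def decayWeight (z : ℂ × ℂ) : ℝ := ((1 + ‖z.1‖) ^ 4)⁻¹ * ((1 + ‖z.2‖) ^ 4)⁻¹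

theorem integrable_decayWeight : Integrable decayWeight := by
  have h : Integrable (fun z : ℂ => ((1 + ‖z‖) ^ 4)⁻¹) := by
    have := integrable_one_add_norm (E := ℂ) (μ := volume) (r := 4)
      (by rw [Complex.finrank_real_complex]; norm_num)
    refine this.congr (ae_of_all _ fun z => ?_)
    simp only
    rw [Real.rpow_neg (by positivity)]
    norm_cast
  exact h.mul_prod h

/-- Measurable functions on `ℂ²` bounded by a multiple of `decayWeight`. -/
def HasDecay (F : ℂ × ℂ → ℂ) (C : ℝ) : Prop :=
  Measurable F ∧ ∀ z, ‖F z‖ ≤ C * decayWeight z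

theorem HasDecay.integrable {F : ℂ × ℂ → ℂ} {C : ℝ} (h : HasDecay F C) : Integrable F :=
  (integrable_decayWeight.const_mul C).mono' h.1.aestronglyMeasurable (ae_of_all _ h.2)

theorem HasDecay.add {F G : ℂ × ℂ → ℂ} {C D : ℝ} (hF : HasDecay F C) (hG : HasDecay G D) :
    HasDecay (fun z => F z + G z) (C + D) :=
  ⟨hF.1.add hG.1, fun z => (norm_add_le _ _).trans (by
    rw [add_mul]; exact add_le_add (hF.2 z) (hG.2 z))⟩

theorem HasDecay.const_mul {F : ℂ × ℂ → ℂ} {C : ℝ} (hF : HasDecay F C) (c : ℂ) :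
    HasDecay (fun z => c * F z) (‖c‖ * C) :=
  ⟨hF.1.const_mul c, fun z => by
    rw [norm_mul, mul_assoc]; exact mul_le_mul_of_nonneg_left (hF.2 z) (norm_nonneg c)⟩

/-- The point of `ℂ²` with given moduli and phases. -/
def polarPoint (θ₁ θ₂ : ℝ) (A : ℝ × ℝ) : ℂ × ℂ :=
  ((A.1 : ℂ) * Complex.exp (Complex.I * θ₁), (A.2 : ℂ) * Complex.exp (Complex.I * θ₂))

theorem continuous_polarPoint (θ₁ θ₂ : ℝ) : Continuous (polarPoint θ₁ θ₂) := by
  unfold polarPoint; fun_prop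

/-- The quadrant of positive moduli. -/
abbrev quadrant : Set (ℝ × ℝ) := Set.Ioi 0 ×ˢ Set.Ioi 0

theorem norm_real_mul_exp (A θ : ℝ) : ‖(A : ℂ) * Complex.exp (Complex.I * θ)‖ = |A| := by
  rw [norm_mul, mul_comm Complex.I, Complex.norm_exp_ofReal_mul_I, mul_one, Complex.norm_real,
    Real.norm_eq_abs]

/-- A majorant of the modulus integrand. -/
def modulusWeight (A : ℝ × ℝ) : ℝ := ((1 + ‖A.1‖) ^ 3)⁻¹ * ((1 + ‖A.2‖) ^ 3)⁻¹

theorem integrable_modulusWeight : Integrable modulusWeight := by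
  have h : Integrable (fun z : ℝ => ((1 + ‖z‖) ^ 3)⁻¹) := by
    have := integrable_one_add_norm (E := ℝ) (μ := volume) (r := 3)
      (by rw [Module.finrank_self]; norm_num)
    refine this.congr (ae_of_all _ fun z => ?_)
    simp only
    rw [Real.rpow_neg (by positivity)]
    norm_cast
  exact h.mul_prod h

/-- The Jacobian `A₁ A₂` costs one power of decay in each modulus, which leaves the integrable
exponent 3 out of 4. -/
theorem HasDecay.norm_polar_le {F : ℂ × ℂ → ℂ} {C : ℝ} (h : HasDecay F C) (θ₁ θ₂ : ℝ)
    (A : ℝ × ℝ) :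
    ‖(A.1 * A.2) • F (polarPoint θ₁ θ₂ A)‖ ≤ C * modulusWeight A := by
  have h1 := h.2 (polarPoint θ₁ θ₂ A)
  have hC : 0 ≤ C := by
    have := (norm_nonneg _).trans (h.2 0)
    simpa [decayWeight] using this
  rw [norm_smul, norm_mul]
  simp only [decayWeight, polarPoint, norm_real_mul_exp, ← Real.norm_eq_abs] at h1
  have key : ∀ x : ℝ, 0 ≤ x → x * ((1 + x) ^ 4)⁻¹ ≤ ((1 + x) ^ 3)⁻¹ := by
    intro x hx
    rw [← div_eq_mul_inv, inv_eq_one_div, div_le_div_iff₀ (by positivity) (by positivity)]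
    have : 0 ≤ (1 + x) ^ 3 := by positivity
    nlinarith
  calc ‖A.1‖ * ‖A.2‖ * ‖F (polarPoint θ₁ θ₂ A)‖
      ≤ ‖A.1‖ * ‖A.2‖ * (C * (((1 + ‖A.1‖) ^ 4)⁻¹ * ((1 + ‖A.2‖) ^ 4)⁻¹)) :=
        mul_le_mul_of_nonneg_left h1 (by positivity)
    _ = C * ((‖A.1‖ * ((1 + ‖A.1‖) ^ 4)⁻¹) * (‖A.2‖ * ((1 + ‖A.2‖) ^ 4)⁻¹)) := by ring
    _ ≤ C * modulusWeight A := by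
        refine mul_le_mul_of_nonneg_left ?_ hC
        exact mul_le_mul (key _ (norm_nonneg _)) (key _ (norm_nonneg _)) (by positivity)
          (by positivity)

theorem HasDecay.integrable_polar {F : ℂ × ℂ → ℂ} {C : ℝ} (h : HasDecay F C) (θ₁ θ₂ : ℝ) :
    Integrable (fun A : ℝ × ℝ => (A.1 * A.2) • F (polarPoint θ₁ θ₂ A)) := by
  refine (integrable_modulusWeight.const_mul C).mono' ?_
    (ae_of_all _ (h.norm_polar_le θ₁ θ₂))
  refine Measurable.aestronglyMeasurable ?_
  exact (measurable_fst.mul measurable_snd).smul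
    (h.1.comp (continuous_polarPoint θ₁ θ₂).measurable)

theorem HasDecay.phaseMarginal_eq {F : ℂ × ℂ → ℂ} {C : ℝ} (h : HasDecay F C) (θ₁ θ₂ : ℝ) :
    phaseMarginal F θ₁ θ₂
      = ∫ A in quadrant, (A.1 * A.2) • F (polarPoint θ₁ θ₂ A) := by
  unfold phaseMarginal
  rw [Measure.volume_eq_prod, setIntegral_prod _ ((h.integrable_polar θ₁ θ₂).integrableOn)]
  rfl

theorem HasDecay.phaseMarginal_add {F G : ℂ × ℂ → ℂ} {C D : ℝ} (hF : HasDecay F C)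
    (hG : HasDecay G D) (θ₁ θ₂ : ℝ) :
    phaseMarginal (fun z => F z + G z) θ₁ θ₂
      = phaseMarginal F θ₁ θ₂ + phaseMarginal G θ₁ θ₂ := by
  rw [(hF.add hG).phaseMarginal_eq, hF.phaseMarginal_eq, hG.phaseMarginal_eq,
    ← integral_add (hF.integrable_polar θ₁ θ₂).integrableOn
      (hG.integrable_polar θ₁ θ₂).integrableOn]
  simp only [smul_add]

theorem phaseMarginal_const_mul (c : ℂ) (F : ℂ × ℂ → ℂ) (θ₁ θ₂ : ℝ) :
    phaseMarginal (fun z => c * F z) θ₁ θ₂ = c * phaseMarginal F θ₁ θ₂ := by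
  unfold phaseMarginal
  rw [← integral_const_mul]
  congr 1 with A₁
  rw [← integral_const_mul]
  congr 1 with A₂
  rw [mul_smul_comm]

theorem HasDecay.norm_phaseMarginal_le {F : ℂ × ℂ → ℂ} {C : ℝ} (h : HasDecay F C)
    (θ₁ θ₂ : ℝ) :
    ‖phaseMarginal F θ₁ θ₂‖ ≤ C * ∫ A in quadrant, modulusWeight A := by
  rw [h.phaseMarginal_eq, ← integral_const_mul]
  exact norm_integral_le_of_norm_le (integrable_modulusWeight.const_mul C).integrableOn
    (ae_of_all _ (h.norm_polar_le θ₁ θ₂))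

/-! ### Polynomials times the Gaussian density -/

theorem continuous_modeValue (s : Mode) : Continuous fun z => modeValue z s := by
  rcases s with ⟨i, b⟩
  fin_cases i <;> cases b <;> simp [modeValue] <;> fun_prop

theorem norm_modeValue_le (z : ℂ × ℂ) (s : Mode) :
    ‖modeValue z s‖ ≤ (1 + ‖z.1‖) * (1 + ‖z.2‖) := by
  have h1 := norm_nonneg z.1
  have h2 := norm_nonneg z.2
  rcases s with ⟨i, b⟩
  fin_cases i <;> cases b <;> simp [modeValue] <;> nlinarith

theorem continuous_eval_modeValue (q : MvPolynomial Mode ℂ) :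
    Continuous fun z => MvPolynomial.eval (modeValue z) q := by
  have : Continuous fun z => modeValue z := continuous_pi continuous_modeValue
  exact (MvPolynomial.continuous_eval q).comp this

theorem continuous_gaussDensity : Continuous gaussDensity := by
  unfold gaussDensity; fun_prop

theorem exists_norm_eval_le (q : MvPolynomial Mode ℂ) :
    ∃ C : ℝ, 0 ≤ C ∧ ∃ k : ℕ, ∀ z, ‖MvPolynomial.eval (modeValue z) q‖
      ≤ C * ((1 + ‖z.1‖) * (1 + ‖z.2‖)) ^ k := by
  have hone : ∀ z : ℂ × ℂ, 1 ≤ (1 + ‖z.1‖) * (1 + ‖z.2‖) := fun z => by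
    nlinarith [norm_nonneg z.1, norm_nonneg z.2, mul_nonneg (norm_nonneg z.1) (norm_nonneg z.2)]
  induction q using MvPolynomial.induction_on with
  | C a => exact ⟨‖a‖, norm_nonneg _, 0, fun z => by simp⟩
  | add p q hp hq =>
    obtain ⟨C, hC, k, h⟩ := hp
    obtain ⟨D, hD, l, h'⟩ := hq
    refine ⟨C + D, by positivity, max k l, fun z => ?_⟩
    rw [map_add, add_mul]
    refine (norm_add_le _ _).trans (add_le_add ((h z).trans ?_) ((h' z).trans ?_))
    · exact mul_le_mul_of_nonneg_left (pow_le_pow_right₀ (hone z) (le_max_left _ _)) hC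
    · exact mul_le_mul_of_nonneg_left (pow_le_pow_right₀ (hone z) (le_max_right _ _)) hD
  | mul_X p s hp =>
    obtain ⟨C, hC, k, h⟩ := hp
    refine ⟨C, hC, k + 1, fun z => ?_⟩
    rw [map_mul, MvPolynomial.eval_X, norm_mul, pow_succ, ← mul_assoc]
    exact mul_le_mul (h z) (norm_modeValue_le z s) (norm_nonneg _) (by positivity)

theorem one_add_pow_mul_exp_le (K : ℕ) {x : ℝ} (hx : 0 ≤ x) :
    (1 + x) ^ K * Real.exp (-x ^ 2) ≤ K.factorial * Real.exp 2 := by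
  have h1 : (1 + x) ^ K ≤ K.factorial * Real.exp (1 + x) := by
    have := Real.pow_div_factorial_le_exp (1 + x) (by positivity) K
    rwa [div_le_iff₀ (by positivity), mul_comm] at this
  calc (1 + x) ^ K * Real.exp (-x ^ 2) ≤ K.factorial * Real.exp (1 + x) * Real.exp (-x ^ 2) := by
        gcongr
    _ = K.factorial * Real.exp (1 + x - x ^ 2) := by
        rw [mul_assoc, ← Real.exp_add]; ring_nf
    _ ≤ _ := by
        gcongr
        -- `1 + x - x² = 5/4 - (x - 1/2)² ≤ 2`.
        nlinarith [sq_nonneg (x - 1/2)]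

theorem exp_neg_sq_sub_sq (x y : ℝ) :
    Real.exp (-x ^ 2 - y ^ 2) = Real.exp (-x ^ 2) * Real.exp (-y ^ 2) := by
  rw [← Real.exp_add, sub_eq_add_neg]

theorem exists_hasDecay_polyGauss (q : MvPolynomial Mode ℂ) : ∃ C, HasDecay (polyGauss q) C := by
  obtain ⟨C, hC, k, h⟩ := exists_norm_eval_le q
  -- In each variable the Gaussian has to absorb `k` powers from the polynomial and 4 from
  -- `decayWeight`.
  refine ⟨C * ((Real.pi ^ 2)⁻¹ * ((k + 4).factorial * Real.exp 2) ^ 2), ?_, fun z => ?_⟩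
  · unfold polyGauss
    exact ((continuous_eval_modeValue q).mul
      (Complex.continuous_ofReal.comp continuous_gaussDensity)).measurable
  · unfold polyGauss gaussDensity decayWeight
    rw [norm_mul, Complex.norm_real, Real.norm_eq_abs, abs_of_nonneg (by positivity)]
    have e1 := one_add_pow_mul_exp_le (k + 4) (norm_nonneg z.1)
    have e2 := one_add_pow_mul_exp_le (k + 4) (norm_nonneg z.2)
    rw [← mul_inv, ← div_eq_mul_inv _ (_ * _), le_div_iff₀ (by positivity)]
    calc _ ≤ C * ((1 + ‖z.1‖) * (1 + ‖z.2‖)) ^ k *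
          ((Real.pi ^ 2)⁻¹ * Real.exp (-‖z.1‖ ^ 2 - ‖z.2‖ ^ 2)) *
            ((1 + ‖z.1‖) ^ 4 * (1 + ‖z.2‖) ^ 4) := by
          gcongr
          exact h z
      _ = C * ((Real.pi ^ 2)⁻¹ * (((1 + ‖z.1‖) ^ (k + 4) * Real.exp (-‖z.1‖ ^ 2)) *
          ((1 + ‖z.2‖) ^ (k + 4) * Real.exp (-‖z.2‖ ^ 2)))) := by
          rw [exp_neg_sq_sub_sq]
          generalize 1 + ‖z.1‖ = x, 1 + ‖z.2‖ = y
          ring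
      _ ≤ C * ((Real.pi ^ 2)⁻¹ * (((k + 4).factorial * Real.exp 2) *
          ((k + 4).factorial * Real.exp 2))) := by gcongr
      _ = _ := by ring

theorem polyGauss_add (p q : MvPolynomial Mode ℂ) :
    polyGauss (p + q) = fun z => polyGauss p z + polyGauss q z := by
  ext z; simp [polyGauss, add_mul]

theorem polyGauss_smul (c : ℂ) (q : MvPolynomial Mode ℂ) :
    polyGauss (c • q) = fun z => c * polyGauss q z := by
  ext z; simp [polyGauss, mul_assoc]

/-- The phase marginal of a polynomial times the Gaussian density, as a linear functional. -/
def marginalFunctional (θ₁ θ₂ : ℝ) : MvPolynomial Mode ℂ →ₗ[ℂ] ℂ where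
  toFun q := phaseMarginal (polyGauss q) θ₁ θ₂
  map_add' p q := by
    obtain ⟨C, hC⟩ := exists_hasDecay_polyGauss p
    obtain ⟨D, hD⟩ := exists_hasDecay_polyGauss q
    rw [polyGauss_add, hC.phaseMarginal_add hD]
  map_smul' c q := by
    rw [polyGauss_smul, phaseMarginal_const_mul]; rfl

/-- The Gaussian expectation of a polynomial, as a linear functional. -/
def gaussExpect : MvPolynomial Mode ℂ →ₗ[ℂ] ℂ where
  toFun q := ∫ z, polyGauss q z
  map_add' p q := by
    obtain ⟨C, hC⟩ := exists_hasDecay_polyGauss p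
    obtain ⟨D, hD⟩ := exists_hasDecay_polyGauss q
    rw [polyGauss_add, integral_add hC.integrable hD.integrable]
  map_smul' c q := by
    rw [polyGauss_smul, integral_const_mul]; rfl

theorem eval_monomial_modeValue (a : Mode →₀ ℕ) (c : ℂ) (z : ℂ × ℂ) :
    MvPolynomial.eval (modeValue z) (MvPolynomial.monomial a c)
      = c * ((z.1 ^ a (0, true) * (starRingEnd ℂ) z.1 ^ a (0, false)) *
        (z.2 ^ a (1, true) * (starRingEnd ℂ) z.2 ^ a (1, false))) := by
  rw [MvPolynomial.eval_monomial, Finsupp.prod_fintype _ _ (by simp), Fintype.prod_prod_type,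
    Fin.prod_univ_two, Fintype.prod_bool, Fintype.prod_bool]
  simp [modeValue]

/-- The source of the Gamma functions: one power of `A` is the Jacobian, the other `k` are the
degree of a monomial in one mode. -/
theorem integral_pow_mul_exp_neg_sq (k : ℕ) :
    ∫ A in Set.Ioi (0 : ℝ), ((A ^ (k + 1) * Real.exp (-A ^ 2) : ℝ) : ℂ)
      = ((Real.Gamma (1 + (k : ℝ) / 2) / 2 : ℝ) : ℂ) := by
  rw [integral_complex_ofReal]
  congr 1
  have h := integral_rpow_mul_exp_neg_rpow (p := 2) (q := (k : ℝ) + 1) (by norm_num)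
    (by have : (0 : ℝ) ≤ k := by positivity
        linarith)
  have e : ((k : ℝ) + 1 + 1) / 2 = 1 + (k : ℝ) / 2 := by ring
  rw [e] at h
  rw [div_eq_inv_mul, ← one_div, ← h]
  refine setIntegral_congr_fun measurableSet_Ioi fun x _ => ?_
  norm_cast

/-- The one-mode factor of the phase marginal of a monomial. -/
def modulusFactor (a b : ℕ) (θ : ℝ) : ℂ :=
  Complex.exp (Complex.I * (((a : ℂ) - b) * θ)) *
    ((Real.Gamma (1 + ((a + b : ℕ) : ℝ) / 2) / 2 : ℝ) : ℂ)

theorem polar_pow_mul_conj_pow (a b : ℕ) (A θ : ℝ) :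
    ((A : ℂ) * Complex.exp (Complex.I * θ)) ^ a *
      (starRingEnd ℂ) ((A : ℂ) * Complex.exp (Complex.I * θ)) ^ b
      = (A : ℂ) ^ (a + b) * Complex.exp (Complex.I * (((a : ℂ) - b) * θ)) := by
  rw [map_mul, Complex.conj_ofReal, ← Complex.exp_conj, map_mul, Complex.conj_I,
    Complex.conj_ofReal, mul_pow, mul_pow, ← Complex.exp_nat_mul, ← Complex.exp_nat_mul, pow_add]
  have : Complex.exp (Complex.I * (((a : ℂ) - b) * θ))
      = Complex.exp (a * (Complex.I * θ)) * Complex.exp (b * (-Complex.I * θ)) := by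
    rw [← Complex.exp_add]; ring_nf
  rw [this]; ring

theorem marginalFunctional_monomial (θ₁ θ₂ : ℝ) (a : Mode →₀ ℕ) (c : ℂ) :
    marginalFunctional θ₁ θ₂ (MvPolynomial.monomial a c)
      = c * ((Real.pi ^ 2)⁻¹ : ℝ) * (modulusFactor (a (0, true)) (a (0, false)) θ₁ *
        modulusFactor (a (1, true)) (a (1, false)) θ₂) := by
  change phaseMarginal _ _ _ = _
  unfold phaseMarginal
  have hfac : ∀ A₁ A₂ : ℝ, (A₁ * A₂) • polyGauss (MvPolynomial.monomial a c)
      ((A₁ : ℂ) * Complex.exp (Complex.I * θ₁), (A₂ : ℂ) * Complex.exp (Complex.I * θ₂))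
      = (c * ((Real.pi ^ 2)⁻¹ : ℝ) *
        (Complex.exp (Complex.I * (((a (0, true) : ℂ) - a (0, false)) * θ₁)) *
          Complex.exp (Complex.I * (((a (1, true) : ℂ) - a (1, false)) * θ₂))) *
        ((A₁ ^ (a (0, true) + a (0, false) + 1) * Real.exp (-A₁ ^ 2) : ℝ) : ℂ)) *
        ((A₂ ^ (a (1, true) + a (1, false) + 1) * Real.exp (-A₂ ^ 2) : ℝ) : ℂ) := by
    intro A₁ A₂
    unfold polyGauss gaussDensity
    rw [eval_monomial_modeValue, polar_pow_mul_conj_pow, polar_pow_mul_conj_pow,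
      norm_real_mul_exp, norm_real_mul_exp, sq_abs, sq_abs, exp_neg_sq_sub_sq,
      Complex.real_smul]
    push_cast
    ring
  simp only [hfac]
  simp_rw [integral_const_mul, integral_mul_const, integral_const_mul,
    integral_pow_mul_exp_neg_sq]
  unfold modulusFactor
  push_cast
  ring

theorem integral_pow_mul_conj_pow_mul_exp (a b : ℕ) :
    ∫ z : ℂ, z ^ a * (starRingEnd ℂ) z ^ b * (Real.exp (-‖z‖ ^ 2) : ℂ)
      = if a = b then (Real.pi * a.factorial : ℂ) else 0 := by
  rw [← Complex.integral_comp_polarCoord_symm]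
  have hfac : ∀ p : ℝ × ℝ, p.1 • ((Complex.polarCoord.symm p) ^ a *
      (starRingEnd ℂ) (Complex.polarCoord.symm p) ^ b *
        (Real.exp (-‖Complex.polarCoord.symm p‖ ^ 2) : ℂ))
      = ((p.1 ^ (a + b + 1) * Real.exp (-p.1 ^ 2) : ℝ) : ℂ) *
        Complex.exp (Complex.I * (((a : ℂ) - b) * p.2)) := by
    intro p
    have : Complex.polarCoord.symm p = (p.1 : ℂ) * Complex.exp (Complex.I * p.2) := by
      rw [Complex.polarCoord_symm_apply, mul_comm Complex.I, Complex.exp_mul_I]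
      push_cast; rfl
    rw [this, polar_pow_mul_conj_pow, norm_real_mul_exp, sq_abs, Complex.real_smul]
    push_cast
    ring
  simp only [hfac]
  rw [polarCoord_target, Measure.volume_eq_prod, setIntegral_prod_mul
    (fun r : ℝ => ((r ^ (a + b + 1) * Real.exp (-r ^ 2) : ℝ) : ℂ))
    (fun t : ℝ => Complex.exp (Complex.I * (((a : ℂ) - b) * t))), integral_pow_mul_exp_neg_sq]
  split_ifs with h
  · subst h
    have : (1 + ((a + a : ℕ) : ℝ) / 2) = (a : ℝ) + 1 := by push_cast; ring
    rw [this, Real.Gamma_nat_eq_factorial]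
    simp
    ring_nf
    rw [max_eq_left (by positivity)]
    push_cast
    ring
  · have hne : (a : ℂ) - b ≠ 0 := sub_ne_zero.2 (by exact_mod_cast h)
    rw [← integral_Ioc_eq_integral_Ioo, ← intervalIntegral.integral_of_le (by linarith [Real.pi_pos])]
    have : ∀ t : ℝ, Complex.exp (Complex.I * (((a : ℂ) - b) * t))
        = Complex.exp ((Complex.I * ((a : ℂ) - b)) * t) := fun t => by ring_nf
    simp only [this]
    rw [integral_exp_mul_complex (mul_ne_zero Complex.I_ne_zero hne)]
    -- For `a ≠ b` the angular integrand has a periodic antiderivative, so its integral over a full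
    -- turn vanishes.
    have hper : Complex.exp (Complex.I * ((a : ℂ) - b) * (Real.pi : ℝ))
        = Complex.exp (Complex.I * ((a : ℂ) - b) * ((-Real.pi : ℝ) : ℂ)) := by
      rw [Complex.exp_eq_exp_iff_exists_int]
      exact ⟨(a : ℤ) - b, by push_cast; ring⟩
    rw [hper]
    simp

/-- The Gaussian expectation of a monomial. -/
theorem gaussExpect_monomial (a : Mode →₀ ℕ) (c : ℂ) :
    gaussExpect (MvPolynomial.monomial a c)
      = c * ((if a (0, true) = a (0, false) then ((a (0, true)).factorial : ℂ) else 0) *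
        (if a (1, true) = a (1, false) then ((a (1, true)).factorial : ℂ) else 0)) := by
  change ∫ z, polyGauss _ z = _
  have hfac : ∀ z : ℂ × ℂ, polyGauss (MvPolynomial.monomial a c) z
      = (c * ((Real.pi ^ 2)⁻¹ : ℝ)) *
        ((z.1 ^ a (0, true) * (starRingEnd ℂ) z.1 ^ a (0, false) * (Real.exp (-‖z.1‖ ^ 2) : ℂ)) *
        (z.2 ^ a (1, true) * (starRingEnd ℂ) z.2 ^ a (1, false) *
          (Real.exp (-‖z.2‖ ^ 2) : ℂ))) := by
    intro z
    unfold polyGauss gaussDensity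
    rw [eval_monomial_modeValue, exp_neg_sq_sub_sq]
    push_cast
    ring
  simp only [hfac]
  rw [integral_const_mul, Measure.volume_eq_prod, integral_prod_mul
    (fun z : ℂ => z ^ a (0, true) * (starRingEnd ℂ) z ^ a (0, false) *
      (Real.exp (-‖z‖ ^ 2) : ℂ))
    (fun z : ℂ => z ^ a (1, true) * (starRingEnd ℂ) z ^ a (1, false) *
      (Real.exp (-‖z‖ ^ 2) : ℂ)),
    integral_pow_mul_conj_pow_mul_exp, integral_pow_mul_conj_pow_mul_exp]
  have hpi : (Real.pi : ℂ) ≠ 0 := by exact_mod_cast Real.pi_ne_zero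
  split_ifs <;> push_cast <;> field_simp <;> ring

/-! ### The charge grading -/

/-- The charges of a mode with respect to independent phase rotations of the two wavevectors. -/
def Mode.charge (s : Mode) : ℤ × ℤ :=
  if s.1 = 0 then (if s.2 then 1 else -1, 0) else (0, if s.2 then 1 else -1)

theorem Mode.charge_opp (s : Mode) : s.opp.charge = -s.charge := by
  rcases s with ⟨i, b⟩
  fin_cases i <;> cases b <;> simp [Mode.charge, Mode.opp]

theorem Mode.opp_opp (s : Mode) : s.opp.opp = s := by simp [Mode.opp]

theorem weight_charge (a : Mode →₀ ℕ) : Finsupp.weight Mode.charge a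
    = ((a (0, true) : ℤ) - a (0, false), (a (1, true) : ℤ) - a (1, false)) := by
  rw [Finsupp.weight_apply, Finsupp.sum_fintype _ _ (by simp), Fintype.sum_prod_type,
    Fin.sum_univ_two, Fintype.sum_bool, Fintype.sum_bool]
  simp [Mode.charge]
  constructor <;> ring

theorem gaussExpect_monomial_of_charged {a : Mode →₀ ℕ}
    (ha : Finsupp.weight Mode.charge a ≠ 0) (c : ℂ) :
    gaussExpect (MvPolynomial.monomial a c) = 0 := by
  rw [gaussExpect_monomial]
  rw [weight_charge] at ha
  split_ifs with h1 h2
  · exact absurd (by simp [h1, h2]) ha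
  all_goals simp

theorem gaussExpect_of_charged {q : MvPolynomial Mode ℂ} {c : ℤ × ℤ} (hc : c ≠ 0)
    (hq : q.IsWeightedHomogeneous Mode.charge c) : gaussExpect q = 0 := by
  rw [q.as_sum, map_sum]
  refine Finset.sum_eq_zero fun a ha => gaussExpect_monomial_of_charged ?_ _
  rw [hq (MvPolynomial.mem_support_iff.1 ha)]
  exact hc

/-- A neutral monomial is a function of the moduli alone, so its mass is spread evenly over the
torus of phases, of area `(2π)²`. -/
theorem marginalFunctional_of_neutral {q : MvPolynomial Mode ℂ}
    (hq : q.IsWeightedHomogeneous Mode.charge 0) (θ₁ θ₂ : ℝ) :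
    marginalFunctional θ₁ θ₂ q = ((2 * Real.pi : ℂ) ^ 2)⁻¹ * gaussExpect q := by
  rw [q.as_sum, map_sum, map_sum, Finset.mul_sum]
  refine Finset.sum_congr rfl fun a ha => ?_
  have hw := hq (MvPolynomial.mem_support_iff.1 ha)
  rw [weight_charge, Prod.mk_eq_zero, sub_eq_zero, sub_eq_zero] at hw
  have h1 : a (0, true) = a (0, false) := by exact_mod_cast hw.1
  have h2 : a (1, true) = a (1, false) := by exact_mod_cast hw.2
  have hG : ∀ (k : ℕ) (θ : ℝ), modulusFactor k k θ = k.factorial / 2 := by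
    intro k θ
    have : (1 + ((k + k : ℕ) : ℝ) / 2) = (k : ℝ) + 1 := by push_cast; ring
    rw [modulusFactor, this, Real.Gamma_nat_eq_factorial]
    simp
  rw [marginalFunctional_monomial, gaussExpect_monomial, if_pos h1, if_pos h2, ← h1, ← h2, hG, hG]
  have hpi : (Real.pi : ℂ) ≠ 0 := by exact_mod_cast Real.pi_ne_zero
  push_cast
  field_simp

theorem gaussDeriv_apply (s : Mode) (q : MvPolynomial Mode ℂ) :
    gaussDeriv s q = MvPolynomial.pderiv s q - MvPolynomial.X s.opp * q := by
  rw [gaussDeriv, LinearMap.sub_apply, LinearMap.mulLeft_apply]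
  rfl

/-- Integrals of derivatives vanish. -/
theorem gaussExpect_gaussDeriv (s : Mode) (q : MvPolynomial Mode ℂ) :
    gaussExpect (gaussDeriv s q) = 0 := by
  classical
  induction q using MvPolynomial.induction_on' with
  | add p q hp hq => rw [map_add, map_add, hp, hq, add_zero]
  | monomial a c =>
    have hX : ∀ t : Mode, (MvPolynomial.X t : MvPolynomial Mode ℂ) * MvPolynomial.monomial a c
        = MvPolynomial.monomial (Finsupp.single t 1 + a) c := by
      intro t
      rw [MvPolynomial.X, MvPolynomial.monomial_mul, one_mul]
    rw [gaussDeriv_apply, MvPolynomial.pderiv_monomial, hX, map_sub, gaussExpect_monomial, gaussExpect_monomial]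
    rcases s with ⟨i, b⟩
    fin_cases i <;> cases b <;>
      simp only [Mode.opp, Finsupp.add_apply, Finsupp.tsub_apply, Finsupp.single_apply,
        Prod.mk.injEq, Fin.mk_zero, Fin.mk_one, Bool.not_true, Bool.not_false,
        reduceCtorEq, zero_ne_one, one_ne_zero, and_true, and_false, if_true, if_false,
        Fin.isValue, Nat.sub_zero, Nat.zero_add] <;>
      generalize a (0, true) = p, a (0, false) = q, a (1, true) = r, a (1, false) = t
    -- Both terms are nonzero only if the exponent of `s` exceeds that of `s.opp` by one and the
    -- exponents of the other pair agree; they then coincide by `(q + 1) · q! = (q + 1)!`. Exponent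
    -- zero is separate because the subtraction of exponents truncates.
    · rcases q with _ | q
      · simp
      · simp [add_comm 1, Nat.factorial_succ]
        split_ifs <;> simp_all <;> ring
    · rcases p with _ | p
      · simp [add_comm 1]
      · simp [add_comm 1, Nat.factorial_succ]
        split_ifs <;> simp_all <;> ring
    · rcases t with _ | t
      · simp
      · simp [add_comm 1, Nat.factorial_succ]
        split_ifs <;> simp_all <;> ring
    · rcases r with _ | r
      · simp [add_comm 1]
      · simp [add_comm 1, Nat.factorial_succ]
        split_ifs <;> simp_all <;> ring

/-- Gaussian integration by parts. -/
theorem gaussExpect_X_mul (s : Mode) (q : MvPolynomial Mode ℂ) :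
    gaussExpect (MvPolynomial.X s * q) = gaussExpect (MvPolynomial.pderiv s.opp q) := by
  have h := gaussExpect_gaussDeriv s.opp q
  rw [gaussDeriv_apply, map_sub, Mode.opp_opp, sub_eq_zero] at h
  exact h.symm

theorem isWeightedHomogeneous_gaussDeriv (s : Mode) {q : MvPolynomial Mode ℂ} {c : ℤ × ℤ}
    (hq : q.IsWeightedHomogeneous Mode.charge c) :
    (gaussDeriv s q).IsWeightedHomogeneous Mode.charge (c - s.charge) := by
  rw [gaussDeriv_apply]
  refine (hq.pderiv (by abel)).sub ?_
  have := (MvPolynomial.isWeightedHomogeneous_X ℂ Mode.charge s.opp).mul hq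
  rwa [Mode.charge_opp, neg_add_eq_sub] at this

/-! ### Polynomials are determined by their Gaussian moments -/

/-- The multi-index of the complex conjugate monomial. -/
def oppIndex (a : Mode →₀ ℕ) : Mode →₀ ℕ := Finsupp.equivFunOnFinite.symm fun s => a s.opp

theorem weight_oppIndex (a : Mode →₀ ℕ) :
    Finsupp.weight Mode.charge (oppIndex a) = -Finsupp.weight Mode.charge a := by
  simp [weight_charge, oppIndex, Mode.opp]

/-- The polynomial whose values are the complex conjugates of those of a given polynomial. -/
def conjPoly (q : MvPolynomial Mode ℂ) : MvPolynomial Mode ℂ :=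
  ∑ a ∈ q.support, MvPolynomial.monomial (oppIndex a) ((starRingEnd ℂ) (q.coeff a))

theorem eval_conjPoly (q : MvPolynomial Mode ℂ) (z : ℂ × ℂ) :
    MvPolynomial.eval (modeValue z) (conjPoly q)
      = (starRingEnd ℂ) (MvPolynomial.eval (modeValue z) q) := by
  conv_rhs => rw [q.as_sum]
  rw [conjPoly, map_sum, map_sum, map_sum]
  refine Finset.sum_congr rfl fun a _ => ?_
  rw [eval_monomial_modeValue, eval_monomial_modeValue]
  simp only [oppIndex, Mode.opp, Finsupp.equivFunOnFinite_symm_apply_apply, map_mul, map_pow,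
    Complex.conj_conj, Bool.not_true, Bool.not_false]
  ring

/-- The expectation is the integral of the continuous nonnegative function `|q|² P_G`, and `P_G` is
positive everywhere. -/
theorem eval_eq_zero_of_gaussExpect_conj_mul {q : MvPolynomial Mode ℂ}
    (h : gaussExpect (conjPoly q * q) = 0) (z : ℂ × ℂ) :
    MvPolynomial.eval (modeValue z) q = 0 := by
  set g : ℂ × ℂ → ℝ := fun z =>
    ‖MvPolynomial.eval (modeValue z) q‖ ^ 2 * gaussDensity z with hg
  have hpos : ∀ z, 0 < gaussDensity z := fun z => by unfold gaussDensity; positivity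
  have hgc : Continuous g := ((continuous_eval_modeValue q).norm.pow 2).mul continuous_gaussDensity
  have hfun : polyGauss (conjPoly q * q) = fun z => ((g z : ℝ) : ℂ) := by
    ext z
    rw [polyGauss, map_mul, eval_conjPoly, mul_comm ((starRingEnd ℂ) _), Complex.mul_conj, hg,
      Complex.normSq_eq_norm_sq]
    push_cast
    rfl
  obtain ⟨C, hC⟩ := exists_hasDecay_polyGauss (conjPoly q * q)
  have hint : Integrable g := by
    have := hC.integrable
    rw [hfun] at this
    exact this.re
  have h0 : ∫ z, g z = 0 := by
    have h' : ∫ z, polyGauss (conjPoly q * q) z = 0 := h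
    rw [hfun, integral_complex_ofReal] at h'
    exact_mod_cast h'
  have hnn : 0 ≤ g := fun z => mul_nonneg (by positivity) (hpos z).le
  rw [integral_eq_zero_iff_of_nonneg hnn hint] at h0
  have := (Continuous.ae_eq_iff_eq volume hgc continuous_const).1 h0
  have hz : g z = 0 := congrFun this z
  rw [hg] at hz
  simpa [(hpos z).ne'] using hz

/-- A polynomial of vanishing expectation that is orthogonal to all charged monomials does not
contribute to the density of the phases. -/
theorem marginalFunctional_eq_zero {r : MvPolynomial Mode ℂ} (h0 : gaussExpect r = 0)
    (h : ∀ a : Mode →₀ ℕ, Finsupp.weight Mode.charge a ≠ 0 →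
      gaussExpect (MvPolynomial.monomial a 1 * r) = 0) (θ₁ θ₂ : ℝ) :
    marginalFunctional θ₁ θ₂ r = 0 := by
  classical
  set r₀ := MvPolynomial.weightedHomogeneousComponent Mode.charge 0 r with hr₀
  set r₁ := r - r₀ with hr₁
  have hr : r = r₀ + r₁ := by rw [hr₁]; abel
  have hn : r₀.IsWeightedHomogeneous Mode.charge 0 :=
    MvPolynomial.weightedHomogeneousComponent_isWeightedHomogeneous _ _
  have hsupp : ∀ a ∈ r₁.support, Finsupp.weight Mode.charge a ≠ 0 := by
    intro a ha hw
    rw [MvPolynomial.mem_support_iff, hr₁, MvPolynomial.coeff_sub, hr₀,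
      MvPolynomial.coeff_weightedHomogeneousComponent, if_pos hw, sub_self] at ha
    exact ha rfl
  have hsplit : ∀ p, gaussExpect (conjPoly r₁ * p) = ∑ a ∈ r₁.support,
      (starRingEnd ℂ) (r₁.coeff a) * gaussExpect (MvPolynomial.monomial (oppIndex a) 1 * p) := by
    intro p
    rw [conjPoly, Finset.sum_mul, map_sum]
    refine Finset.sum_congr rfl fun a _ => ?_
    rw [← smul_eq_mul (a := (starRingEnd ℂ) _), ← map_smul, ← smul_mul_assoc,
      MvPolynomial.smul_monomial, smul_eq_mul, mul_one]
  have hopp : ∀ a ∈ r₁.support, Finsupp.weight Mode.charge (oppIndex a) ≠ 0 := fun a ha => by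
    rw [weight_oppIndex, neg_ne_zero]; exact hsupp a ha
  -- The conjugate of the charged part `r₁` is orthogonal to `r` by hypothesis and to the neutral
  -- part `r₀` by charge; hence the expectation of `|r₁|²` vanishes.
  have e1 : gaussExpect (conjPoly r₁ * r) = 0 := by
    rw [hsplit]
    exact Finset.sum_eq_zero fun a ha => by rw [h _ (hopp a ha), mul_zero]
  have e2 : gaussExpect (conjPoly r₁ * r₀) = 0 := by
    rw [hsplit]
    refine Finset.sum_eq_zero fun a ha => ?_
    have hm := (MvPolynomial.isWeightedHomogeneous_monomial Mode.charge (oppIndex a) (1 : ℂ)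
      rfl).mul hn
    rw [add_zero] at hm
    rw [gaussExpect_of_charged (hopp a ha) hm, mul_zero]
  have e3 : gaussExpect (conjPoly r₁ * r₁) = 0 := by
    rw [hr, mul_add, map_add, e2, zero_add] at e1
    exact e1
  have hz := eval_eq_zero_of_gaussExpect_conj_mul e3
  have hf : polyGauss r₁ = fun _ => 0 := by
    ext z; rw [polyGauss, hz, zero_mul]
  have e4 : marginalFunctional θ₁ θ₂ r₁ = 0 := by
    change phaseMarginal (polyGauss r₁) θ₁ θ₂ = 0
    rw [hf]; simp [phaseMarginal]
  have e5 : gaussExpect r₁ = 0 := by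
    change ∫ z, polyGauss r₁ z = 0
    rw [hf]; simp
  have e6 : gaussExpect r₀ = 0 := by
    rw [hr, map_add, e5, add_zero] at h0; exact h0
  rw [hr, map_add, e4, marginalFunctional_of_neutral hn, e6, mul_zero, zero_add]

/-! ### The leading polynomial -/

/-- `α_{-k₁}^n α_{k₂}^m` for `b = true`, and its complex conjugate for `b = false`. -/
def resonantMonomial (n m : ℕ) (b : Bool) : MvPolynomial Mode ℂ :=
  MvPolynomial.X (0, !b) ^ n * MvPolynomial.X (1, b) ^ m

/-- The charged part of the first coefficient of the expansion that is not neutral. -/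
def leadingPoly (n m : ℕ) (P : Bool → ℂ) : MvPolynomial Mode ℂ :=
  ∑ b : Bool, (P b / (n.factorial * m.factorial)) • resonantMonomial n m b

theorem resonantMonomial_eq (n m : ℕ) (b : Bool) : resonantMonomial n m b
    = MvPolynomial.monomial (Finsupp.single (0, !b) n + Finsupp.single (1, b) m) 1 := by
  rw [resonantMonomial, MvPolynomial.X_pow_eq_monomial, MvPolynomial.X_pow_eq_monomial,
    MvPolynomial.monomial_mul, one_mul]

theorem isWeightedHomogeneous_resonantMonomial (n m : ℕ) (b : Bool) :
    (resonantMonomial n m b).IsWeightedHomogeneous Mode.charge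
      (if b then (-(n : ℤ), (m : ℤ)) else ((n : ℤ), -(m : ℤ))) := by
  rw [resonantMonomial_eq]
  refine MvPolynomial.isWeightedHomogeneous_monomial _ _ _ ?_
  rw [weight_charge]
  cases b <;> simp

/-- The two summands are complex conjugates on `ℂ²`, which gives twice a real part. The constants
cancel: `(2π)² · π⁻²` against the two factors `1/2` of the radial integrals. -/
theorem marginalFunctional_leadingPoly (n m : ℕ) (P : Bool → ℂ)
    (hP : P false = (starRingEnd ℂ) (P true)) (θ₁ θ₂ : ℝ) :
    (2 * Real.pi : ℂ) ^ 2 * marginalFunctional θ₁ θ₂ (leadingPoly n m P)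
      = (leadingTerm n m (P true) θ₁ θ₂ : ℂ) := by
  have hpi : (Real.pi : ℂ) ≠ 0 := by exact_mod_cast Real.pi_ne_zero
  rw [leadingPoly, Fintype.sum_bool, map_add, map_smul, map_smul, resonantMonomial_eq,
    resonantMonomial_eq, marginalFunctional_monomial, marginalFunctional_monomial, leadingTerm, hP]
  -- The real part is hidden behind `x` so that the simplification of the left side does not rewrite
  -- it.
  obtain ⟨x, hx⟩ : ∃ x : ℝ,
      x = (P true * Complex.exp (-Complex.I * (n * θ₁ - m * θ₂))).re := ⟨_, rfl⟩
  rw [← hx]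
  simp only [modulusFactor, Finsupp.add_apply, Finsupp.single_apply]
  simp only [Prod.mk.injEq, Bool.not_true, Bool.not_false]
  norm_num
  have e1 : Complex.exp (-(Complex.I * (n * θ₁))) * Complex.exp (Complex.I * (m * θ₂)) =
      Complex.exp (-Complex.I * (n * θ₁ - m * θ₂)) := by
    rw [← Complex.exp_add]; ring_nf
  have e2 : Complex.exp (Complex.I * (n * θ₁)) * Complex.exp (-(Complex.I * (m * θ₂))) =
      (starRingEnd ℂ) (Complex.exp (-Complex.I * (n * θ₁ - m * θ₂))) := by
    rw [← Complex.exp_add, ← Complex.exp_conj]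
    simp
    ring_nf
  have e3 : ∀ w : ℂ, ((w.re : ℝ) : ℂ) = (w + (starRingEnd ℂ) w) / 2 := fun w => by
    rw [Complex.add_conj]; push_cast; ring
  rw [hx, e3, map_mul, ← e2, ← e1]
  field_simp
  try ring

/-! ### Resonant charges -/

/-- The total momentum of a configuration of this charge vanishes when `n k₁ = m k₂`. -/
def IsResonant (n m : ℕ) (c : ℤ × ℤ) : Prop := c.1 * m + c.2 * n = 0

/-- The charge of the configuration `k₁, …, k₁, -k₂, …, -k₂` (for `b = true`) or its opposite. -/
def resonantCharge (n m : ℕ) (b : Bool) : ℤ × ℤ :=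
  if b then ((n : ℤ), -(m : ℤ)) else (-(n : ℤ), (m : ℤ))

/-- From `c₁ m = -c₂ n` and coprimality, `n` divides `c₁`. -/
theorem exists_eq_of_isResonant {n m : ℕ} (hn : 0 < n) (hnm : Nat.Coprime n m)
    {c : ℤ × ℤ} (hc : IsResonant n m c) : ∃ t : ℤ, c = (t * n, -(t * m)) := by
  obtain ⟨x, y⟩ := c
  unfold IsResonant at hc
  simp only at hc
  have h1 : (n : ℤ) ∣ x * m := ⟨-y, by linarith⟩
  have hco : IsCoprime (n : ℤ) (m : ℤ) := Nat.isCoprime_iff_coprime.2 hnm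
  obtain ⟨t, rfl⟩ := hco.dvd_of_dvd_mul_right h1
  refine ⟨t, ?_⟩
  have hn' : (n : ℤ) ≠ 0 := by exact_mod_cast hn.ne'
  have h2 : y = -(t * m) := mul_right_cancel₀ hn' (by linarith)
  rw [h2, mul_comm]

section Configurations

variable {κ : Type*} (s : κ → Mode)

theorem Mode.abs_charge (s : Mode) : |s.charge.1| + |s.charge.2| = 1 := by
  rcases s with ⟨i, b⟩
  fin_cases i <;> cases b <;> simp [Mode.charge]

theorem abs_sum_charge_le (S : Finset κ) :
    |(∑ i ∈ S, (s i).charge).1| + |(∑ i ∈ S, (s i).charge).2| ≤ S.card := by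
  rw [Prod.fst_sum, Prod.snd_sum]
  calc _ ≤ ∑ i ∈ S, |(s i).charge.1| + ∑ i ∈ S, |(s i).charge.2| :=
        add_le_add (Finset.abs_sum_le_sum_abs _ _) (Finset.abs_sum_le_sum_abs _ _)
    _ = S.card := by
        rw [← Finset.sum_add_distrib]
        simp [Mode.abs_charge]

/-- The charge is `t (n, -m)` with `t ≠ 0`; reaching `|t| (n + m)` takes at least that many modes of
one unit each. This bound fixes the order of the leading term. -/
theorem le_card_of_isResonant {n m : ℕ} (hn : 0 < n) (hnm : Nat.Coprime n m) {S : Finset κ}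
    (hr : IsResonant n m (∑ i ∈ S, (s i).charge)) (h0 : ∑ i ∈ S, (s i).charge ≠ 0) :
    n + m ≤ S.card := by
  obtain ⟨t, ht⟩ := exists_eq_of_isResonant hn hnm hr
  have h := abs_sum_charge_le s S
  rw [ht] at h h0
  have ht0 : t ≠ 0 := by rintro rfl; simp at h0
  have h1 : 1 ≤ |t| := Int.one_le_abs ht0
  simp only [abs_neg, abs_mul, Nat.abs_cast] at h
  have : ((n + m : ℕ) : ℤ) ≤ S.card := by push_cast; nlinarith
  exact_mod_cast this

theorem eq_resonantCharge {n m : ℕ} (hn : 0 < n) (hnm : Nat.Coprime n m) {S : Finset κ}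
    (hr : IsResonant n m (∑ i ∈ S, (s i).charge)) (h0 : ∑ i ∈ S, (s i).charge ≠ 0)
    (hS : S.card = n + m) : ∃ b, ∑ i ∈ S, (s i).charge = resonantCharge n m b := by
  obtain ⟨t, ht⟩ := exists_eq_of_isResonant hn hnm hr
  have h := abs_sum_charge_le s S
  rw [ht] at h h0
  have ht0 : t ≠ 0 := by rintro rfl; simp at h0
  simp only [abs_neg, abs_mul, Nat.abs_cast, hS] at h
  have h1 : |t| ≤ 1 := by
    by_contra hlt
    push_cast at h
    nlinarith
  rw [ht]
  rcases abs_le.1 h1 with ⟨h2, h3⟩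
  have : t = 1 ∨ t = -1 := by omega
  rcases this with rfl | rfl
  · exact ⟨true, by simp [resonantCharge]⟩
  · exact ⟨false, by simp [resonantCharge]⟩

theorem resonantCharge_ne_zero {n m : ℕ} (hn : 0 < n) (b : Bool) : resonantCharge n m b ≠ 0 := by
  cases b <;> simp [resonantCharge, Prod.ext_iff] <;> omega

theorem resonantCharge_injective {n m : ℕ} (hn : 0 < n) :
    Function.Injective (resonantCharge n m) := by
  intro b b' h
  cases b <;> cases b' <;> simp [resonantCharge] at h ⊢ <;> omega

/-- Configurations of `n + m` modes of resonant charge consist of `k₁` and `-k₂`, or of their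
opposites. -/
theorem mem_of_resonantCharge {n m : ℕ} {b : Bool} {S : Finset κ}
    (h : ∑ i ∈ S, (s i).charge = resonantCharge n m b) (hS : S.card = n + m) :
    (∀ i ∈ S, s i = (0, b) ∨ s i = (1, !b)) ∧ {i ∈ S | s i = (0, b)}.card = n := by
  have h1 := congrArg Prod.fst h
  have h2 := congrArg Prod.snd h
  rw [Prod.fst_sum] at h1
  rw [Prod.snd_sum] at h2
  have hall : ∀ i ∈ S, s i = (0, b) ∨ s i = (1, !b) := by
    -- `g` is at most 1 on every mode and adds up to `n + m` over `n + m` modes, so it equals 1 on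
    -- each of them.
    let g : Mode → ℤ := fun t => if b then t.charge.1 - t.charge.2 else t.charge.2 - t.charge.1
    have hg : ∀ t : Mode, g t ≤ 1 := by
      rintro ⟨i, b'⟩
      fin_cases i <;> cases b' <;> cases b <;> simp [g, Mode.charge]
    have hsum : ∑ i ∈ S, (1 - g (s i)) = 0 := by
      rw [Finset.sum_sub_distrib, Finset.sum_const, hS, sub_eq_zero]
      cases b <;> simp [g, resonantCharge, Finset.sum_sub_distrib] at h1 h2 ⊢ <;> rw [h1, h2] <;>
        ring
    rw [Finset.sum_eq_zero_iff_of_nonneg (fun i _ => sub_nonneg.2 (hg (s i)))] at hsum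
    intro i hi
    have := hsum i hi
    generalize s i = t at this
    rcases t with ⟨j, b'⟩
    fin_cases j <;> cases b' <;> cases b <;> simp [g, Mode.charge] at this ⊢
  refine ⟨hall, ?_⟩
  have h3 : ∑ i ∈ S, (s i).charge.1 = ∑ i ∈ S, if s i = (0, b) then (if b then 1 else -1) else 0 := by
    refine Finset.sum_congr rfl fun i hi => ?_
    rcases hall i hi with h | h <;> rw [h] <;> simp [Mode.charge]
  rw [h3, ← Finset.sum_filter, Finset.sum_const] at h1
  cases b <;> simpa [resonantCharge] using h1

end Configurations

/-- Two tuples of resonant charge differ by a permutation. -/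
theorem exists_perm_of_resonantCharge {n m N : ℕ} (hN : N = n + m) {b : Bool}
    {s t : Fin N → Mode} (hs : ∑ i, (s i).charge = resonantCharge n m b)
    (ht : ∑ i, (t i).charge = resonantCharge n m b) :
    ∃ σ : Equiv.Perm (Fin N), s = t ∘ σ := by
  have hc : (Finset.univ : Finset (Fin N)).card = n + m := by simp [hN]
  obtain ⟨hs1, hs2⟩ := mem_of_resonantCharge s hs hc
  obtain ⟨ht1, ht2⟩ := mem_of_resonantCharge t ht hc
  have hcard : Fintype.card {i // s i = (0, b)} = Fintype.card {i // t i = (0, b)} := by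
    rw [Fintype.card_subtype, Fintype.card_subtype, hs2, ht2]
  -- Any bijection between the positions of `(0, b)` in the two tuples extends to a permutation, and
  -- every remaining entry is `(1, !b)`.
  let e := Fintype.equivOfCardEq hcard
  refine ⟨e.extendSubtype, funext fun i => ?_⟩
  by_cases hi : s i = (0, b)
  · have := e.extendSubtype_mem i hi
    rw [hi, Function.comp_apply, this]
  · have h1 := e.extendSubtype_not_mem i hi
    rw [(hs1 i (Finset.mem_univ i)).resolve_left hi, Function.comp_apply,
      (ht1 _ (Finset.mem_univ _)).resolve_left h1]

/-- The tuple `k₁, …, k₁, -k₂, …, -k₂` (for `b = true`) or its opposite. -/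
def resonantTuple (n m : ℕ) (b : Bool) : Fin (n + m) → Mode :=
  Fin.append (fun _ : Fin n => ((0 : Fin 2), b)) (fun _ : Fin m => ((1 : Fin 2), !b))

theorem sum_charge_resonantTuple (n m : ℕ) (b : Bool) :
    ∑ i, (resonantTuple n m b i).charge = resonantCharge n m b := by
  rw [Fin.sum_univ_add]
  simp only [resonantTuple, Fin.append_left, Fin.append_right, Finset.sum_const, Finset.card_univ,
    Fintype.card_fin]
  cases b <;> simp [Mode.charge, resonantCharge]

/-- Such a tuple is determined by the `n` positions at which the mode is `(0, b)`, and these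
positions are arbitrary. -/
theorem card_resonantCharge (n m : ℕ) (b : Bool) :
    {s : Fin (n + m) → Mode | ∑ i, (s i).charge = resonantCharge n m b}.toFinset.card
      = (n + m).choose n := by
  have hc : (Finset.univ : Finset (Fin (n + m))).card = n + m := by simp
  rw [← hc, ← Finset.card_powersetCard, hc]
  refine Finset.card_bij (fun s _ => ({i | s i = (0, b)} : Finset (Fin (n + m)))) ?_ ?_ ?_
  · intro s hs
    simp only [Set.mem_toFinset, Set.mem_ofPred_eq] at hs
    rw [Finset.mem_powersetCard]
    exact ⟨Finset.subset_univ _, (mem_of_resonantCharge s hs hc).2⟩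
  · intro s hs t ht hst
    simp only [Set.mem_toFinset, Set.mem_ofPred_eq] at hs ht
    have hs1 := (mem_of_resonantCharge s hs hc).1
    have ht1 := (mem_of_resonantCharge t ht hc).1
    funext i
    have hi : s i = (0, b) ↔ t i = (0, b) := by
      have := congrArg (fun A : Finset (Fin (n + m)) => i ∈ A) hst
      simpa using this
    rcases hs1 i (Finset.mem_univ i) with h | h
    · rw [h, hi.1 h]
    · rcases ht1 i (Finset.mem_univ i) with h' | h'
      · rw [hi.2 h', h']
      · rw [h, h']
  · intro A hA
    rw [Finset.mem_powersetCard] at hA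
    refine ⟨fun i => if i ∈ A then (0, b) else (1, !b), ?_, ?_⟩
    · simp only [Set.mem_toFinset, Set.mem_ofPred_eq]
      have hA' : (Finset.univ.filter fun i => i ∉ A).card = m := by
        have := Finset.card_compl A
        rw [hA.2, Fintype.card_fin, Finset.compl_eq_univ_sdiff] at this
        rw [← Finset.sdiff_eq_filter, this]
        omega
      simp only [apply_ite Mode.charge]
      rw [Finset.sum_ite, Finset.sum_const, Finset.sum_const, hA', Finset.filter_mem_eq_inter,
        Finset.univ_inter, hA.2]
      cases b <;> simp [Mode.charge, resonantCharge]
    · ext i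
      by_cases h : i ∈ A <;> simp [h]

/-! ### The formal expansion -/

/-- Operators that preserve the charge. -/
def IsNeutral (D : Module.End ℂ (MvPolynomial Mode ℂ)) : Prop :=
  ∀ (c : ℤ × ℤ) (q : MvPolynomial Mode ℂ), q.IsWeightedHomogeneous Mode.charge c →
    (D q).IsWeightedHomogeneous Mode.charge c

theorem IsNeutral.zero : IsNeutral 0 := fun c _ _ =>
  MvPolynomial.isWeightedHomogeneous_zero ℂ Mode.charge c

theorem IsNeutral.one : IsNeutral 1 := fun _ _ h => h

theorem IsNeutral.mul {D D' : Module.End ℂ (MvPolynomial Mode ℂ)} (h : IsNeutral D)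
    (h' : IsNeutral D') : IsNeutral (D * D') := fun c q hq => h c _ (h' c q hq)

theorem IsNeutral.smul {D : Module.End ℂ (MvPolynomial Mode ℂ)} (h : IsNeutral D) (a : ℂ) :
    IsNeutral (a • D) := fun c q hq =>
  (MvPolynomial.weightedHomogeneousSubmodule ℂ Mode.charge c).smul_mem a (h c q hq)

theorem IsNeutral.sum {ι : Type*} {A : Finset ι} {D : ι → Module.End ℂ (MvPolynomial Mode ℂ)}
    (h : ∀ i ∈ A, IsNeutral (D i)) : IsNeutral (∑ i ∈ A, D i) := fun c q hq => by
  rw [LinearMap.sum_apply]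
  exact (MvPolynomial.weightedHomogeneousSubmodule ℂ Mode.charge c).sum_mem
    fun i hi => h i hi c q hq

/-- The operator `∂/∂α_{s₁} ⋯ ∂/∂α_{s_N}`. -/
abbrev derivProd {N : ℕ} (s : Fin N → Mode) : Module.End ℂ (MvPolynomial Mode ℂ) :=
  (List.ofFn fun i => gaussDeriv (s i)).prod

theorem isWeightedHomogeneous_derivProd {N : ℕ} (s : Fin N → Mode) {q : MvPolynomial Mode ℂ}
    {c : ℤ × ℤ} (hq : q.IsWeightedHomogeneous Mode.charge c) :
    (derivProd s q).IsWeightedHomogeneous Mode.charge (c - ∑ i, (s i).charge) := by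
  induction N with
  | zero => simpa [derivProd] using hq
  | succ N ih =>
    have := isWeightedHomogeneous_gaussDeriv (s 0) (ih (fun i => s i.succ))
    rw [derivProd, List.ofFn_succ, List.prod_cons, Module.End.mul_apply, Fin.sum_univ_succ,
      add_comm (s 0).charge, ← sub_sub]
    exact this

theorem gaussExpect_derivProd {N : ℕ} (hN : 0 < N) (s : Fin N → Mode)
    (q : MvPolynomial Mode ℂ) : gaussExpect (derivProd s q) = 0 := by
  obtain ⟨N, rfl⟩ := Nat.exists_eq_succ_of_ne_zero hN.ne'
  rw [derivProd, List.ofFn_succ, List.prod_cons, Module.End.mul_apply, gaussExpect_gaussDeriv]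

/-- The Leibniz rule summed over labels instead of exponents: each term is one Wick contraction. -/
theorem pderiv_prod_X {κ : Type*} [DecidableEq κ] (t : Mode) (s : κ → Mode) (S : Finset κ) :
    MvPolynomial.pderiv t (∏ i ∈ S, (MvPolynomial.X (s i) : MvPolynomial Mode ℂ))
      = ∑ i ∈ S with s i = t, ∏ j ∈ S.erase i, MvPolynomial.X (s j) := by
  induction S using Finset.induction_on with
  | empty => simp
  | insert a S ha ih =>
    rw [Finset.prod_insert ha, MvPolynomial.pderiv_mul, ih, Finset.filter_insert, Finset.mul_sum]
    have h : ∀ i ∈ S.filter (fun i => s i = t),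
        (MvPolynomial.X (s a) * ∏ j ∈ S.erase i, MvPolynomial.X (s j) : MvPolynomial Mode ℂ)
          = ∏ j ∈ (insert a S).erase i, MvPolynomial.X (s j) := by
      intro i hi
      have hne : a ≠ i := fun h => ha (h ▸ (Finset.mem_filter.1 hi).1)
      rw [Finset.erase_insert_of_ne hne, Finset.prod_insert
        (fun h => ha (Finset.mem_of_mem_erase h))]
    rw [Finset.sum_congr rfl h]
    split_ifs with hat
    · rw [Finset.sum_insert (fun h => ha (Finset.mem_filter.1 h).1), Finset.erase_insert ha, hat,
        MvPolynomial.pderiv_X_self, one_mul]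
    · rw [MvPolynomial.pderiv_X_of_ne hat, zero_mul, zero_add]

/-- `gaussDeriv t` is `∂_t` minus multiplication by `X t.opp`. Without opposite modes `∂_t` never
meets its own variable, and only the multiplications survive. -/
theorem derivProd_one_of_not_opp {N : ℕ} (s : Fin N → Mode) (hs : ∀ i j, s i ≠ (s j).opp) :
    derivProd s 1 = (-1) ^ N * ∏ i, MvPolynomial.X (s i).opp := by
  induction N with
  | zero => simp [derivProd]
  | succ N ih =>
    have hd : MvPolynomial.pderiv (s 0) (∏ i : Fin N, (MvPolynomial.X (s i.succ).opp :
        MvPolynomial Mode ℂ)) = 0 := by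
      rw [pderiv_prod_X]
      refine Finset.sum_eq_zero fun i hi => ?_
      exact absurd (Finset.mem_filter.1 hi).2 (hs 0 i.succ).symm
    have hd' : MvPolynomial.pderiv (s 0) ((-1 : MvPolynomial Mode ℂ) ^ N *
        ∏ i : Fin N, MvPolynomial.X (s i.succ).opp) = 0 := by
      rw [MvPolynomial.pderiv_mul, hd, mul_zero, add_zero]
      have : ((-1 : MvPolynomial Mode ℂ) ^ N) = MvPolynomial.C ((-1) ^ N) := by simp
      rw [this, MvPolynomial.pderiv_C, zero_mul]
    rw [derivProd, List.ofFn_succ, List.prod_cons, Module.End.mul_apply,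
      ih (fun i => s i.succ) (fun i j => hs i.succ j.succ), gaussDeriv_apply, hd',
      Fin.prod_univ_succ]
    ring

theorem derivProd_one_of_resonant {n m : ℕ} {b : Bool} {s : Fin (n + m) → Mode}
    (hs : ∑ i, (s i).charge = resonantCharge n m b) :
    derivProd s 1 = (-1 : ℂ) ^ (n + m) • resonantMonomial n m b := by
  have hc : (Finset.univ : Finset (Fin (n + m))).card = n + m := by simp
  have h1 := (mem_of_resonantCharge s hs hc).1
  obtain ⟨σ, rfl⟩ := exists_perm_of_resonantCharge rfl hs (sum_charge_resonantTuple n m b)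
  rw [derivProd_one_of_not_opp]
  · simp only [Function.comp_apply]
    rw [Equiv.prod_comp σ (fun i => (MvPolynomial.X (resonantTuple n m b i).opp :
      MvPolynomial Mode ℂ)), Fin.prod_univ_add]
    simp only [resonantTuple, Fin.append_left, Fin.append_right, Finset.prod_const,
      Finset.card_univ, Fintype.card_fin, Mode.opp, Bool.not_not]
    rw [resonantMonomial, MvPolynomial.smul_eq_C_mul]
    simp
  · intro i j
    rcases h1 i (Finset.mem_univ i) with h | h <;> rcases h1 j (Finset.mem_univ j) with h' | h' <;>
      rw [h, h'] <;> simp [Mode.opp]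

section Expansion

variable {n m : ℕ} {p : (N : ℕ) → (Fin N → Mode) → ℂ}

/-- Fewer than `n + m` modes have vanishing total momentum only if their charges cancel; the
remaining coefficients are zero by momentum conservation. -/
theorem isNeutral_cumulantOp (hn : 0 < n) (hnm : Nat.Coprime n m)
    (hres : ∀ N s, ¬ IsResonant n m (∑ i, (s i).charge) → p N s = 0) {N : ℕ}
    (hN : N < n + m) : IsNeutral (cumulantOp p N) := by
  refine IsNeutral.smul (IsNeutral.sum fun s _ => ?_) _
  by_cases hs : ∑ i, (s i).charge = 0
  · refine IsNeutral.smul (fun c q hq => ?_) _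
    have := isWeightedHomogeneous_derivProd s hq
    rwa [hs, sub_zero] at this
  · rw [hres N s, zero_smul]
    · exact IsNeutral.zero
    · intro h
      have := le_card_of_isResonant s (S := Finset.univ) hn hnm h hs
      simp at this
      omega

theorem gaussExpect_cumulantOp {N : ℕ} (hN : 0 < N) (q : MvPolynomial Mode ℂ) :
    gaussExpect (cumulantOp p N q) = 0 := by
  rw [cumulantOp, LinearMap.smul_apply, map_smul, LinearMap.sum_apply, map_sum,
    Finset.sum_eq_zero, smul_zero]
  intro s _
  rw [LinearMap.smul_apply, map_smul, gaussExpect_derivProd hN, smul_zero]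

theorem gaussExpect_leadingPoly (hn : 0 < n) (P : Bool → ℂ) :
    gaussExpect (leadingPoly n m P) = 0 := by
  rw [leadingPoly, map_sum]
  refine Finset.sum_eq_zero fun b _ => ?_
  rw [map_smul, gaussExpect_of_charged _ (isWeightedHomogeneous_resonantMonomial n m b), smul_zero]
  cases b <;> simp <;> omega

/-- The first cumulant operator that is not neutral. -/
theorem exists_cumulantOp_eq (hn : 0 < n) (hnm : Nat.Coprime n m)
    (hres : ∀ N s, ¬ IsResonant n m (∑ i, (s i).charge) → p N s = 0)
    (hperm : ∀ (s : Fin (n + m) → Mode) (σ : Equiv.Perm (Fin (n + m))),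
      p (n + m) (s ∘ σ) = p (n + m) s) :
    ∃ Q : MvPolynomial Mode ℂ, Q.IsWeightedHomogeneous Mode.charge 0 ∧
      cumulantOp p (n + m) 1 = Q + leadingPoly n m fun b => p (n + m) (resonantTuple n m b) := by
  classical
  obtain ⟨A, hA⟩ : ∃ A : ℂ, A = (-1) ^ (n + m) / ((n + m).factorial : ℂ) := ⟨_, rfl⟩
  have hone := MvPolynomial.isWeightedHomogeneous_one ℂ Mode.charge
  refine ⟨A • ∑ s : Fin (n + m) → Mode with ∑ i, (s i).charge = 0, p (n + m) s • derivProd s 1, ?_, ?_⟩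
  · refine (MvPolynomial.weightedHomogeneousSubmodule ℂ Mode.charge 0).smul_mem _
      (Submodule.sum_mem _ fun s hs => Submodule.smul_mem _ _ ?_)
    have := isWeightedHomogeneous_derivProd s hone
    rwa [(Finset.mem_filter.1 hs).2, sub_zero] at this
  -- A tuple is neutral, or of one of the two minimal resonant charges, or has coefficient zero. By
  -- symmetry all tuples of one resonant charge give the same term.
  · have hsplit : ∀ s : Fin (n + m) → Mode, p (n + m) s • derivProd s 1 =
        (if ∑ i, (s i).charge = 0 then p (n + m) s • derivProd s 1 else 0) +
        ∑ b : Bool, if ∑ i, (s i).charge = resonantCharge n m b then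
          (p (n + m) (resonantTuple n m b) * (-1) ^ (n + m)) • resonantMonomial n m b else 0 := by
      intro s
      by_cases h0 : ∑ i, (s i).charge = 0
      · rw [if_pos h0, Finset.sum_eq_zero, add_zero]
        intro b _
        rw [if_neg]
        rw [h0]
        exact (resonantCharge_ne_zero hn b).symm
      · rw [if_neg h0, zero_add]
        by_cases hr : IsResonant n m (∑ i, (s i).charge)
        · obtain ⟨b, hb⟩ := eq_resonantCharge s (S := Finset.univ) hn hnm hr h0 (by simp)
          rw [Finset.sum_eq_single b]
          · rw [if_pos hb]
            obtain ⟨σ, hσ⟩ := exists_perm_of_resonantCharge rfl hb (sum_charge_resonantTuple n m b)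
            rw [derivProd_one_of_resonant hb, hσ, hperm, smul_smul]
          · intro b' _ hne
            rw [if_neg]
            rw [hb]
            exact fun h => hne (resonantCharge_injective hn h).symm
          · simp
        · rw [hres (n + m) s hr, zero_smul, Finset.sum_eq_zero]
          intro b _
          rw [if_neg]
          intro hb
          apply hr
          rw [hb]
          cases b <;> simp [IsResonant, resonantCharge] <;> ring
    rw [cumulantOp, ← hA, LinearMap.smul_apply, LinearMap.sum_apply]
    simp only [LinearMap.smul_apply]
    rw [Finset.sum_congr rfl fun s _ => hsplit s, Finset.sum_add_distrib, smul_add,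
      Finset.sum_filter]
    refine congrArg _ ?_
    rw [Finset.sum_comm, leadingPoly, Finset.smul_sum]
    refine Finset.sum_congr rfl fun b _ => ?_
    rw [← Finset.sum_filter, Finset.sum_const]
    have hcard : (Finset.univ.filter fun s : Fin (n + m) → Mode =>
        ∑ i, (s i).charge = resonantCharge n m b).card = (n + m).choose n := by
      rw [← card_resonantCharge n m b]
      congr 1
      ext s
      simp
    rw [hcard, ← Nat.cast_smul_eq_nsmul ℂ, smul_smul, smul_smul]
    congr 1
    have hch : (((n + m).choose n : ℕ) : ℂ) * (n.factorial * m.factorial) = (n + m).factorial := by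
      have := Nat.add_choose_mul_factorial_mul_factorial n m
      rw [← this, Nat.choose_symm_add]
      push_cast
      ring
    have h1 : (n.factorial : ℂ) ≠ 0 := by exact_mod_cast n.factorial_ne_zero
    have h2 : (m.factorial : ℂ) ≠ 0 := by exact_mod_cast m.factorial_ne_zero
    have h3 : ((n + m).factorial : ℂ) ≠ 0 := by exact_mod_cast (n + m).factorial_ne_zero
    -- One sign belongs to the cumulant operator, the other to the derivatives of the Gaussian.
    -- Together with `choose / (n + m)! = 1 / (n! m!)` this leaves the coefficient of `leadingPoly`.
    have h4 : ((-1 : ℂ) ^ (n + m)) * (-1) ^ (n + m) = 1 := by rw [← mul_pow]; simp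
    rw [hA]
    field_simp
    rw [← hch]
    linear_combination (p (n + m) (resonantTuple n m b) * ((n + m).choose n : ℂ) * (n.factorial * m.factorial)) * h4

/-- With at least one factor of the series, the outermost operation is a derivative. -/
theorem gaussExpect_coeff_cumulantSeries_pow (r j : ℕ) (q : MvPolynomial Mode ℂ) :
    gaussExpect (PowerSeries.coeff j (cumulantSeries p ^ (r + 1)) q) = 0 := by
  rw [pow_succ', PowerSeries.coeff_mul, LinearMap.sum_apply, map_sum]
  refine Finset.sum_eq_zero fun a _ => ?_
  rw [Module.End.mul_apply, cumulantSeries, PowerSeries.coeff_mk]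
  split_ifs
  · simp
  · exact gaussExpect_cumulantOp (by omega) _

/-- The orders in `ε` of the factors add up to `j`, so each factor is a cumulant operator of order
at most `j + 2 < n + m`. -/
theorem isNeutral_coeff_cumulantSeries_pow (hn : 0 < n) (hnm : Nat.Coprime n m)
    (hres : ∀ N s, ¬ IsResonant n m (∑ i, (s i).charge) → p N s = 0) (r : ℕ) {j : ℕ}
    (hj : j < n + m - 2) : IsNeutral (PowerSeries.coeff j (cumulantSeries p ^ r)) := by
  induction r generalizing j with
  | zero =>
    rw [pow_zero, PowerSeries.coeff_one]
    split_ifs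
    · exact IsNeutral.one
    · exact IsNeutral.zero
  | succ r ih =>
    rw [pow_succ', PowerSeries.coeff_mul]
    refine IsNeutral.sum fun a ha => ?_
    rw [Finset.HasAntidiagonal.mem_antidiagonal] at ha
    refine IsNeutral.mul ?_ (ih (by omega))
    rw [cumulantSeries, PowerSeries.coeff_mk]
    split_ifs
    · exact IsNeutral.zero
    · exact isNeutral_cumulantOp hn hnm hres (by omega)

theorem coeff_zero_cumulantSeries_pow (r : ℕ) :
    PowerSeries.coeff 0 (cumulantSeries p ^ (r + 1)) = 0 := by
  rw [pow_succ', PowerSeries.coeff_mul]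
  simp [cumulantSeries]

/-- The series has no constant term, so with two or more factors each one takes a positive share of
`n + m - 2` and stays below the first charged operator. -/
theorem isNeutral_coeff_cumulantSeries_pow_add_two (hn : 0 < n) (hnm : Nat.Coprime n m)
    (hres : ∀ N s, ¬ IsResonant n m (∑ i, (s i).charge) → p N s = 0) (r : ℕ) :
    IsNeutral (PowerSeries.coeff (n + m - 2) (cumulantSeries p ^ (r + 2))) := by
  rw [pow_succ', PowerSeries.coeff_mul]
  refine IsNeutral.sum fun a ha => ?_
  rw [Finset.HasAntidiagonal.mem_antidiagonal] at ha
  by_cases h2 : a.2 = 0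
  · rw [h2, coeff_zero_cumulantSeries_pow, mul_zero]
    exact IsNeutral.zero
  by_cases h1 : a.1 = 0
  · rw [h1, cumulantSeries, PowerSeries.coeff_mk, if_pos rfl, zero_mul]
    exact IsNeutral.zero
  · refine IsNeutral.mul ?_ (isNeutral_coeff_cumulantSeries_pow hn hnm hres _ (by omega))
    rw [cumulantSeries, PowerSeries.coeff_mk, if_neg h1]
    exact isNeutral_cumulantOp hn hnm hres (by omega)

/-- The coefficients of the formal expansion, up to the first one that is not neutral. -/
theorem exists_expansionCoeff_eq (hn : 0 < n) (h3 : 3 ≤ n + m) (hnm : Nat.Coprime n m)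
    (hres : ∀ N s, ¬ IsResonant n m (∑ i, (s i).charge) → p N s = 0)
    (hperm : ∀ (s : Fin (n + m) → Mode) (σ : Equiv.Perm (Fin (n + m))),
      p (n + m) (s ∘ σ) = p (n + m) s) {j : ℕ} (hj : j ≤ n + m - 2) :
    ∃ Q : MvPolynomial Mode ℂ, Q.IsWeightedHomogeneous Mode.charge 0 ∧
      gaussExpect Q = (if j = 0 then 1 else 0) ∧
      expansionCoeff p j = Q + if j = n + m - 2 then
        leadingPoly n m fun b => p (n + m) (resonantTuple n m b) else 0 := by
  have hone := MvPolynomial.isWeightedHomogeneous_one ℂ Mode.charge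
  have hE1 : gaussExpect 1 = 1 := by
    have := gaussExpect_monomial 0 1
    simpa using this
  have hexp : gaussExpect (expansionCoeff p j) = if j = 0 then 1 else 0 := by
    rw [expansionCoeff, LinearMap.sum_apply, map_sum, Finset.sum_range_succ', Finset.sum_eq_zero]
    · rw [pow_zero, PowerSeries.coeff_one]
      split_ifs <;> simp [hE1]
    · intro r _
      rw [LinearMap.smul_apply, map_smul, gaussExpect_coeff_cumulantSeries_pow, smul_zero]
  have hlead := gaussExpect_leadingPoly (n := n) (m := m) hn
    fun b => p (n + m) (resonantTuple n m b)
  refine ⟨expansionCoeff p j - if j = n + m - 2 then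
        leadingPoly n m fun b => p (n + m) (resonantTuple n m b) else 0, ?_, ?_, by abel⟩
  · by_cases hjJ : j = n + m - 2
    · obtain ⟨Q, hQ, hQ'⟩ := exists_cumulantOp_eq hn hnm hres hperm
      rw [if_pos hjJ, expansionCoeff]
      -- Here `j ≥ 1` because `n + m ≥ 3`. The powers 0 and 1 are split off: power 0 has no
      -- coefficient at `j`, and power 1 gives the cumulant operator of order `n + m`.
      obtain ⟨k, hk⟩ : ∃ k, j + 1 = k + 2 := ⟨j - 1, by omega⟩
      rw [hk, Finset.sum_range_succ', Finset.sum_range_succ', pow_zero, PowerSeries.coeff_one,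
        if_neg (by omega), smul_zero, add_zero, zero_add, pow_one, cumulantSeries,
        PowerSeries.coeff_mk, if_neg (by omega), Nat.factorial_one, Nat.cast_one, inv_one, one_smul,
        LinearMap.add_apply, ← cumulantSeries]
      have hj2 : j + 2 = n + m := by omega
      rw [hj2, hQ', ← add_assoc, add_sub_cancel_right]
      refine MvPolynomial.IsWeightedHomogeneous.add ?_ hQ
      refine (IsNeutral.sum fun r _ => IsNeutral.smul ?_ _) 0 1 hone
      rw [hjJ]
      exact isNeutral_coeff_cumulantSeries_pow_add_two hn hnm hres r
    · rw [if_neg hjJ, sub_zero, expansionCoeff]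
      exact (IsNeutral.sum fun r _ => IsNeutral.smul
        (isNeutral_coeff_cumulantSeries_pow hn hnm hres r (by omega)) _) 0 1 hone
  · rw [map_sub, hexp]
    split_ifs <;> simp [hlead]

theorem phaseDeviationCoeff_eq (hn : 0 < n) (h3 : 3 ≤ n + m) (hnm : Nat.Coprime n m)
    (hres : ∀ N s, ¬ IsResonant n m (∑ i, (s i).charge) → p N s = 0)
    (hperm : ∀ (s : Fin (n + m) → Mode) (σ : Equiv.Perm (Fin (n + m))),
      p (n + m) (s ∘ σ) = p (n + m) s)
    (hconj : p (n + m) (resonantTuple n m false)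
      = (starRingEnd ℂ) (p (n + m) (resonantTuple n m true)))
    {j : ℕ} (hj : j ≤ n + m - 2) (θ₁ θ₂ : ℝ) :
    phaseDeviationCoeff p j θ₁ θ₂ = if j = n + m - 2 then
      (leadingTerm n m (p (n + m) (resonantTuple n m true)) θ₁ θ₂ : ℂ) else 0 := by
  obtain ⟨Q, hQ, hQE, hQe⟩ := exists_expansionCoeff_eq hn h3 hnm hres hperm hj
  have hpi : (Real.pi : ℂ) ≠ 0 := by exact_mod_cast Real.pi_ne_zero
  have hQm : (2 * Real.pi : ℂ) ^ 2 * marginalFunctional θ₁ θ₂ Q = if j = 0 then 1 else 0 := by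
    rw [marginalFunctional_of_neutral hQ, hQE]
    field_simp
  change (2 * Real.pi : ℂ) ^ 2 * marginalFunctional θ₁ θ₂ (expansionCoeff p j) - _ = _
  rw [hQe, map_add, mul_add, hQm, add_sub_cancel_left]
  split_ifs
  · exact marginalFunctional_leadingPoly n m _ hconj θ₁ θ₂
  · simp

end Expansion

/-! ### Periodic integrals over the box -/

section Box

variable {d : ℕ} {L : Fin d → ℝ}

-- The box is a fundamental domain of the lattice spanned by the periods, and so is each of its
-- translates; a periodic function has the same integral over both.
open Pointwise in
theorem setIntegral_box_add {E : Type*} [NormedAddCommGroup E] [NormedSpace ℝ E]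
    (hL : ∀ i, 0 < L i) {g : (Fin d → ℝ) → E} (hg : ∀ x i, g (x + Pi.single i (L i)) = g x)
    (a : Fin d → ℝ) : ∫ x in box L, g (x + a) = ∫ x in box L, g x := by
  let b : Module.Basis (Fin d) ℝ (Fin d → ℝ) :=
    (Pi.basisFun ℝ (Fin d)).isUnitSMul (w := L) fun i => (hL i).ne'.isUnit
  have hb : ∀ i, b i = Pi.single i (L i) := by
    intro i
    simp only [b, Module.Basis.isUnitSMul_apply, Pi.basisFun_apply]
    rw [← Pi.single_smul, smul_eq_mul, mul_one]
  have hrepr : ∀ x i, b.repr x i = x i / L i := by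
    intro x i
    simp only [b, Module.Basis.repr_isUnitSMul, Pi.basisFun_repr]
    rw [Units.smul_def, smul_eq_mul, Units.val_inv_eq_inv_val, IsUnit.unit_spec]
    field_simp
  have hbox : ZSpan.fundamentalDomain b = box L := by
    ext x
    simp only [ZSpan.mem_fundamentalDomain, box, Set.mem_ofPred_eq, hrepr, Set.mem_Ico]
    refine forall_congr' fun i => ?_
    rw [div_lt_one (hL i), le_div_iff₀ (hL i), zero_mul]
  have hdom := ZSpan.isAddFundamentalDomain' b (volume : Measure (Fin d → ℝ))
  rw [hbox] at hdom
  have hinv : ∀ (γ : (Submodule.span ℤ (Set.range b)).toAddSubgroup) (x : Fin d → ℝ), g (γ +ᵥ x) = g x := by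
    rintro ⟨γ, hγ⟩ x
    change g (γ + x) = g x
    rw [Submodule.mem_toAddSubgroup] at hγ
    induction hγ using Submodule.span_induction generalizing x with
    | mem γ h =>
      obtain ⟨i, rfl⟩ := h
      rw [hb, add_comm, hg]
    | zero => rw [zero_add]
    | add γ γ' _ _ h h' => rw [add_assoc, h, h']
    | smul z γ _ h =>
      induction z generalizing x with
      | zero => rw [zero_smul, zero_add]
      | succ z hz => rw [add_smul, one_smul, add_assoc, hz, h]
      | pred z hz =>
        have := h (((-(z : ℤ) - 1) • γ) + x)
        rw [← this, ← hz x]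
        congr 1
        module
  have : Countable (Submodule.span ℤ (Set.range b)).toAddSubgroup :=
    inferInstanceAs (Countable (Submodule.span ℤ (Set.range b)))
  have h2 := hdom.vadd_of_comm (G' := (Fin d → ℝ)) a
  have h3 := h2.setIntegral_eq hdom hinv
  rw [← h3]
  have hmp := measurePreserving_add_right (volume : Measure (Fin d → ℝ)) a
  have hpre : box L = (fun x => x + a) ⁻¹' (a +ᵥ box L) := by
    ext x
    rw [Set.mem_preimage, add_comm x a]
    exact (Set.vadd_mem_vadd_set_iff (a := a)).symm
  conv_lhs => rw [hpre]
  exact hmp.setIntegral_preimage_emb (measurableEmbedding_addRight a) g _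

theorem isFiniteMeasure_box : IsFiniteMeasure ((volume : Measure (Fin d → ℝ)).restrict (box L)) := by
  refine ⟨?_⟩
  rw [Measure.restrict_apply_univ]
  have hsub : box L ⊆ Set.Icc 0 L := fun x hx => ⟨fun i => (hx i).1, fun i => (hx i).2.le⟩
  exact (measure_mono hsub).trans_lt isCompact_Icc.measure_lt_top

/-- The plane wave `e^{-i k·x}`. -/
def planeWave (k x : Fin d → ℝ) : ℂ := Complex.exp (-Complex.I * ((k ⬝ᵥ x : ℝ) : ℂ))

theorem planeWave_add (k x y : Fin d → ℝ) :
    planeWave k (x + y) = planeWave k x * planeWave k y := by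
  rw [planeWave, planeWave, planeWave, ← Complex.exp_add, dotProduct_add]
  push_cast
  ring_nf

theorem norm_planeWave (k x : Fin d → ℝ) : ‖planeWave k x‖ = 1 := by
  rw [planeWave, neg_mul, ← mul_neg, ← Complex.ofReal_neg, mul_comm,
    Complex.norm_exp_ofReal_mul_I]

theorem continuous_planeWave (k : Fin d → ℝ) : Continuous (planeWave k) := by
  unfold planeWave dotProduct
  fun_prop

theorem conj_planeWave (k x : Fin d → ℝ) :
    (starRingEnd ℂ) (planeWave k x) = planeWave (-k) x := by
  rw [planeWave, planeWave, ← Complex.exp_conj, map_mul, map_neg, Complex.conj_I,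
    Complex.conj_ofReal, neg_dotProduct]
  push_cast
  ring_nf

theorem planeWave_period (hL : ∀ i, 0 < L i) {k : Fin d → ℝ} (hk : IsWavevector L k) (i : Fin d) :
    planeWave k (Pi.single i (L i)) = 1 := by
  obtain ⟨z, hz⟩ := hk
  rw [planeWave, dotProduct_single, hz, div_mul_cancel₀ _ (hL i).ne', Complex.exp_eq_one_iff]
  exact ⟨-z i, by push_cast; ring⟩

end Box

theorem IsWavevector.neg {d : ℕ} {L k : Fin d → ℝ} (hk : IsWavevector L k) :
    IsWavevector L (-k) := by
  obtain ⟨z, hz⟩ := hk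
  exact ⟨-z, fun i => by simp [hz]; ring⟩

/-! ### Moments of Fourier modes -/

theorem conj_fourierMode {d : ℕ} {L : Fin d → ℝ} {Ω : Type*}
    {f : Ω → (Fin d → ℝ) → ℝ} (k : Fin d → ℝ) (ω : Ω) :
    (starRingEnd ℂ) (fourierMode L f k ω) = fourierMode L f (-k) ω := by
  change (starRingEnd ℂ) (_ * ∫ x in box L, (f ω x : ℂ) * planeWave k x)
    = _ * ∫ x in box L, (f ω x : ℂ) * planeWave (-k) x
  rw [map_mul, Complex.conj_ofReal, ← integral_conj]
  simp only [map_mul, Complex.conj_ofReal, conj_planeWave]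

section Field

variable {d : ℕ} {L : Fin d → ℝ} {Ω : Type*} [MeasurableSpace Ω] {μ : Measure Ω}
  {f : Ω → (Fin d → ℝ) → ℝ}

theorem IsHomogeneousField.measurable_apply (hf : IsHomogeneousField L μ f) (x : Fin d → ℝ) :
    Measurable fun ω => f ω x :=
  hf.measurable.comp (measurable_id.prodMk measurable_const)

theorem IsHomogeneousField.shift (hf : IsHomogeneousField L μ f) (a : Fin d → ℝ) :
    IsHomogeneousField L μ fun ω x => f ω (x + a) where
  measurable := hf.measurable.comp (measurable_fst.prodMk (measurable_snd.add_const a))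
  periodic ω x i := by rw [add_right_comm, hf.periodic]
  moments x N := hf.moments (x + a) N
  mean_zero x := hf.mean_zero (x + a)
  homogeneous b N x := by
    have := hf.homogeneous b N fun i => x i + a
    simpa only [add_right_comm _ b a] using this

theorem IsHomogeneousField.integral_comp_shift (hf : IsHomogeneousField L μ f) {N : ℕ}
    (x : Fin N → Fin d → ℝ) (a : Fin d → ℝ) {E : Type*} [NormedAddCommGroup E] [NormedSpace ℝ E]
    {g : (Fin N → ℝ) → E} (hg : Continuous g) :
    ∫ ω, g (fun i => f ω (x i + a)) ∂μ = ∫ ω, g (fun i => f ω (x i)) ∂μ := by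
  have h1 : AEMeasurable (fun ω i => f ω (x i + a)) μ :=
    (measurable_pi_lambda _ fun i => hf.measurable_apply _).aemeasurable
  have h2 : AEMeasurable (fun ω i => f ω (x i)) μ :=
    (measurable_pi_lambda _ fun i => hf.measurable_apply _).aemeasurable
  rw [← integral_map (f := g) h1, ← integral_map (f := g) h2, hf.homogeneous]
  all_goals
    exact hg.aestronglyMeasurable

theorem integrable_abs_pow (hf : IsHomogeneousField L μ f) (x : Fin d → ℝ) (N : ℕ) :
    Integrable (fun ω => |f ω x| ^ N) μ := by
  have := (hf.moments x N).abs
  simpa only [abs_pow] using this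

theorem integral_abs_pow_eq (hf : IsHomogeneousField L μ f) (x : Fin d → ℝ) (N : ℕ) :
    ∫ ω, |f ω x| ^ N ∂μ = ∫ ω, |f ω 0| ^ N ∂μ := by
  have := hf.integral_comp_shift (N := 1) (fun _ => 0) x
    (g := fun y : Fin 1 → ℝ => |y 0| ^ N) (by fun_prop)
  simpa using this

/-- Every factor is at most the largest one. The summand 1 is there for `N = 0`. -/
theorem prod_norm_le_one_add_sum {N : ℕ} (a : Fin N → ℝ) (ha : ∀ i, 0 ≤ a i) :
    ∏ i, a i ≤ 1 + ∑ i, a i ^ N := by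
  rcases N with _ | N
  · simp
  · obtain ⟨j, _, hj⟩ := Finset.exists_max_image Finset.univ a Finset.univ_nonempty
    calc ∏ i, a i ≤ ∏ _i : Fin (N + 1), a j :=
          Finset.prod_le_prod (fun i _ => ha i) fun i hi => hj i hi
      _ = a j ^ (N + 1) := by simp
      _ ≤ ∑ i, a i ^ (N + 1) := Finset.single_le_sum
          (f := fun i => a i ^ (N + 1)) (fun i _ => pow_nonneg (ha i) _) (Finset.mem_univ j)
      _ ≤ _ := by linarith

/-- The product measure on `N` copies of the box. -/
abbrev boxPi (L : Fin d → ℝ) (N : ℕ) : Measure (Fin N → Fin d → ℝ) :=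
  Measure.pi fun _ => (volume : Measure (Fin d → ℝ)).restrict (box L)

theorem measurable_eval_prod (hf : IsHomogeneousField L μ f) {N : ℕ} (i : Fin N) :
    Measurable fun p : Ω × (Fin N → Fin d → ℝ) => f p.1 (p.2 i) :=
  hf.measurable.comp (measurable_fst.prodMk ((measurable_pi_apply i).comp measurable_snd))

theorem powerSpectrum_neg (k : Fin d → ℝ) : powerSpectrum L μ f (-k) = powerSpectrum L μ f k := by
  unfold powerSpectrum
  simp only [← conj_fourierMode, RCLike.norm_conj]

theorem powerSpectrum_nonneg (k : Fin d → ℝ) : 0 ≤ powerSpectrum L μ f k :=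
  integral_nonneg fun _ => by positivity

theorem measurable_fourierMode (hf : IsHomogeneousField L μ f) (k : Fin d → ℝ) :
    Measurable (fourierMode L f k) := by
  have hm : Measurable (Function.uncurry fun ω (x : Fin d → ℝ) => (f ω x : ℂ) * planeWave k x) :=
    (Complex.measurable_ofReal.comp hf.measurable).mul
      ((continuous_planeWave k).measurable.comp measurable_snd)
  exact (hm.stronglyMeasurable.integral_prod_right
    (ν := (volume : Measure (Fin d → ℝ)).restrict (box L))).measurable.const_mul _

/-- For a wavevector of the box, `f e^{-ik·x}` is periodic, so the shift can be undone under the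
integral and leaves a phase factor. -/
theorem fourierMode_shift (hf : IsHomogeneousField L μ f) (hL : ∀ i, 0 < L i) {k : Fin d → ℝ}
    (hk : IsWavevector L k) (a : Fin d → ℝ) (ω : Ω) :
    fourierMode L (fun ω x => f ω (x + a)) k ω = planeWave (-k) a * fourierMode L f k ω := by
  have hpw : planeWave (-k) a * planeWave k a = 1 := by
    rw [← conj_planeWave, mul_comm, Complex.mul_conj, Complex.normSq_eq_norm_sq, norm_planeWave]
    simp
  have hper : ∀ x i, (f ω (x + Pi.single i (L i)) : ℂ) * planeWave k (x + Pi.single i (L i))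
      = (f ω x : ℂ) * planeWave k x := by
    intro x i
    rw [hf.periodic, planeWave_add, planeWave_period hL hk, mul_one]
  have h1 := setIntegral_box_add hL
    (g := fun x => (f ω x : ℂ) * planeWave k x) hper a
  have h2 : ∫ x in box L, (f ω (x + a) : ℂ) * planeWave k x
      = planeWave (-k) a * ∫ x in box L, (f ω x : ℂ) * planeWave k x := by
    rw [← h1, ← integral_const_mul]
    congr 1
    ext x
    rw [planeWave_add]
    linear_combination (-(f ω (x + a) : ℂ) * planeWave k x) * hpw
  change _ * ∫ x in box L, (f ω (x + a) : ℂ) * planeWave k x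
    = _ * (_ * ∫ x in box L, (f ω x : ℂ) * planeWave k x)
  rw [h2, mul_left_comm]

variable [IsProbabilityMeasure μ]

/-- The majorant involves the field at one point at a time, and its absolute moments do not depend
on the point by homogeneity. This justifies Fubini for the moments of the modes. -/
theorem integrable_prod_field (hf : IsHomogeneousField L μ f) {N : ℕ} (k : Fin N → Fin d → ℝ) :
    Integrable (fun p : Ω × (Fin N → Fin d → ℝ) =>
      ∏ i, ((f p.1 (p.2 i) : ℂ) * planeWave (k i) (p.2 i))) (μ.prod (boxPi L N)) := by
  have : IsFiniteMeasure ((volume : Measure (Fin d → ℝ)).restrict (box L)) := isFiniteMeasure_box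
  have hmaj : Integrable (fun p : Ω × (Fin N → Fin d → ℝ) =>
      1 + ∑ i, |f p.1 (p.2 i)| ^ N) (μ.prod (boxPi L N)) := by
    refine (integrable_const 1).add (integrable_finsetSum _ fun i _ => ?_)
    have hm : Measurable fun p : Ω × (Fin N → Fin d → ℝ) => |f p.1 (p.2 i)| ^ N :=
      (measurable_eval_prod hf i).abs.pow_const N
    rw [integrable_prod_iff' hm.aestronglyMeasurable]
    refine ⟨ae_of_all _ fun x => integrable_abs_pow hf (x i) N, ?_⟩
    have : ∀ x : Fin N → Fin d → ℝ, ∫ ω, ‖|f ω (x i)| ^ N‖ ∂μ = ∫ ω, |f ω 0| ^ N ∂μ := by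
      intro x
      rw [← integral_abs_pow_eq hf (x i)]
      simp
    simp only [this]
    exact integrable_const _
  refine hmaj.mono' ?_ (ae_of_all _ fun p => ?_)
  · refine Measurable.aestronglyMeasurable (Finset.measurable_prod _ fun i _ => ?_)
    exact (Complex.measurable_ofReal.comp (measurable_eval_prod hf i)).mul
      ((continuous_planeWave _).measurable.comp ((measurable_pi_apply i).comp measurable_snd))
  · rw [norm_prod]
    simp only [norm_mul, norm_planeWave, mul_one, Complex.norm_real, Real.norm_eq_abs]
    exact prod_norm_le_one_add_sum _ fun i => abs_nonneg _

/-- Moments of Fourier modes in terms of the correlation functions of the field. -/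
theorem integral_prod_fourierMode (hf : IsHomogeneousField L μ f) {N : ℕ}
    (k : Fin N → Fin d → ℝ) :
    ∫ ω, ∏ i, fourierMode L f (k i) ω ∂μ
      = (((Real.sqrt (boxVolume L))⁻¹ : ℝ) : ℂ) ^ N * ∫ x, (∏ i, planeWave (k i) (x i)) *
        ∫ ω, ∏ i, (f ω (x i) : ℂ) ∂μ ∂(boxPi L N) := by
  have : IsFiniteMeasure ((volume : Measure (Fin d → ℝ)).restrict (box L)) := isFiniteMeasure_box
  have h1 : ∀ ω, ∏ i, fourierMode L f (k i) ω = (((Real.sqrt (boxVolume L))⁻¹ : ℝ) : ℂ) ^ N *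
      ∫ x, ∏ i, ((f ω (x i) : ℂ) * planeWave (k i) (x i)) ∂(boxPi L N) := by
    intro ω
    rw [integral_fintype_prod_eq_prod fun i (y : Fin d → ℝ) => (f ω y : ℂ) * planeWave (k i) y]
    simp only [fourierMode]
    rw [Finset.prod_mul_distrib, Finset.prod_const, Finset.card_univ, Fintype.card_fin]
    rfl
  simp only [h1]
  rw [integral_const_mul, integral_integral_swap (integrable_prod_field hf k)]
  congr 2
  ext x
  rw [← integral_const_mul]
  simp only [Finset.prod_mul_distrib, mul_comm]

theorem prod_planeWave_sum {ι : Type*} (S : Finset ι) (k : ι → Fin d → ℝ) (a : Fin d → ℝ) :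
    ∏ i ∈ S, planeWave (k i) a = planeWave (∑ i ∈ S, k i) a := by
  simp only [planeWave]
  rw [← Complex.exp_sum, ← Finset.mul_sum, sum_dotProduct]
  push_cast
  rfl

/-- Moments of Fourier modes of nonvanishing total momentum vanish. -/
theorem integral_prod_fourierMode_eq_zero (hf : IsHomogeneousField L μ f) (hL : ∀ i, 0 < L i)
    {N : ℕ} {k : Fin N → Fin d → ℝ} (hk : ∀ i, IsWavevector L (k i)) (hsum : ∑ i, k i ≠ 0) :
    ∫ ω, ∏ i, fourierMode L f (k i) ω ∂μ = 0 := by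
  set K := ∑ i, k i with hK
  have hKK : K ⬝ᵥ K ≠ 0 := fun h => hsum (dotProduct_self_eq_zero.1 h)
  -- The shift is chosen with `K · a = π`: shifting the field flips the sign of the moment, while
  -- homogeneity leaves it unchanged.
  set a : Fin d → ℝ := (Real.pi / (K ⬝ᵥ K)) • K with ha
  have hpw : planeWave (-K) a = -1 := by
    rw [planeWave, ha, dotProduct_smul, neg_dotProduct, smul_eq_mul, mul_neg,
      div_mul_cancel₀ _ hKK]
    push_cast
    rw [neg_mul_neg, mul_comm, Complex.exp_pi_mul_I]
  have h1 : ∫ ω, ∏ i, fourierMode L (fun ω x => f ω (x + a)) (k i) ω ∂μ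
      = ∫ ω, ∏ i, fourierMode L f (k i) ω ∂μ := by
    rw [integral_prod_fourierMode (hf.shift a), integral_prod_fourierMode hf]
    congr 2
    ext x
    congr 1
    exact hf.integral_comp_shift x a (g := fun y : Fin N → ℝ => ∏ i, (y i : ℂ)) (by fun_prop)
  have h2 : ∀ ω, ∏ i, fourierMode L (fun ω x => f ω (x + a)) (k i) ω
      = -∏ i, fourierMode L f (k i) ω := by
    intro ω
    simp only [fun i => fourierMode_shift hf hL (hk i) a ω]
    rw [Finset.prod_mul_distrib, prod_planeWave_sum, Finset.sum_neg_distrib, ← hK, hpw,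
      neg_one_mul]
  simp only [h2] at h1
  rw [integral_neg, neg_eq_iff_add_eq_zero, ← two_mul] at h1
  simpa using h1

theorem integral_prod_finset_fourierMode_eq_zero (hf : IsHomogeneousField L μ f)
    (hL : ∀ i, 0 < L i) {κ : Type*} {k : κ → Fin d → ℝ} (hk : ∀ i, IsWavevector L (k i))
    (S : Finset κ) (hsum : ∑ i ∈ S, k i ≠ 0) :
    ∫ ω, ∏ i ∈ S, fourierMode L f (k i) ω ∂μ = 0 := by
  have e := S.equivFin.symm
  have hs : ∑ i : Fin S.card, k (e i) ≠ 0 := by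
    rwa [Equiv.sum_comp e (fun i : S => k i), Finset.sum_coe_sort]
  rw [← integral_prod_fourierMode_eq_zero hf hL (fun i => hk (e i)) hs]
  refine integral_congr_ae (ae_of_all _ fun ω => ?_)
  simp only
  rw [Equiv.prod_comp e (fun i : S => fourierMode L f (k i) ω),
    Finset.prod_coe_sort S fun i => fourierMode L f (k i) ω]

end Field

/-! ### Symmetries of polyspectra -/

section Cumulants

variable {Ω : Type*} [MeasurableSpace Ω] {μ : Measure Ω} [IsProbabilityMeasure μ]

/-- The cumulant depends only on the set of labels. A permutation `e` gives the symmetry of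
polyspectra; an enumeration of a block turns its cumulant into a polyspectrum. -/
theorem jointCumulant_comp_embedding {κ : Type*} [DecidableEq κ] (X : κ → Ω → ℂ) {N : ℕ}
    (hN : 0 < N) (e : Fin N ↪ κ) :
    jointCumulant μ (fun i => X (e i))
      = cumulantOf (fun S : Finset κ => ∫ ω, ∏ i ∈ S, X i ω ∂μ) (Finset.univ.map e) := by
  have hne : (Finset.univ : Finset (Fin N)).Nonempty := ⟨⟨0, hN⟩, Finset.mem_univ _⟩
  rw [← cumulantOf_map e (by simp) hne, jointCumulant]
  simp only [Finset.prod_map]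

theorem jointCumulant_conj {N : ℕ} (hN : 0 < N) (X : Fin N → Ω → ℂ) :
    jointCumulant μ (fun i ω => (starRingEnd ℂ) (X i ω))
      = (starRingEnd ℂ) (jointCumulant μ X) := by
  have hne : (Finset.univ : Finset (Fin N)).Nonempty := ⟨⟨0, hN⟩, Finset.mem_univ _⟩
  rw [jointCumulant, jointCumulant, ← cumulantOf_conj (by simp) hne]
  simp only [← integral_conj, map_prod]

end Cumulants

section Polyspectra

variable {d : ℕ} {L : Fin d → ℝ} {Ω : Type*} [MeasurableSpace Ω] {μ : Measure Ω}
  [IsProbabilityMeasure μ] {f : Ω → (Fin d → ℝ) → ℝ}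

theorem normalizedPolyspectrum_eq_zero (hf : IsHomogeneousField L μ f) (hL : ∀ i, 0 < L i)
    {N : ℕ} {k : Fin N → Fin d → ℝ} (hk : ∀ i, IsWavevector L (k i)) (hsum : ∑ i, k i ≠ 0) :
    normalizedPolyspectrum L μ f k = 0 := by
  rw [normalizedPolyspectrum, polyspectrum, jointCumulant, cumulantOf_eq_zero (by simp) k
    (fun S hS => integral_prod_finset_fourierMode_eq_zero hf hL hk S hS) hsum, mul_zero, zero_div]

theorem normalizedPolyspectrum_comp_perm {N : ℕ} (hN : 0 < N) (k : Fin N → Fin d → ℝ)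
    (σ : Equiv.Perm (Fin N)) :
    normalizedPolyspectrum L μ f (fun i => k (σ i)) = normalizedPolyspectrum L μ f k := by
  have h := jointCumulant_comp_embedding (μ := μ) (fun i => fourierMode L f (k i)) hN
    σ.toEmbedding
  rw [Finset.map_univ_equiv] at h
  rw [normalizedPolyspectrum, normalizedPolyspectrum, polyspectrum, polyspectrum,
    Equiv.prod_comp σ fun i => powerSpectrum L μ f (k i)]
  congr 2

theorem normalizedPolyspectrum_neg {N : ℕ} (hN : 0 < N) (k : Fin N → Fin d → ℝ) :
    normalizedPolyspectrum L μ f (fun i => -k i)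
      = (starRingEnd ℂ) (normalizedPolyspectrum L μ f k) := by
  have h := jointCumulant_conj (μ := μ) hN fun i => fourierMode L f (k i)
  rw [normalizedPolyspectrum, normalizedPolyspectrum, polyspectrum, polyspectrum, map_div₀,
    map_mul, Complex.conj_ofReal, Complex.conj_ofReal, ← h]
  simp only [powerSpectrum_neg]
  congr 3
  ext i ω
  rw [conj_fourierMode]

end Polyspectra

/-! ### Two collinear modes -/

section TwoModes

variable {d : ℕ} {k : Fin 2 → Fin d → ℝ} {n m : ℕ}

theorem Mode.vec_opp (k : Fin 2 → Fin d → ℝ) (s : Mode) : s.opp.vec k = -s.vec k := by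
  rcases s with ⟨i, b⟩
  cases b <;> simp [Mode.vec, Mode.opp]

theorem Mode.vec_eq_charge (k : Fin 2 → Fin d → ℝ) (s : Mode) :
    s.vec k = s.charge.1 • k 0 + s.charge.2 • k 1 := by
  rcases s with ⟨i, b⟩
  fin_cases i <;> cases b <;> simp [Mode.vec, Mode.charge]

theorem isWavevector_vec {L : Fin d → ℝ} (hk : ∀ a, IsWavevector L (k a)) (s : Mode) :
    IsWavevector L (s.vec k) := by
  unfold Mode.vec
  split_ifs
  · exact hk _
  · exact (hk _).neg

/-- For charge `c` the relation gives `m (c₁ k₁ + c₂ k₂) = (c₁ m + c₂ n) k₁`, and `k₁ ≠ 0`. -/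
theorem sum_vec_ne_zero (hk0 : k 0 ≠ 0) (hrel : (n : ℝ) • k 0 = (m : ℝ) • k 1) {κ : Type*}
    {S : Finset κ} {s : κ → Mode} (h : ¬ IsResonant n m (∑ i ∈ S, (s i).charge)) :
    ∑ i ∈ S, (s i).vec k ≠ 0 := by
  intro h0
  apply h
  simp only [Mode.vec_eq_charge, Finset.sum_add_distrib] at h0
  rw [← Finset.sum_smul, ← Finset.sum_smul, ← Prod.fst_sum, ← Prod.snd_sum] at h0
  set c := ∑ i ∈ S, (s i).charge
  have h1 : ((c.1 * m + c.2 * n : ℤ) : ℝ) • k 0 = 0 := by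
    have h2 : (m : ℝ) • (c.1 • k 0 + c.2 • k 1) = 0 := by rw [h0, smul_zero]
    rw [smul_add, smul_comm _ c.2, ← hrel] at h2
    rw [← h2]
    push_cast
    module
  rcases smul_eq_zero.1 h1 with h3 | h3
  · exact_mod_cast h3
  · exact absurd h3 hk0

theorem vec_resonantTuple_true (k : Fin 2 → Fin d → ℝ) (n m : ℕ) :
    (fun a => (resonantTuple n m true a).vec k)
      = Fin.append (fun _ : Fin n => k 0) (fun _ : Fin m => -k 1) := by
  funext a
  refine Fin.addCases (fun i => ?_) (fun i => ?_) a <;> simp [resonantTuple, Mode.vec]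

theorem vec_resonantTuple_false (k : Fin 2 → Fin d → ℝ) (n m : ℕ) :
    (fun a => (resonantTuple n m false a).vec k)
      = fun a => -(resonantTuple n m true a).vec k := by
  funext a
  refine Fin.addCases (fun i => ?_) (fun i => ?_) a <;> simp [resonantTuple, Mode.vec]

theorem three_le_add (hk01 : k 0 ≠ k 1) (hn : 0 < n) (hm : 0 < m)
    (hrel : (n : ℝ) • k 0 = (m : ℝ) • k 1) : 3 ≤ n + m := by
  by_contra h
  obtain rfl : n = 1 := by omega
  obtain rfl : m = 1 := by omega
  simp at hrel
  exact hk01 hrel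

end TwoModes

/-! ### Moments of the normalized modes -/

section NormalizedModes

variable {d : ℕ} {L : Fin d → ℝ} {Ω : Type*} [MeasurableSpace Ω] {μ : Measure Ω}
  {f : Ω → (Fin d → ℝ) → ℝ} {k : Fin 2 → Fin d → ℝ} {n m : ℕ}

/-- The pair `(α_{k₁}, α_{k₂})`. -/
def modePair (L : Fin d → ℝ) (μ : Measure Ω) (f : Ω → (Fin d → ℝ) → ℝ) (k : Fin 2 → Fin d → ℝ)
    (ω : Ω) : ℂ × ℂ :=
  (normalizedMode L μ f (k 0) ω, normalizedMode L μ f (k 1) ω)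

theorem powerSpectrum_vec (s : Mode) :
    powerSpectrum L μ f (s.vec k) = powerSpectrum L μ f (k s.1) := by
  unfold Mode.vec
  split_ifs
  · rfl
  · exact powerSpectrum_neg _

theorem modeValue_modePair (s : Mode) (ω : Ω) :
    modeValue (modePair L μ f k ω) s = normalizedMode L μ f (s.vec k) ω := by
  rcases s with ⟨i, b⟩
  fin_cases i <;> cases b <;>
    simp [modeValue, modePair, normalizedMode, Mode.vec, conj_fourierMode, powerSpectrum_neg]

theorem measurable_modePair (hf : IsHomogeneousField L μ f) : Measurable (modePair L μ f k) :=
  ((measurable_fourierMode hf _).div_const _).prodMk ((measurable_fourierMode hf _).div_const _)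

/-- The moments of the normalized modes. -/
def modeMoment {κ : Type*} (L : Fin d → ℝ) (μ : Measure Ω) (f : Ω → (Fin d → ℝ) → ℝ)
    (k : Fin 2 → Fin d → ℝ) (s : κ → Mode) (S : Finset κ) : ℂ :=
  ∫ ω, ∏ i ∈ S, modeValue (modePair L μ f k ω) (s i) ∂μ

theorem modeMoment_eq_mul {κ : Type*} (s : κ → Mode) (S : Finset κ) :
    modeMoment L μ f k s S = (∏ i ∈ S, ((Real.sqrt (powerSpectrum L μ f ((s i).vec k)) : ℝ) : ℂ)⁻¹)
      * ∫ ω, ∏ i ∈ S, fourierMode L f ((s i).vec k) ω ∂μ := by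
  unfold modeMoment
  rw [← integral_const_mul]
  simp only [modeValue_modePair, normalizedMode, div_eq_mul_inv, Finset.prod_mul_distrib, mul_comm]

theorem modeMoment_pair {κ : Type*} [DecidableEq κ] (s : κ → Mode)
    (hP : ∀ a, 0 < powerSpectrum L μ f (k a)) {i j : κ} (hij : i ≠ j)
    (h : s j = (s i).opp) : modeMoment L μ f k s {i, j} = 1 := by
  have hpos : 0 < powerSpectrum L μ f ((s i).vec k) := by
    rw [powerSpectrum_vec]; exact hP _
  have hsq : ((Real.sqrt (powerSpectrum L μ f ((s i).vec k)) : ℝ) : ℂ) ^ 2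
      = (powerSpectrum L μ f ((s i).vec k) : ℝ) := by
    rw [← Complex.ofReal_pow, Real.sq_sqrt hpos.le]
  have hne : ((powerSpectrum L μ f ((s i).vec k) : ℝ) : ℂ) ≠ 0 := by exact_mod_cast hpos.ne'
  have hint : ∫ ω, ∏ l ∈ {i, j}, fourierMode L f ((s l).vec k) ω ∂μ
      = (powerSpectrum L μ f ((s i).vec k) : ℝ) := by
    rw [powerSpectrum, ← integral_complex_ofReal]
    congr 1
    ext ω
    rw [Finset.prod_pair hij, h, Mode.vec_opp, ← conj_fourierMode, Complex.mul_conj,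
      Complex.normSq_eq_norm_sq]
  rw [modeMoment_eq_mul, hint, Finset.prod_pair hij, h, Mode.vec_opp, powerSpectrum_neg,
    ← mul_inv, ← sq, hsq, inv_mul_cancel₀ hne]

variable [IsProbabilityMeasure μ]

theorem modeMoment_empty {κ : Type*} (s : κ → Mode) : modeMoment L μ f k s ∅ = 1 := by
  simp [modeMoment]

theorem modeMoment_eq_zero (hf : IsHomogeneousField L μ f) (hL : ∀ i, 0 < L i)
    (hk : ∀ a, IsWavevector L (k a)) {κ : Type*} (s : κ → Mode) (S : Finset κ)
    (hS : ∑ i ∈ S, (s i).vec k ≠ 0) : modeMoment L μ f k s S = 0 := by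
  rw [modeMoment_eq_mul, integral_prod_finset_fourierMode_eq_zero hf hL
    (fun i => isWavevector_vec hk (s i)) S hS, mul_zero]

variable {κ : Type*} [DecidableEq κ] (s : κ → Mode)

theorem cumulantOf_modeMoment_of_not_isResonant (hf : IsHomogeneousField L μ f)
    (hL : ∀ i, 0 < L i) (hk : ∀ a, IsWavevector L (k a)) (hk0 : k 0 ≠ 0)
    (hrel : (n : ℝ) • k 0 = (m : ℝ) • k 1) {B : Finset κ}
    (hB : ¬ IsResonant n m (∑ i ∈ B, (s i).charge)) :
    cumulantOf (modeMoment L μ f k s) B = 0 :=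
  cumulantOf_eq_zero (modeMoment_empty s) (fun i => (s i).vec k)
    (fun S hS => modeMoment_eq_zero hf hL hk s S hS) (sum_vec_ne_zero hk0 hrel hB)

theorem eq_opp_of_charge_add_eq_zero {s t : Mode} (h : s.charge + t.charge = 0) : t = s.opp := by
  rcases s with ⟨i, b⟩
  rcases t with ⟨j, c⟩
  fin_cases i <;> fin_cases j <;> cases b <;> cases c <;>
    simp [Mode.charge, Mode.opp] at h ⊢

/-- The mean of a mode vanishes, because a unit charge is not resonant when `n + m ≥ 3`. The second
cumulant is thus the second moment, normalized to 1. -/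
theorem cumulantOf_modeMoment_of_card_eq_two (hf : IsHomogeneousField L μ f)
    (hL : ∀ i, 0 < L i) (hk : ∀ a, IsWavevector L (k a)) (hk0 : k 0 ≠ 0) (hn : 0 < n)
    (hnm : Nat.Coprime n m) (h3 : 3 ≤ n + m)
    (hrel : (n : ℝ) • k 0 = (m : ℝ) • k 1) (hP : ∀ a, 0 < powerSpectrum L μ f (k a))
    {B : Finset κ} (hB : B.card = 2) (hc : ∑ i ∈ B, (s i).charge = 0) :
    cumulantOf (modeMoment L μ f k s) B = 1 := by
  obtain ⟨i, j, hij, rfl⟩ := Finset.card_eq_two.1 hB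
  rw [Finset.sum_pair hij] at hc
  have hm0 : modeMoment L μ f k s {j} = 0 := by
    refine modeMoment_eq_zero hf hL hk s _ (sum_vec_ne_zero hk0 hrel fun hr => ?_)
    have hne : ∑ l ∈ {j}, (s l).charge ≠ 0 := by
      rw [Finset.sum_singleton]
      intro h
      have := (s j).abs_charge
      simp [h] at this
    have := le_card_of_isResonant s hn hnm hr hne
    simp at this
    omega
  have hrec := cumulantOf_recursion (modeMoment_empty (L := L) (μ := μ) (f := f) (k := k) s)
    (S := {i, j}) (x := i) (by simp)
  have hfil : {B ∈ ({i, j} : Finset κ).powerset | i ∈ B} = {{i}, {i, j}} := by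
    ext B
    simp only [Finset.mem_filter, Finset.mem_powerset, Finset.mem_insert, Finset.mem_singleton]
    constructor
    · rintro ⟨h1, h2⟩
      by_cases hj : j ∈ B
      · right
        exact h1.antisymm (by simp [Finset.insert_subset_iff, h2, hj])
      · left
        refine Finset.eq_singleton_iff_unique_mem.2 ⟨h2, fun x hx => ?_⟩
        rcases Finset.mem_insert.1 (h1 hx) with h | h
        · exact h
        · exact absurd (Finset.mem_singleton.1 h ▸ hx) hj
    · rintro (rfl | rfl) <;> simp
  have hne : ({i} : Finset κ) ≠ {i, j} := by
    intro h
    have : j ∈ ({i} : Finset κ) := by rw [h]; simp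
    exact hij (Finset.mem_singleton.1 this).symm
  have hsd : ({i, j} : Finset κ) \ {i} = {j} := by
    ext x
    simp only [Finset.mem_sdiff, Finset.mem_insert, Finset.mem_singleton]
    constructor
    · tauto
    · rintro rfl; exact ⟨Or.inr rfl, hij.symm⟩
  rw [hfil, Finset.sum_pair hne, hsd, hm0, mul_zero, zero_add, Finset.sdiff_self,
    modeMoment_empty, mul_one, modeMoment_pair s hP hij (eq_opp_of_charge_add_eq_zero hc)] at hrec
  exact hrec.symm

/-- Cumulants of the normalized modes are normalized polyspectra. -/
theorem cumulantOf_modeMoment_eq (hL : ∀ i, 0 < L i) {B : Finset κ} {N : ℕ} (hN : 0 < N)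
    (e : Fin N ↪ κ) (hB : Finset.univ.map e = B) :
    cumulantOf (modeMoment L μ f k s) B = ((boxVolume L ^ (1 - (N : ℝ) / 2) : ℝ) : ℂ) *
      normalizedPolyspectrum L μ f fun a => (s (e a)).vec k := by
  have hV : 0 < boxVolume L := Finset.prod_pos fun i _ => hL i
  have hne : B.Nonempty := by rw [← hB]; exact ⟨e ⟨0, hN⟩, by simp⟩
  have h1 : modeMoment L μ f k s = fun S : Finset κ =>
      (∏ i ∈ S, ((Real.sqrt (powerSpectrum L μ f ((s i).vec k)) : ℝ) : ℂ)⁻¹)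
        * ∫ ω, ∏ i ∈ S, fourierMode L f ((s i).vec k) ω ∂μ := funext (modeMoment_eq_mul s)
  rw [h1, cumulantOf_smul (by simp) _ hne, normalizedPolyspectrum, polyspectrum,
    jointCumulant_comp_embedding (fun i => fourierMode L f ((s i).vec k)) hN e, hB,
    Real.sqrt_prod _ fun i _ => powerSpectrum_nonneg _, ← hB, Finset.prod_map, mul_div_assoc',
    ← mul_assoc, ← Complex.ofReal_mul, ← Real.rpow_add hV, Finset.prod_inv_distrib]
  have : (1 - (N : ℝ) / 2 + ((N : ℝ) / 2 - 1)) = 0 := by ring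
  rw [this, Real.rpow_zero, Complex.ofReal_one, one_mul, inv_mul_eq_div, Complex.ofReal_prod]

end NormalizedModes

/-! ### Moments as polynomials in `V^{-1/2}` -/

section MomentPolynomials

variable {κ : Type*}

/-- The cumulants of the normalized modes as polynomials in `V^{-1/2}`. -/
def cumulantPoly (p : (N : ℕ) → (Fin N → Mode) → ℂ) (s : κ → Mode) (B : Finset κ) :
    Polynomial ℂ :=
  if B.card ≤ 1 then 0 else if B.card = 2 then (if ∑ i ∈ B, (s i).charge = 0 then 1 else 0)
  else Polynomial.C (p B.card fun i => s (B.equivFin.symm i)) * Polynomial.X ^ (B.card - 2)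

variable {n m : ℕ} {p : (N : ℕ) → (Fin N → Mode) → ℂ} (s : κ → Mode)

theorem sum_charge_equivFin (B : Finset κ) :
    ∑ i, (s (B.equivFin.symm i)).charge = ∑ i ∈ B, (s i).charge := by
  rw [Equiv.sum_comp B.equivFin.symm (fun i : B => (s i).charge),
    Finset.sum_coe_sort B fun i => (s i).charge]

theorem cumulantPoly_of_card_eq_two {B : Finset κ} (h : B.card = 2)
    (h0 : ∑ i ∈ B, (s i).charge = 0) : cumulantPoly p s B = 1 := by
  simp [cumulantPoly, h, h0]

theorem prod_eq_pow_mul_pow {M : Type*} [CommMonoid M] {b : Bool} {S : Finset κ}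
    (hS : ∀ i ∈ S, s i = (0, b) ∨ s i = (1, !b)) (g : Mode → M) :
    ∏ i ∈ S, g (s i) = g (0, b) ^ {i ∈ S | s i = (0, b)}.card *
      g (1, !b) ^ {i ∈ S | ¬ s i = (0, b)}.card := by
  rw [← Finset.prod_filter_mul_prod_filter_not S fun i => s i = (0, b)]
  congr 1
  · exact Finset.prod_eq_pow_card fun i hi => by rw [(Finset.mem_filter.1 hi).2]
  · refine Finset.prod_eq_pow_card fun i hi => ?_
    rw [Finset.mem_filter] at hi
    rw [(hS i hi.1).resolve_left hi.2]

/-- A block of `N ≥ 3` modes carries `ε^{N-2}`, and a charged block that does not vanish has `N ≥ n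
+ m`, with equality only at the minimal resonant charges. -/
theorem X_pow_dvd_cumulantPoly (hn : 0 < n) (hnm : Nat.Coprime n m)
    (hres : ∀ N, 3 ≤ N → ∀ s, ¬ IsResonant n m (∑ i, (s i).charge) → p N s = 0) {B : Finset κ}
    (hB : ∑ i ∈ B, (s i).charge ≠ 0) :
    Polynomial.X ^ (n + m - 2) ∣ cumulantPoly p s B ∧
      ((¬ ∃ b, B.card = n + m ∧ ∑ i ∈ B, (s i).charge = resonantCharge n m b) →
        Polynomial.X ^ (n + m - 2 + 1) ∣ cumulantPoly p s B) := by
  unfold cumulantPoly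
  split_ifs with h1 h2
  · simp
  · simp
  · by_cases hr : IsResonant n m (∑ i ∈ B, (s i).charge)
    · have hle := le_card_of_isResonant s hn hnm hr hB
      refine ⟨dvd_mul_of_dvd_right (pow_dvd_pow _ (by omega)) _, fun hb => ?_⟩
      have hne : B.card ≠ n + m := fun h => by
        obtain ⟨b, hb'⟩ := eq_resonantCharge s hn hnm hr hB h
        exact hb ⟨b, h, hb'⟩
      exact dvd_mul_of_dvd_right (pow_dvd_pow _ (by omega)) _
    · rw [hres _ (by omega)]
      · simp
      · rwa [sum_charge_equivFin]

theorem card_filter_of_resonantCharge {b : Bool} {S : Finset κ}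
    (hS : ∀ i ∈ S, s i = (0, b) ∨ s i = (1, !b))
    (hc : ∑ i ∈ S, (s i).charge = resonantCharge n m b) :
    {i ∈ S | s i = (0, b)}.card = n ∧ {i ∈ S | ¬ s i = (0, b)}.card = m := by
  have h := prod_eq_pow_mul_pow s hS fun t => Multiplicative.ofAdd t.charge
  rw [← ofAdd_sum, hc, ← ofAdd_nsmul, ← ofAdd_nsmul, ← ofAdd_add] at h
  have h' := Multiplicative.ofAdd.injective h
  cases b <;> simpa [resonantCharge, Mode.charge, eq_comm] using h'

variable [DecidableEq κ]

/-- Charge is additive, so every partition of a charged set has a charged block. -/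
theorem X_pow_dvd_momentOf (hn : 0 < n) (hnm : Nat.Coprime n m)
    (hres : ∀ N, 3 ≤ N → ∀ s, ¬ IsResonant n m (∑ i, (s i).charge) → p N s = 0) {S : Finset κ}
    (hS : ∑ i ∈ S, (s i).charge ≠ 0) :
    Polynomial.X ^ (n + m - 2) ∣ momentOf (cumulantPoly p s) S := by
  induction S using Finset.strongInduction with
  | H S ih =>
    have hne : S.Nonempty := by
      rw [Finset.nonempty_iff_ne_empty]; rintro rfl; simp at hS
    obtain ⟨x, hx⟩ := hne
    rw [momentOf_eq_sum _ hx]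
    refine Finset.dvd_sum fun B hB => ?_
    rw [Finset.mem_filter, Finset.mem_powerset] at hB
    by_cases h : ∑ i ∈ B, (s i).charge = 0
    · refine dvd_mul_of_dvd_right (ih _ (Finset.sdiff_ssubset hB.1 ⟨x, hB.2⟩) ?_) _
      rwa [← Finset.sum_sdiff hB.1, h, add_zero] at hS
    · exact dvd_mul_of_dvd_left (X_pow_dvd_cumulantPoly s hn hnm hres h).1 _

/-- Only pairs of opposite modes and blocks of minimal resonant charge contribute to the leading
coefficient of a charged moment. -/
theorem coeff_mul_momentOf_eq_zero (hn : 0 < n) (h3 : 3 ≤ n + m) (hnm : Nat.Coprime n m)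
    (hres : ∀ N, 3 ≤ N → ∀ s, ¬ IsResonant n m (∑ i, (s i).charge) → p N s = 0)
    {S B : Finset κ} (hBS : B ⊆ S) (hS : ∑ i ∈ S, (s i).charge ≠ 0)
    (h2 : ¬ (B.card = 2 ∧ ∑ i ∈ B, (s i).charge = 0))
    (hb : ¬ ∃ b, B.card = n + m ∧ ∑ i ∈ B, (s i).charge = resonantCharge n m b ∧
      ∑ i ∈ S, (s i).charge = resonantCharge n m b) :
    (cumulantPoly p s B * momentOf (cumulantPoly p s) (S \ B)).coeff (n + m - 2) = 0 := by
  have hdvd : ∀ q : Polynomial ℂ, Polynomial.X ^ (n + m - 2 + 1) ∣ q →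
      q.coeff (n + m - 2) = 0 := fun q hq =>
    Polynomial.X_pow_dvd_iff.1 hq _ (Nat.lt_succ_self _)
  apply hdvd
  have hsum := Finset.sum_sdiff (f := fun i => (s i).charge) hBS
  by_cases hB : ∑ i ∈ B, (s i).charge = 0
  · rw [hB, add_zero] at hsum
    rw [pow_succ']
    -- A neutral block other than a pair brings an extra power of `ε`, on top of those of the
    -- charged complement.
    refine mul_dvd_mul ?_ (X_pow_dvd_momentOf s hn hnm hres (hsum ▸ hS))
    unfold cumulantPoly
    split_ifs with h h'
    · simp
    · exact absurd ⟨h', hB⟩ h2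
    · exact dvd_mul_of_dvd_right (dvd_pow_self _ (by omega)) _
  · obtain ⟨hd, hd'⟩ := X_pow_dvd_cumulantPoly s hn hnm hres hB
    by_cases hSB : ∑ i ∈ S \ B, (s i).charge = 0
    · rw [hSB, zero_add] at hsum
      exact dvd_mul_of_dvd_left (hd' fun ⟨b, hb1, hb2⟩ => hb ⟨b, hb1, hb2, hsum ▸ hb2⟩) _
    -- Two charged factors give `ε^{2(n+m-2)}`, which is beyond the leading order since `n + m ≥ 3`.
    · have hmul := mul_dvd_mul hd (X_pow_dvd_momentOf s hn hnm hres hSB)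
      rw [← pow_add] at hmul
      exact (pow_dvd_pow _ (by omega)).trans hmul

/-- Splitting off a neutral pair does not change the charge, so induction applies; every other block
is of higher order. -/
theorem coeff_momentOf_of_not_resonantCharge (hn : 0 < n) (h3 : 3 ≤ n + m)
    (hnm : Nat.Coprime n m)
    (hres : ∀ N, 3 ≤ N → ∀ s, ¬ IsResonant n m (∑ i, (s i).charge) → p N s = 0)
    {S : Finset κ} (hS : ∑ i ∈ S, (s i).charge ≠ 0)
    (hb : ∀ b, ∑ i ∈ S, (s i).charge ≠ resonantCharge n m b) :
    (momentOf (cumulantPoly p s) S).coeff (n + m - 2) = 0 := by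
  induction S using Finset.strongInduction with
  | H S ih =>
    have hne : S.Nonempty := by
      rw [Finset.nonempty_iff_ne_empty]; rintro rfl; simp at hS
    obtain ⟨x, hx⟩ := hne
    rw [momentOf_eq_sum _ hx, Polynomial.finsetSum_coeff]
    refine Finset.sum_eq_zero fun B hB => ?_
    rw [Finset.mem_filter, Finset.mem_powerset] at hB
    by_cases h2 : B.card = 2 ∧ ∑ i ∈ B, (s i).charge = 0
    · rw [cumulantPoly_of_card_eq_two s h2.1 h2.2, one_mul]
      have hsum := Finset.sum_sdiff (f := fun i => (s i).charge) hB.1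
      rw [h2.2, add_zero] at hsum
      exact ih _ (Finset.sdiff_ssubset hB.1 ⟨x, hB.2⟩) (hsum ▸ hS) (hsum ▸ hb)
    · exact coeff_mul_momentOf_eq_zero s hn h3 hnm hres hB.1 hS h2
        fun ⟨b, _, _, h⟩ => hb b h

theorem pderiv_resonantMonomial {b : Bool} {t : Mode} (h0 : t ≠ (0, !b)) (h1 : t ≠ (1, b)) :
    MvPolynomial.pderiv t (resonantMonomial n m b) = 0 := by
  rw [resonantMonomial, MvPolynomial.pderiv_mul, MvPolynomial.pderiv_pow, MvPolynomial.pderiv_pow,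
    MvPolynomial.pderiv_X_of_ne h0.symm, MvPolynomial.pderiv_X_of_ne h1.symm]
  simp

/-- Contraction of a factor that is not contracted with the resonant monomial. -/
theorem gaussExpect_prod_mul_resonantMonomial {b : Bool} {S : Finset κ} {x : κ} (hx : x ∈ S)
    (hs : s x = (0, !b) ∨ s x = (1, b)) :
    gaussExpect ((∏ i ∈ S, MvPolynomial.X (s i)) * resonantMonomial n m b)
      = ∑ y ∈ S.erase x with s y = (s x).opp,
        gaussExpect ((∏ i ∈ (S.erase x).erase y, MvPolynomial.X (s i)) *
          resonantMonomial n m b) := by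
  rw [← Finset.mul_prod_erase _ _ hx, mul_assoc, gaussExpect_X_mul, MvPolynomial.pderiv_mul,
    pderiv_prod_X, pderiv_resonantMonomial, mul_zero, add_zero, Finset.sum_mul, map_sum]
  all_goals
    rcases hs with h | h <;> rw [h] <;> cases b <;> simp [Mode.opp]

/-- The leading coefficient of a moment of resonant charge. -/
theorem coeff_momentOf_of_resonantCharge (hn : 0 < n) (h3 : 3 ≤ n + m) (hnm : Nat.Coprime n m)
    (hres : ∀ N, 3 ≤ N → ∀ s, ¬ IsResonant n m (∑ i, (s i).charge) → p N s = 0)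
    (hperm : ∀ (s : Fin (n + m) → Mode) (σ : Equiv.Perm (Fin (n + m))),
      p (n + m) (s ∘ σ) = p (n + m) s) {b : Bool}
    {S : Finset κ} (hS : ∑ i ∈ S, (s i).charge = resonantCharge n m b) :
    (momentOf (cumulantPoly p s) S).coeff (n + m - 2)
      = p (n + m) (resonantTuple n m b) / (n.factorial * m.factorial) *
        gaussExpect ((∏ i ∈ S, MvPolynomial.X (s i)) * resonantMonomial n m b) := by
  induction S using Finset.strongInduction with
  | H S ih =>
    have hS0 : ∑ i ∈ S, (s i).charge ≠ 0 := by rw [hS]; exact resonantCharge_ne_zero hn b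
    -- Such an `x` cannot sit in the block of minimal resonant charge, so at leading order it is
    -- paired with an opposite mode. On the Gaussian side it cannot be contracted with the resonant
    -- monomial, and the two recursions agree.
    by_cases hex : ∃ x ∈ S, s x = (0, !b) ∨ s x = (1, b)
    · obtain ⟨x, hx, hsx⟩ := hex
      rw [gaussExpect_prod_mul_resonantMonomial s hx hsx, Finset.mul_sum, momentOf_eq_sum _ hx,
        Polynomial.finsetSum_coeff]
      have hsub : ({B ∈ S.powerset | x ∈ B}.filter fun B =>
          B.card = 2 ∧ ∑ i ∈ B, (s i).charge = 0) ⊆ {B ∈ S.powerset | x ∈ B} :=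
        Finset.filter_subset _ _
      rw [← Finset.sum_subset hsub]
      · symm
        refine Finset.sum_bij (fun y _ => {x, y}) ?_ ?_ ?_ ?_
        · intro y hy
          rw [Finset.mem_filter, Finset.mem_erase] at hy
          have hne : x ≠ y := fun h => hy.1.1 h.symm
          simp only [Finset.mem_filter, Finset.mem_powerset]
          refine ⟨⟨by simp [Finset.insert_subset_iff, hx, hy.1.2], by simp⟩,
            Finset.card_pair hne, ?_⟩
          rw [Finset.sum_pair hne, hy.2, Mode.charge_opp, add_neg_cancel]
        · intro y hy y' hy' h
          rw [Finset.mem_filter, Finset.mem_erase] at hy hy'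
          have : y ∈ ({x, y'} : Finset κ) := by rw [← h]; simp
          simpa [hy.1.1] using this
        · intro B hB
          simp only [Finset.mem_filter, Finset.mem_powerset] at hB
          obtain ⟨⟨hBS, hxB⟩, hcard, hch⟩ := hB
          obtain ⟨y, hy⟩ := Finset.card_eq_one.1
            (by rw [Finset.card_erase_of_mem hxB, hcard] : (B.erase x).card = 1)
          have hyB : y ∈ B.erase x := by rw [hy]; simp
          rw [Finset.mem_erase] at hyB
          have hB' : B = {x, y} := by rw [← Finset.insert_erase hxB, hy]
          refine ⟨y, ?_, hB'.symm⟩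
          rw [Finset.mem_filter, Finset.mem_erase]
          refine ⟨⟨hyB.1, hBS hyB.2⟩, ?_⟩
          rw [hB', Finset.sum_pair hyB.1.symm] at hch
          exact eq_opp_of_charge_add_eq_zero hch
        · intro y hy
          rw [Finset.mem_filter, Finset.mem_erase] at hy
          have hne : x ≠ y := fun h => hy.1.1 h.symm
          have hch : ∑ i ∈ {x, y}, (s i).charge = 0 := by
            rw [Finset.sum_pair hne, hy.2, Mode.charge_opp, add_neg_cancel]
          have hsd : (S.erase x).erase y = S \ {x, y} := by
            ext i
            simp only [Finset.mem_erase, Finset.mem_sdiff, Finset.mem_insert,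
              Finset.mem_singleton]
            tauto
          have hsub : ({x, y} : Finset κ) ⊆ S := by
            simp [Finset.insert_subset_iff, hx, hy.1.2]
          have hsum := Finset.sum_sdiff (f := fun i => (s i).charge) hsub
          rw [hch, add_zero] at hsum
          rw [cumulantPoly_of_card_eq_two s (Finset.card_pair hne) hch, one_mul, hsd,
            ih _ (Finset.sdiff_ssubset hsub ⟨x, by simp⟩) (hsum.trans hS)]
      · intro B hB hB'
        have hB2 := Finset.mem_filter.1 hB
        rw [Finset.mem_powerset] at hB2
        refine coeff_mul_momentOf_eq_zero s hn h3 hnm hres hB2.1 hS0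
          (fun h => hB' (Finset.mem_filter.2 ⟨hB, h⟩)) ?_
        rintro ⟨b', hcard, hb1, hb2⟩
        obtain rfl : b' = b := resonantCharge_injective hn (hb2.symm.trans hS)
        have := (mem_of_resonantCharge s hb1 hcard).1 x hB2.2
        rcases hsx with h | h <;> rw [h] at this <;> cases b' <;> simp at this
    -- With no such `x`, the set `S` is the minimal configuration itself: the only block that
    -- contributes is `S`, and the Gaussian moment is `n! m!`.
    · have hall : ∀ i ∈ S, s i = (0, b) ∨ s i = (1, !b) := by
        intro i hi
        have := fun h => hex ⟨i, hi, h⟩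
        generalize s i = t at this
        rcases t with ⟨j, c⟩
        fin_cases j <;> cases c <;> cases b <;> simp at this ⊢
      obtain ⟨hcn, hcm⟩ := card_filter_of_resonantCharge s hall hS
      have hcard : S.card = n + m := by
        rw [← hcn, ← hcm, Finset.card_filter_add_card_filter_not]
      have hE : gaussExpect ((∏ i ∈ S, MvPolynomial.X (s i)) * resonantMonomial n m b)
          = n.factorial * m.factorial := by
        rw [prod_eq_pow_mul_pow s hall fun t => (MvPolynomial.X t : MvPolynomial Mode ℂ), hcn, hcm,
          MvPolynomial.X_pow_eq_monomial, MvPolynomial.X_pow_eq_monomial,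
          MvPolynomial.monomial_mul, resonantMonomial_eq, MvPolynomial.monomial_mul,
          gaussExpect_monomial]
        cases b <;> simp
      have hK : cumulantPoly p s S = Polynomial.C (p (n + m) (resonantTuple n m b)) *
          Polynomial.X ^ (n + m - 2) := by
        have hp : ∀ N (hN : N = n + m) (t : Fin N → Mode),
            ∑ i, (t i).charge = resonantCharge n m b →
            p N t = p (n + m) (resonantTuple n m b) := by
          rintro N rfl t ht
          obtain ⟨σ, rfl⟩ := exists_perm_of_resonantCharge rfl ht
            (sum_charge_resonantTuple n m b)
          exact hperm _ _
        rw [cumulantPoly, if_neg (by omega), if_neg (by omega),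
          hp S.card hcard _ ((sum_charge_equivFin s S).trans hS), hcard]
      obtain ⟨x, hx⟩ : S.Nonempty := Finset.card_pos.1 (by omega)
      have hf1 : (n.factorial : ℂ) ≠ 0 := by exact_mod_cast n.factorial_ne_zero
      have hf2 : (m.factorial : ℂ) ≠ 0 := by exact_mod_cast m.factorial_ne_zero
      rw [hE, div_mul_cancel₀ _ (mul_ne_zero hf1 hf2), momentOf_eq_sum _ hx,
        Polynomial.finsetSum_coeff, Finset.sum_eq_single S]
      · rw [Finset.sdiff_self, momentOf_empty, mul_one, hK, Polynomial.coeff_C_mul,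
          Polynomial.coeff_X_pow_self, mul_one]
      · intro B hB hBS
        rw [Finset.mem_filter, Finset.mem_powerset] at hB
        refine coeff_mul_momentOf_eq_zero s hn h3 hnm hres hB.1 hS0 ?_ ?_
        · rintro ⟨h2, hch⟩
          obtain ⟨i, j, hij, rfl⟩ := Finset.card_eq_two.1 h2
          rw [Finset.sum_pair hij] at hch
          have hopp := eq_opp_of_charge_add_eq_zero hch
          rcases hall i (hB.1 (by simp)) with h | h <;>
            rcases hall j (hB.1 (by simp)) with h' | h' <;> rw [h, h'] at hopp <;>
            cases b <;> simp [Mode.opp] at hopp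
        · rintro ⟨b', hc', -, -⟩
          exact hBS (Finset.eq_of_subset_of_card_le hB.1 (by omega))
      · intro h
        simp [hx] at h

/-- The leading coefficient of a charged moment is the corresponding Gaussian moment of the leading
polynomial. -/
theorem coeff_momentOf_eq_gaussExpect (hn : 0 < n) (h3 : 3 ≤ n + m) (hnm : Nat.Coprime n m)
    (hres : ∀ N, 3 ≤ N → ∀ s, ¬ IsResonant n m (∑ i, (s i).charge) → p N s = 0)
    (hperm : ∀ (s : Fin (n + m) → Mode) (σ : Equiv.Perm (Fin (n + m))),
      p (n + m) (s ∘ σ) = p (n + m) s)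
    {S : Finset κ} (hS : ∑ i ∈ S, (s i).charge ≠ 0) :
    (momentOf (cumulantPoly p s) S).coeff (n + m - 2)
      = gaussExpect ((∏ i ∈ S, MvPolynomial.X (s i)) *
          leadingPoly n m fun b => p (n + m) (resonantTuple n m b)) := by
  have hzero : ∀ b, ∑ i ∈ S, (s i).charge ≠ resonantCharge n m b →
      gaussExpect ((∏ i ∈ S, MvPolynomial.X (s i)) * resonantMonomial n m b) = 0 := by
    intro b hb
    have h1 := MvPolynomial.IsWeightedHomogeneous.prod S
      (fun i => (MvPolynomial.X (s i) : MvPolynomial Mode ℂ)) (fun i => (s i).charge)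
      (fun i _ => MvPolynomial.isWeightedHomogeneous_X ℂ Mode.charge (s i))
    refine gaussExpect_of_charged ?_ (h1.mul (isWeightedHomogeneous_resonantMonomial n m b))
    intro h
    apply hb
    rw [eq_neg_of_add_eq_zero_left h]
    cases b <;> simp [resonantCharge]
  rw [leadingPoly, Finset.mul_sum, map_sum]
  simp only [mul_smul_comm, map_smul, smul_eq_mul]
  by_cases hex : ∃ b, ∑ i ∈ S, (s i).charge = resonantCharge n m b
  · obtain ⟨b, hb⟩ := hex
    rw [Finset.sum_eq_single b, coeff_momentOf_of_resonantCharge s hn h3 hnm hres hperm hb]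
    · intro b' _ hne
      rw [hzero b', mul_zero]
      rw [hb]
      exact fun h => hne (resonantCharge_injective hn h).symm
    · simp
  · rw [coeff_momentOf_of_not_resonantCharge s hn h3 hnm hres hS fun b h => hex ⟨b, h⟩,
      Finset.sum_eq_zero]
    intro b _
    rw [hzero b fun h => hex ⟨b, h⟩, mul_zero]

end MomentPolynomials

/-! ### Asymptotic expansions -/

/-- A polynomial that vanishes to high order along a sequence tending to zero has vanishing low
coefficients. -/
theorem coeff_eq_zero_of_norm_eval_le {ι : Type*} {l : Filter ι} [l.NeBot] {ε : ι → ℝ}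
    (hε : Tendsto ε l (nhds 0)) (hpos : ∀ᶠ i in l, 0 < ε i) {D : Polynomial ℂ} {C : ℝ} {J : ℕ}
    (h : ∀ᶠ i in l, ‖D.eval (ε i : ℂ)‖ ≤ C * ε i ^ (J + 1)) {j : ℕ} (hj : j ≤ J) :
    D.coeff j = 0 := by
  induction j using Nat.strong_induction_on with
  | h j ih =>
    -- With the lower coefficients already zero, `D = X^j R` and `R 0` is the coefficient in
    -- question; the bound divided by `ε^j` still tends to zero because `j ≤ J`.
    obtain ⟨R, hR⟩ := Polynomial.X_pow_dvd_iff.2 fun i hi => ih i hi (hi.le.trans hj)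
    have h0 : D.coeff j = R.eval 0 := by
      rw [hR, Polynomial.coeff_X_pow_mul', if_pos le_rfl, Nat.sub_self, Polynomial.coeff_zero_eq_eval_zero]
    have hlim : Tendsto (fun i => R.eval (ε i : ℂ)) l (nhds (R.eval 0)) := by
      have hc : Tendsto (fun i => (ε i : ℂ)) l (nhds 0) := by
        have := (Complex.continuous_ofReal.tendsto 0).comp hε
        rwa [Complex.ofReal_zero] at this
      exact (R.continuous.tendsto 0).comp hc
    have hbound : ∀ᶠ i in l, ‖R.eval (ε i : ℂ)‖ ≤ C * ε i ^ (J + 1 - j) := by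
      filter_upwards [h, hpos] with i hi hi0
      rw [hR, Polynomial.eval_mul, Polynomial.eval_pow, Polynomial.eval_X, norm_mul, norm_pow,
        Complex.norm_real, Real.norm_eq_abs, abs_of_pos hi0] at hi
      have hsplit : ε i ^ (J + 1) = ε i ^ j * ε i ^ (J + 1 - j) := by
        rw [← pow_add]; congr 1; omega
      rw [hsplit, mul_left_comm] at hi
      exact le_of_mul_le_mul_left hi (pow_pos hi0 j)
    have hz : Tendsto (fun i => C * ε i ^ (J + 1 - j)) l (nhds 0) := by
      have := (hε.pow (J + 1 - j)).const_mul C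
      rwa [zero_pow (by omega), mul_zero] at this
    rw [h0]
    exact tendsto_nhds_unique hlim (squeeze_zero_norm' hbound hz)

theorem rpow_neg_half_mul {V : ℝ} (hV : 0 < V) (j : ℕ) :
    V ^ (-((j : ℝ) / 2)) = (V ^ (-(1 / 2 : ℝ))) ^ j := by
  rw [← Real.rpow_natCast, ← Real.rpow_mul hV.le]
  ring_nf

/-- Partial sum of an expansion in powers of `ε`. -/
def partialSum (q : ℕ → MvPolynomial Mode ℂ) (J : ℕ) (ε : ℝ) : MvPolynomial Mode ℂ :=
  ∑ j ∈ Finset.range (J + 1), ((ε : ℂ) ^ j) • q j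

theorem polyGauss_mul (p q : MvPolynomial Mode ℂ) (z : ℂ × ℂ) :
    polyGauss (p * q) z = MvPolynomial.eval (modeValue z) p * polyGauss q z := by
  simp [polyGauss, mul_assoc]

theorem polyGauss_partialSum (q : ℕ → MvPolynomial Mode ℂ) (J : ℕ) (ε : ℝ) (z : ℂ × ℂ) :
    polyGauss (partialSum q J ε) z
      = ∑ j ∈ Finset.range (J + 1), (ε : ℂ) ^ j * polyGauss (q j) z := by
  simp [polyGauss, partialSum, Finset.sum_mul, mul_assoc, MvPolynomial.smul_eval]

section Expansion

variable {ι : Type*} {l : Filter ι} {V : ι → ℝ} {ρ : ι → ℂ × ℂ → ℝ}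
  {q : ℕ → MvPolynomial Mode ℂ}

theorem HasVolumeExpansion.exists_hasDecay (h : HasVolumeExpansion l V ρ q)
    (hρ : ∀ i, Measurable (ρ i)) (hV : ∀ᶠ i in l, 0 < V i) (g : MvPolynomial Mode ℂ) (J : ℕ) :
    ∃ C : ℝ, ∀ᶠ i in l, HasDecay (fun z => MvPolynomial.eval (modeValue z) g *
      ((ρ i z : ℂ) - polyGauss (partialSum q J (V i ^ (-(1 / 2 : ℝ)))) z))
      (C * (V i ^ (-(1 / 2 : ℝ))) ^ (J + 1)) := by
  obtain ⟨C, hC, k, hg⟩ := exists_norm_eval_le g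
  -- In each variable `k` powers compensate the growth of `g` and 4 make up `decayWeight`; the
  -- factor 2 is due to `(1 + ‖z.1‖) (1 + ‖z.2‖) ≤ (1 + ‖z‖)²`.
  obtain ⟨K, hK⟩ := h J (2 * (k + 4))
  refine ⟨C * |K|, ?_⟩
  filter_upwards [hK, hV] with i hi hVi
  set ε := V i ^ (-(1 / 2 : ℝ)) with hε
  have hε0 : 0 < ε := Real.rpow_pos_of_pos hVi _
  refine ⟨?_, fun z => ?_⟩
  · obtain ⟨_, hm⟩ := exists_hasDecay_polyGauss (partialSum q J ε)
    exact (continuous_eval_modeValue g).measurable.mul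
      ((Complex.measurable_ofReal.comp (hρ i)).sub hm.1)
  · have h1 := hi z
    have h2 : ∑ j ∈ Finset.range (J + 1), ((V i ^ (-((j : ℝ) / 2)) : ℝ) : ℂ) * polyGauss (q j) z
        = polyGauss (partialSum q J ε) z := by
      rw [polyGauss_partialSum]
      refine Finset.sum_congr rfl fun j _ => ?_
      rw [rpow_neg_half_mul hVi, ← hε, Complex.ofReal_pow]
    have h3 := rpow_neg_half_mul hVi (J + 1)
    push_cast at h3
    rw [h2, h3, ← hε] at h1
    rw [norm_mul]
    set x := 1 + ‖z.1‖ with hx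
    set y := 1 + ‖z.2‖ with hy
    have hx0 : 0 < x := by positivity
    have hy0 : 0 < y := by positivity
    have hxz : x ≤ 1 + ‖z‖ := by
      have := norm_fst_le z; linarith
    have hyz : y ≤ 1 + ‖z‖ := by
      have := norm_snd_le z; linarith
    have h4 : (x * y) ^ (k + 4) ≤ (1 + ‖z‖) ^ (2 * (k + 4)) := by
      rw [pow_mul, sq]
      gcongr
    have h5 : ((1 + ‖z‖) ^ (2 * (k + 4)))⁻¹ ≤ ((x * y) ^ (k + 4))⁻¹ := by
      gcongr
    calc _ ≤ (C * (x * y) ^ k) * (|K| * ε ^ (J + 1) * ((x * y) ^ (k + 4))⁻¹) := by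
          refine mul_le_mul (hg z) (h1.trans ?_) (norm_nonneg _) (by positivity)
          refine mul_le_mul ?_ h5 (by positivity) (by positivity)
          exact mul_le_mul_of_nonneg_right (le_abs_self K) (by positivity)
      _ = C * |K| * ε ^ (J + 1) * decayWeight z := by
          rw [decayWeight, ← hx, ← hy]
          field_simp
          rw [pow_add, mul_pow x y 4]
          ring

theorem HasVolumeExpansion.exists_moment_bound (h : HasVolumeExpansion l V ρ q)
    (hρ : ∀ i, Measurable (ρ i)) (hV : ∀ᶠ i in l, 0 < V i) (g : MvPolynomial Mode ℂ) (J : ℕ) :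
    ∃ C : ℝ, ∀ᶠ i in l, ‖(∫ z, MvPolynomial.eval (modeValue z) g * (ρ i z : ℂ))
      - gaussExpect (g * partialSum q J (V i ^ (-(1 / 2 : ℝ))))‖
      ≤ C * (V i ^ (-(1 / 2 : ℝ))) ^ (J + 1) := by
  obtain ⟨C, hC⟩ := h.exists_hasDecay hρ hV g J
  refine ⟨C * ∫ z, decayWeight z, ?_⟩
  filter_upwards [hC] with i hi
  set Q := partialSum q J (V i ^ (-(1 / 2 : ℝ)))
  obtain ⟨D, hD⟩ := exists_hasDecay_polyGauss (g * Q)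
  have hsum : ∫ z, MvPolynomial.eval (modeValue z) g * (ρ i z : ℂ)
      = (∫ z, MvPolynomial.eval (modeValue z) g * ((ρ i z : ℂ) - polyGauss Q z))
        + gaussExpect (g * Q) := by
    change _ = _ + ∫ z, polyGauss (g * Q) z
    rw [← integral_add hi.integrable hD.integrable]
    congr 1
    ext z
    rw [polyGauss_mul]
    ring
  rw [hsum, add_sub_cancel_right, mul_right_comm, ← integral_const_mul]
  exact norm_integral_le_of_norm_le (integrable_decayWeight.const_mul _) (ae_of_all _ hi.2)

theorem HasVolumeExpansion.exists_phaseMarginal_bound (h : HasVolumeExpansion l V ρ q)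
    (hρ : ∀ i, Measurable (ρ i)) (hV : ∀ᶠ i in l, 0 < V i) (J : ℕ) :
    ∃ C : ℝ, ∀ᶠ i in l, ∀ θ₁ θ₂ : ℝ, ‖phaseMarginal (fun z => (ρ i z : ℂ)) θ₁ θ₂
      - marginalFunctional θ₁ θ₂ (partialSum q J (V i ^ (-(1 / 2 : ℝ))))‖
      ≤ C * (V i ^ (-(1 / 2 : ℝ))) ^ (J + 1) := by
  obtain ⟨C, hC⟩ := h.exists_hasDecay hρ hV 1 J
  refine ⟨C * ∫ A in quadrant, modulusWeight A, ?_⟩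
  filter_upwards [hC] with i hi θ₁ θ₂
  simp only [map_one, one_mul] at hi
  set Q := partialSum q J (V i ^ (-(1 / 2 : ℝ)))
  obtain ⟨D, hD⟩ := exists_hasDecay_polyGauss Q
  have hsum := hi.phaseMarginal_add hD θ₁ θ₂
  simp only [sub_add_cancel] at hsum
  change ‖_ - phaseMarginal (polyGauss Q) θ₁ θ₂‖ ≤ _
  rw [hsum]
  have e : phaseMarginal (polyGauss Q) θ₁ θ₂ = phaseMarginal (fun z => polyGauss Q z) θ₁ θ₂ := rfl
  rw [e, add_sub_cancel_right, mul_right_comm]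
  exact hi.norm_phaseMarginal_le θ₁ θ₂

end Expansion

theorem phaseMarginal_ofReal (ρ : ℂ × ℂ → ℝ) (θ₁ θ₂ : ℝ) :
    phaseMarginal (fun z => (ρ z : ℂ)) θ₁ θ₂ = ((phaseMarginal ρ θ₁ θ₂ : ℝ) : ℂ) := by
  unfold phaseMarginal
  rw [← integral_complex_ofReal]
  congr 1 with A₁
  rw [← integral_complex_ofReal]
  congr 1 with A₂
  simp

/-- Every monomial is a product over a finite set of labelled modes. -/
theorem exists_prod_X_eq_monomial (a : Mode →₀ ℕ) :
    ∃ S : Finset (Mode × ℕ), ∏ i ∈ S, (MvPolynomial.X i.1 : MvPolynomial Mode ℂ)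
      = MvPolynomial.monomial a 1 ∧ ∑ i ∈ S, i.1.charge = Finsupp.weight Mode.charge a := by
  refine ⟨(Finset.univ.sigma fun t : Mode => Finset.range (a t)).map
    (Equiv.sigmaEquivProd Mode ℕ).toEmbedding, ?_, ?_⟩
  · rw [Finset.prod_map, Finset.prod_sigma, MvPolynomial.monomial_eq, Finsupp.prod_fintype _ _
      (by simp)]
    simp
  · rw [Finset.sum_map, Finset.sum_sigma, Finsupp.weight_apply, Finsupp.sum_fintype _ _ (by simp)]
    simp

/-- The coefficients of an expansion are determined, as far as the phases are concerned, by its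
moments. -/
theorem marginalFunctional_of_moments {n m : ℕ} (hn : 0 < n) (h3 : 3 ≤ n + m)
    (hnm : Nat.Coprime n m) {p : (N : ℕ) → (Fin N → Mode) → ℂ}
    (hres : ∀ N, 3 ≤ N → ∀ s, ¬ IsResonant n m (∑ i, (s i).charge) → p N s = 0)
    (hperm : ∀ (s : Fin (n + m) → Mode) (σ : Equiv.Perm (Fin (n + m))),
      p (n + m) (s ∘ σ) = p (n + m) s)
    {q : ℕ → MvPolynomial Mode ℂ}
    (hq : ∀ S : Finset (Mode × ℕ), ∀ j ≤ n + m - 2,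
      gaussExpect ((∏ i ∈ S, MvPolynomial.X i.1) * q j)
        = (momentOf (cumulantPoly p Prod.fst) S).coeff j)
    {j : ℕ} (hj : j ≤ n + m - 2) (θ₁ θ₂ : ℝ) :
    marginalFunctional θ₁ θ₂ (q j) = (if j = 0 then ((2 * Real.pi : ℂ) ^ 2)⁻¹ else 0) +
      if j = n + m - 2 then marginalFunctional θ₁ θ₂
        (leadingPoly n m fun b => p (n + m) (resonantTuple n m b)) else 0 := by
  set Λ := leadingPoly n m fun b => p (n + m) (resonantTuple n m b) with hΛ
  have hone := MvPolynomial.isWeightedHomogeneous_one ℂ Mode.charge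
  have hE1 : gaussExpect 1 = 1 := by
    have := gaussExpect_monomial 0 1
    simpa using this
  have hI1 : marginalFunctional θ₁ θ₂ 1 = ((2 * Real.pi : ℂ) ^ 2)⁻¹ := by
    rw [marginalFunctional_of_neutral hone, hE1, mul_one]
  -- The difference between `q j` and its expected form has mass zero and no charged moments. Its
  -- neutral part need not vanish, but it does not affect the phases.
  have hr : marginalFunctional θ₁ θ₂
      (q j - (if j = 0 then 1 else 0) - if j = n + m - 2 then Λ else 0) = 0 := by
    refine marginalFunctional_eq_zero ?_ (fun a ha => ?_) θ₁ θ₂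
    · have h0 := hq ∅ j hj
      rw [Finset.prod_empty, one_mul, momentOf_empty, Polynomial.coeff_one] at h0
      rw [map_sub, map_sub, h0]
      split_ifs <;> simp [hE1, hΛ, gaussExpect_leadingPoly hn]
    · obtain ⟨S, hS, hSc⟩ := exists_prod_X_eq_monomial a
      have hS0 : ∑ i ∈ S, i.1.charge ≠ 0 := hSc ▸ ha
      have h1 := hq S j hj
      have hE : gaussExpect (MvPolynomial.monomial a 1) = 0 :=
        gaussExpect_monomial_of_charged ha 1
      rw [← hS] at hE ⊢
      rw [mul_sub, mul_sub, map_sub, map_sub, h1]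
      have h2 : gaussExpect ((∏ i ∈ S, (MvPolynomial.X i.1 : MvPolynomial Mode ℂ)) *
          if j = 0 then 1 else 0) = 0 := by
        split_ifs <;> simp [hE]
      rw [h2, sub_zero]
      by_cases hjJ : j = n + m - 2
      · rw [if_pos hjJ, hjJ, coeff_momentOf_eq_gaussExpect Prod.fst hn h3 hnm hres hperm hS0,
          sub_self]
      · rw [if_neg hjJ, mul_zero, map_zero, sub_zero]
        exact Polynomial.X_pow_dvd_iff.1 (X_pow_dvd_momentOf Prod.fst hn hnm hres hS0) j
          (by omega)
  rw [map_sub, map_sub, sub_sub, sub_eq_zero] at hr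
  rw [hr, ← hI1]
  split_ifs <;> simp

/-! ### Densities of the modes of homogeneous fields -/

section Density

variable {d : ℕ} {L : Fin d → ℝ} {Ω : Type*} [MeasurableSpace Ω] {μ : Measure Ω}
  {f : Ω → (Fin d → ℝ) → ℝ} {k : Fin 2 → Fin d → ℝ} {n m : ℕ}

theorem modeMoment_eq_integral_density (hf : IsHomogeneousField L μ f) {ρ : ℂ × ℂ → ℝ}
    (hρ : Measurable ρ) (hρ0 : ∀ z, 0 ≤ ρ z)
    (hmap : μ.map (modePair L μ f k) =
      (volume : Measure (ℂ × ℂ)).withDensity (fun z => ENNReal.ofReal (ρ z)))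
    {κ : Type*} (s : κ → Mode) (S : Finset κ) :
    modeMoment L μ f k s S
      = ∫ z, MvPolynomial.eval (modeValue z) (∏ i ∈ S, MvPolynomial.X (s i)) * (ρ z : ℂ) := by
  have h1 : modeMoment L μ f k s S = ∫ z, MvPolynomial.eval (modeValue z)
      (∏ i ∈ S, MvPolynomial.X (s i)) ∂(μ.map (modePair L μ f k)) := by
    rw [integral_map (measurable_modePair hf).aemeasurable
      (continuous_eval_modeValue _).aestronglyMeasurable]
    simp [modeMoment]
  rw [h1, hmap, integral_withDensity_eq_integral_toReal_smul hρ.ennreal_ofReal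
    (ae_of_all _ fun z => ENNReal.ofReal_lt_top)]
  congr 1
  ext z
  rw [ENNReal.toReal_ofReal (hρ0 z), Complex.real_smul, mul_comm]

/-- Moments of the normalized modes are polynomials in `V^{-1/2}`. -/
theorem modeMoment_eq_eval [IsProbabilityMeasure μ] (hf : IsHomogeneousField L μ f)
    (hL : ∀ i, 0 < L i) (hk : ∀ a, IsWavevector L (k a)) (hk0 : k 0 ≠ 0) (hn : 0 < n)
    (hnm : Nat.Coprime n m) (h3 : 3 ≤ n + m)
    (hrel : (n : ℝ) • k 0 = (m : ℝ) • k 1) (hP : ∀ a, 0 < powerSpectrum L μ f (k a))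
    {p : (N : ℕ) → (Fin N → Mode) → ℂ}
    (hp : ∀ N : ℕ, 3 ≤ N → ∀ s : Fin N → Mode,
      normalizedPolyspectrum L μ f (fun a => (s a).vec k) = p N s)
    {κ : Type*} [DecidableEq κ] (s : κ → Mode) (S : Finset κ) :
    modeMoment L μ f k s S
      = (momentOf (cumulantPoly p s) S).eval ((boxVolume L ^ (-(1 / 2 : ℝ)) : ℝ) : ℂ) := by
  have hV : 0 < boxVolume L := Finset.prod_pos fun i _ => hL i
  rw [eq_momentOf_cumulantOf (modeMoment_empty s), ← Polynomial.coe_evalRingHom, map_momentOf]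
  refine momentOf_congr fun B _ hB => ?_
  -- This covers single modes and charged pairs, for which `cumulantPoly` is zero.
  have hcharged : B.card < n + m → ∑ i ∈ B, (s i).charge ≠ 0 →
      cumulantOf (modeMoment L μ f k s) B = 0 := fun hlt h0 =>
    cumulantOf_modeMoment_of_not_isResonant s hf hL hk hk0 hrel fun hr =>
      (le_card_of_isResonant s hn hnm hr h0).not_gt hlt
  have hpos := hB.card_pos
  rw [Polynomial.coe_evalRingHom, cumulantPoly]
  split_ifs with h1 h2 h0
  · rw [Polynomial.eval_zero]
    obtain ⟨x, rfl⟩ := Finset.card_eq_one.1 (le_antisymm h1 hpos)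
    refine hcharged (by simp; omega) fun h => ?_
    rw [Finset.sum_singleton] at h
    have := (s x).abs_charge
    simp [h] at this
  · rw [Polynomial.eval_one]
    exact cumulantOf_modeMoment_of_card_eq_two s hf hL hk hk0 hn hnm h3 hrel hP h2 h0
  · rw [Polynomial.eval_zero]
    exact hcharged (by omega) h0
  · let e : Fin B.card ↪ κ := B.equivFin.symm.toEmbedding.trans (Function.Embedding.subtype _)
    have he : Finset.univ.map e = B := by
      ext i
      simp only [e, Finset.mem_map, Finset.mem_univ, true_and, Function.Embedding.trans_apply,
        Equiv.coe_toEmbedding, Function.Embedding.subtype_apply]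
      exact ⟨fun ⟨a, ha⟩ => ha ▸ (B.equivFin.symm a).2,
        fun hi => ⟨B.equivFin ⟨i, hi⟩, by simp⟩⟩
    rw [cumulantOf_modeMoment_eq s hL hpos e he, hp _ (by omega) fun a => s (e a),
      Polynomial.eval_mul, Polynomial.eval_C, Polynomial.eval_pow, Polynomial.eval_X, mul_comm,
      ← Complex.ofReal_pow, ← rpow_neg_half_mul hV]
    have : 1 - (B.card : ℝ) / 2 = -(((B.card - 2 : ℕ) : ℝ) / 2) := by
      rw [Nat.cast_sub (by omega)]; push_cast; ring
    rw [this]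
    rfl

end Density

theorem abs_leadingTerm_le (n m : ℕ) (P : ℂ) :
    ∃ C : ℝ, ∀ θ₁ θ₂ : ℝ, |leadingTerm n m P θ₁ θ₂| ≤ C := by
  refine ⟨|2 * Real.Gamma (1 + (n : ℝ) / 2) * Real.Gamma (1 + (m : ℝ) / 2) /
    (n.factorial * m.factorial)| * ‖P‖, fun θ₁ θ₂ => ?_⟩
  rw [leadingTerm, abs_mul]
  refine mul_le_mul_of_nonneg_left ((Complex.abs_re_le_norm _).trans ?_) (abs_nonneg _)
  have : -Complex.I * ((n : ℂ) * θ₁ - m * θ₂) = ((-(n * θ₁ - m * θ₂) : ℝ) : ℂ) * Complex.I := by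
    push_cast; ring
  rw [norm_mul, this, Complex.norm_exp_ofReal_mul_I, mul_one]

/-- The deviation from random phases, for densities whose expansion has the moments prescribed by
the polyspectra. -/
theorem exists_phaseDeviation_bound {n m : ℕ}
    {p : (N : ℕ) → (Fin N → Mode) → ℂ}
    (hconj : p (n + m) (resonantTuple n m false)
      = (starRingEnd ℂ) (p (n + m) (resonantTuple n m true)))
    {ι : Type*} {l : Filter ι} {V : ι → ℝ} {ρ : ι → ℂ × ℂ → ℝ} {q : ℕ → MvPolynomial Mode ℂ}
    (h : HasVolumeExpansion l V ρ q) (hρ : ∀ i, Measurable (ρ i)) (hV : ∀ᶠ i in l, 1 ≤ V i)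
    (hq : ∀ j ≤ n + m - 2, ∀ θ₁ θ₂ : ℝ, marginalFunctional θ₁ θ₂ (q j)
      = (if j = 0 then ((2 * Real.pi : ℂ) ^ 2)⁻¹ else 0) + if j = n + m - 2 then
        marginalFunctional θ₁ θ₂ (leadingPoly n m fun b => p (n + m) (resonantTuple n m b)) else 0) :
    ∃ K : ℝ, ∀ᶠ i in l, ∀ θ₁ θ₂ : ℝ,
      |phaseDeviation (ρ i) θ₁ θ₂| ≤ K * (V i ^ (-(1 / 2 : ℝ))) ^ (n + m - 2) ∧
      |phaseDeviation (ρ i) θ₁ θ₂ - (V i ^ (-(1 / 2 : ℝ))) ^ (n + m - 2) *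
        leadingTerm n m (p (n + m) (resonantTuple n m true)) θ₁ θ₂|
        ≤ K * (V i ^ (-(1 / 2 : ℝ))) ^ (n + m - 2 + 1) := by
  set J := n + m - 2 with hJ
  set P := p (n + m) (resonantTuple n m true) with hPdef
  obtain ⟨C, hC⟩ := h.exists_phaseMarginal_bound hρ (hV.mono fun i hi => by linarith) J
  obtain ⟨B, hB⟩ := abs_leadingTerm_le n m P
  have hpi : (Real.pi : ℂ) ≠ 0 := by exact_mod_cast Real.pi_ne_zero
  -- The first part bounds the remainder, the second the leading term. Since `ε ≤ 1`, the remainder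
  -- of order `J + 1` is also bounded at order `J`.
  refine ⟨(2 * Real.pi) ^ 2 * |C| + |B|, ?_⟩
  filter_upwards [hC, hV] with i hi hVi θ₁ θ₂
  set ε := V i ^ (-(1 / 2 : ℝ)) with hε
  have hε0 : 0 < ε := Real.rpow_pos_of_pos (by linarith) _
  have hε1 : ε ≤ 1 := Real.rpow_le_one_of_one_le_of_nonpos hVi (by norm_num)
  have hlead := marginalFunctional_leadingPoly n m (fun b => p (n + m) (resonantTuple n m b)) hconj
    θ₁ θ₂
  have hsum : (2 * Real.pi : ℂ) ^ 2 * marginalFunctional θ₁ θ₂ (partialSum q J ε)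
      = 1 + ((ε ^ J * leadingTerm n m P θ₁ θ₂ : ℝ) : ℂ) := by
    rw [partialSum, map_sum]
    have : ∀ j ∈ Finset.range (J + 1), marginalFunctional θ₁ θ₂ (((ε : ℂ) ^ j) • q j)
        = (if j = 0 then (ε : ℂ) ^ j * ((2 * Real.pi : ℂ) ^ 2)⁻¹ else 0) +
          if j = J then (ε : ℂ) ^ j * marginalFunctional θ₁ θ₂
            (leadingPoly n m fun b => p (n + m) (resonantTuple n m b)) else 0 := by
      intro j hj
      rw [map_smul, hq j (Finset.mem_range_succ_iff.1 hj), smul_eq_mul, mul_add]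
      split_ifs <;> simp
    rw [Finset.sum_congr rfl this, Finset.sum_add_distrib, Finset.sum_ite_eq', Finset.sum_ite_eq',
      if_pos (by simp), if_pos (by simp), mul_add, mul_left_comm _ ((ε : ℂ) ^ J), hlead]
    push_cast
    field_simp
    simp [hPdef]
  have hmain : |phaseDeviation (ρ i) θ₁ θ₂ - ε ^ J * leadingTerm n m P θ₁ θ₂|
      ≤ (2 * Real.pi) ^ 2 * |C| * ε ^ (J + 1) := by
    have h1 := hi θ₁ θ₂
    rw [phaseMarginal_ofReal] at h1
    have h2 : ((phaseDeviation (ρ i) θ₁ θ₂ - ε ^ J * leadingTerm n m P θ₁ θ₂ : ℝ) : ℂ)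
        = (2 * Real.pi : ℂ) ^ 2 * ((phaseMarginal (ρ i) θ₁ θ₂ : ℝ) -
          marginalFunctional θ₁ θ₂ (partialSum q J ε)) := by
      rw [mul_sub, hsum, phaseDeviation]
      push_cast
      ring
    rw [← Real.norm_eq_abs, ← Complex.norm_real, h2, norm_mul, mul_assoc]
    have h4 : ‖(2 * Real.pi : ℂ) ^ 2‖ = (2 * Real.pi) ^ 2 := by
      rw [norm_pow, norm_mul, Complex.norm_real, Real.norm_eq_abs, abs_of_pos Real.pi_pos]
      simp
    rw [h4]
    refine mul_le_mul_of_nonneg_left (h1.trans ?_) (by positivity)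
    exact mul_le_mul_of_nonneg_right (le_abs_self C) (by positivity)
  constructor
  · have h5 : |ε ^ J * leadingTerm n m P θ₁ θ₂| ≤ |B| * ε ^ J := by
      rw [abs_mul, abs_of_pos (pow_pos hε0 J), mul_comm]
      exact mul_le_mul_of_nonneg_right ((hB θ₁ θ₂).trans (le_abs_self B)) (by positivity)
    have h6 : (2 * Real.pi) ^ 2 * |C| * ε ^ (J + 1) ≤ (2 * Real.pi) ^ 2 * |C| * ε ^ J :=
      mul_le_mul_of_nonneg_left (pow_le_pow_of_le_one hε0.le hε1 (Nat.le_succ J)) (by positivity)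
    calc |phaseDeviation (ρ i) θ₁ θ₂|
        ≤ |phaseDeviation (ρ i) θ₁ θ₂ - ε ^ J * leadingTerm n m P θ₁ θ₂|
          + |ε ^ J * leadingTerm n m P θ₁ θ₂| := by
          have := abs_add_le (phaseDeviation (ρ i) θ₁ θ₂ - ε ^ J * leadingTerm n m P θ₁ θ₂)
            (ε ^ J * leadingTerm n m P θ₁ θ₂)
          rwa [sub_add_cancel] at this
      _ ≤ _ := by rw [add_mul]; linarith
  · refine hmain.trans ?_
    rw [add_mul]
    have : 0 ≤ |B| * ε ^ (J + 1) := by positivity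
    linarith

end FourierModes

end

/-! ### The formal and the asymptotic statement for a family of fields -/

open FourierModes in
theorem theorem4 {d : ℕ} {ι : Type*} (L : ι → Fin d → ℝ) (hL : ∀ i a, 0 < L i a)
    {Ω : ι → Type*} [∀ i, MeasurableSpace (Ω i)] (μ : ∀ i, Measure (Ω i))
    [∀ i, IsProbabilityMeasure (μ i)] (f : ∀ i, Ω i → (Fin d → ℝ) → ℝ)
    (hf : ∀ i, FourierModes.IsHomogeneousField (L i) (μ i) (f i))
    (k : Fin 2 → Fin d → ℝ) (hk : ∀ i a, FourierModes.IsWavevector (L i) (k a))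
    (hk0 : k 0 ≠ 0) (hk01 : k 0 ≠ k 1)
    (n m : ℕ) (hn : 0 < n) (hm : 0 < m) (hnm : Nat.Coprime n m)
    (hrel : (n : ℝ) • k 0 = (m : ℝ) • k 1)
    (hP : ∀ i a, 0 < FourierModes.powerSpectrum (L i) (μ i) (f i) (k a)) :
    -- the formal expansion in powers of `V^{-1/2}`, for each field of the family
    (∀ i, ∀ θ₁ θ₂ : ℝ,
      (∀ j < n + m - 2, FourierModes.phaseDeviationCoeff
        (fun _ s => FourierModes.normalizedPolyspectrum (L i) (μ i) (f i)
          (fun a => FourierModes.Mode.vec k (s a))) j θ₁ θ₂ = 0) ∧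
      FourierModes.phaseDeviationCoeff
        (fun _ s => FourierModes.normalizedPolyspectrum (L i) (μ i) (f i)
          (fun a => FourierModes.Mode.vec k (s a))) (n + m - 2) θ₁ θ₂ =
        (FourierModes.leadingTerm n m
          (FourierModes.normalizedPolyspectrum (L i) (μ i) (f i)
            (Fin.append (fun _ : Fin n => k 0) (fun _ : Fin m => -k 1))) θ₁ θ₂ : ℂ)) ∧
    -- the actual densities, as the volume tends to infinity with fixed polyspectra
    (∀ (l : Filter ι), Tendsto (fun i => FourierModes.boxVolume (L i)) l atTop →
      ∀ p : (N : ℕ) → (Fin N → FourierModes.Mode) → ℂ,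
      (∀ i, ∀ N : ℕ, 3 ≤ N → ∀ s : Fin N → FourierModes.Mode,
        FourierModes.normalizedPolyspectrum (L i) (μ i) (f i)
          (fun a => FourierModes.Mode.vec k (s a)) = p N s) →
      ∀ ρ : ι → ℂ × ℂ → ℝ, (∀ i, Measurable (ρ i)) → (∀ i z, 0 ≤ ρ i z) →
      (∀ i, (μ i).map (fun ω => (FourierModes.normalizedMode (L i) (μ i) (f i) (k 0) ω,
          FourierModes.normalizedMode (L i) (μ i) (f i) (k 1) ω)) =
        (volume : Measure (ℂ × ℂ)).withDensity (fun z => ENNReal.ofReal (ρ i z))) →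
      ∀ q : ℕ → MvPolynomial FourierModes.Mode ℂ,
      FourierModes.HasVolumeExpansion l (fun i => FourierModes.boxVolume (L i)) ρ q →
      ∃ K : ℝ, ∀ᶠ i in l, ∀ θ₁ θ₂ : ℝ,
        |FourierModes.phaseDeviation (ρ i) θ₁ θ₂|
          ≤ K * FourierModes.boxVolume (L i) ^ (-(((n : ℝ) + m - 2) / 2)) ∧
        |FourierModes.phaseDeviation (ρ i) θ₁ θ₂ -
            FourierModes.boxVolume (L i) ^ (-(((n : ℝ) + m - 2) / 2)) *
              FourierModes.leadingTerm n m
                (p (n + m) (Fin.append (fun _ : Fin n => ((0 : Fin 2), true))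
                  (fun _ : Fin m => ((1 : Fin 2), false)))) θ₁ θ₂|
          ≤ K * FourierModes.boxVolume (L i) ^ (-(((n : ℝ) + m - 1) / 2))) := by
  have h3 : 3 ≤ n + m := three_le_add hk01 hn hm hrel
  have hres : ∀ i N (s : Fin N → Mode), ¬ IsResonant n m (∑ a, (s a).charge) →
      normalizedPolyspectrum (L i) (μ i) (f i) (fun a => Mode.vec k (s a)) = 0 :=
    fun i N s hs => normalizedPolyspectrum_eq_zero (hf i) (hL i)
      (fun a => isWavevector_vec (hk i) (s a)) (sum_vec_ne_zero hk0 hrel hs)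
  have hperm : ∀ i (s : Fin (n + m) → Mode) (σ : Equiv.Perm (Fin (n + m))),
      normalizedPolyspectrum (L i) (μ i) (f i) (fun a => Mode.vec k ((s ∘ σ) a))
        = normalizedPolyspectrum (L i) (μ i) (f i) (fun a => Mode.vec k (s a)) :=
    fun i s σ => normalizedPolyspectrum_comp_perm (by omega) (fun a => Mode.vec k (s a)) σ
  have hconj : ∀ i, normalizedPolyspectrum (L i) (μ i) (f i)
      (fun a => Mode.vec k (resonantTuple n m false a)) = (starRingEnd ℂ)
        (normalizedPolyspectrum (L i) (μ i) (f i)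
          (fun a => Mode.vec k (resonantTuple n m true a))) := fun i => by
    rw [vec_resonantTuple_false]
    exact normalizedPolyspectrum_neg (by omega) _
  refine ⟨fun i θ₁ θ₂ => ?_, ?_⟩
  · have key := fun {j : ℕ} (hj : j ≤ n + m - 2) => phaseDeviationCoeff_eq
      (p := fun _ s => normalizedPolyspectrum (L i) (μ i) (f i) (fun a => Mode.vec k (s a)))
      hn h3 hnm (hres i) (hperm i) (hconj i) hj θ₁ θ₂
    refine ⟨fun j hj => ?_, ?_⟩
    · rw [key hj.le, if_neg hj.ne]
    · rw [key le_rfl, if_pos rfl, vec_resonantTuple_true]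
  · intro l hV p hp ρ hρ hρ0 hmap q hq
    -- Along the trivial filter there is nothing to prove. Otherwise the family has a member `i₀`,
    -- from which `p` inherits momentum conservation, symmetry and reality.
    rcases l.eq_or_neBot with rfl | hl
    · exact ⟨0, by simp⟩
    obtain ⟨i₀⟩ := hl.nonempty
    have hVpos : ∀ i, 0 < boxVolume (L i) := fun i => Finset.prod_pos fun a _ => hL i a
    have hpres : ∀ N, 3 ≤ N → ∀ s : Fin N → Mode,
        ¬ IsResonant n m (∑ a, (s a).charge) → p N s = 0 := fun N hN s hs => by
      rw [← hp i₀ N hN s, hres i₀ N s hs]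
    have hpperm : ∀ (s : Fin (n + m) → Mode) (σ : Equiv.Perm (Fin (n + m))),
        p (n + m) (s ∘ σ) = p (n + m) s := fun s σ => by
      rw [← hp i₀ _ h3, ← hp i₀ _ h3, hperm]
    have hpconj : p (n + m) (resonantTuple n m false)
        = (starRingEnd ℂ) (p (n + m) (resonantTuple n m true)) := by
      rw [← hp i₀ _ h3, ← hp i₀ _ h3, hconj]
    set ε : ι → ℝ := fun i => boxVolume (L i) ^ (-(1 / 2 : ℝ)) with hε
    have hεlim : Tendsto ε l (nhds 0) := (tendsto_rpow_neg_atTop (by norm_num)).comp hV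
    have hεpos : ∀ i, 0 < ε i := fun i => Real.rpow_pos_of_pos (hVpos i) _
    -- The exact moment and the integrated expansion are polynomials in `ε` that differ by
    -- `O(ε^{n+m-1})` as `ε → 0`, so their coefficients agree up to order `n + m - 2`.
    have hmom : ∀ S : Finset (Mode × ℕ), ∀ j ≤ n + m - 2,
        gaussExpect ((∏ i ∈ S, MvPolynomial.X i.1) * q j)
          = (momentOf (cumulantPoly p Prod.fst) S).coeff j := by
      intro S j hj
      obtain ⟨C, hC⟩ := hq.exists_moment_bound hρ (Eventually.of_forall hVpos)
        (∏ i ∈ S, MvPolynomial.X i.1) (n + m - 2)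
      have hD := coeff_eq_zero_of_norm_eval_le hεlim (Eventually.of_forall hεpos)
        (D := momentOf (cumulantPoly p Prod.fst) S - ∑ j ∈ Finset.range (n + m - 2 + 1),
          Polynomial.C (gaussExpect ((∏ i ∈ S, MvPolynomial.X i.1) * q j)) * Polynomial.X ^ j)
        (C := C) (J := n + m - 2) ?_ hj
      · rw [Polynomial.coeff_sub, sub_eq_zero, Polynomial.finsetSum_coeff] at hD
        rw [hD]
        simp only [Polynomial.coeff_C_mul_X_pow]
        rw [Finset.sum_ite_eq, if_pos (Finset.mem_range_succ_iff.2 hj)]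
      · filter_upwards [hC] with i hi
        rw [← modeMoment_eq_integral_density (hf i) (hρ i) (hρ0 i) (hmap i) Prod.fst S,
          modeMoment_eq_eval (hf i) (hL i) (hk i) hk0 hn hnm h3 hrel (hP i) (hp i) Prod.fst S]
          at hi
        rw [Polynomial.eval_sub, Polynomial.eval_finsetSum]
        rw [partialSum, Finset.mul_sum, map_sum] at hi
        convert hi using 3
        refine Finset.sum_congr rfl fun j _ => ?_
        rw [mul_smul_comm, map_smul, smul_eq_mul, Polynomial.eval_mul, Polynomial.eval_C,
          Polynomial.eval_pow, Polynomial.eval_X, mul_comm]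
    obtain ⟨K, hK⟩ := exists_phaseDeviation_bound hpconj hq hρ
      (hV.eventually_ge_atTop 1) fun j hj θ₁ θ₂ =>
        marginalFunctional_of_moments hn h3 hnm hpres hpperm hmom hj θ₁ θ₂
    refine ⟨K, ?_⟩
    filter_upwards [hK] with i hi θ₁ θ₂
    have e1 : -(((n : ℝ) + m - 2) / 2) = -(((n + m - 2 : ℕ) : ℝ) / 2) := by
      rw [Nat.cast_sub (by omega)]; push_cast; ring
    have e2 : -(((n : ℝ) + m - 1) / 2) = -(((n + m - 2 + 1 : ℕ) : ℝ) / 2) := by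
      rw [Nat.cast_add, Nat.cast_sub (by omega)]; push_cast; ring
    rw [e1, e2, rpow_neg_half_mul (hVpos i), rpow_neg_half_mul (hVpos i)]
    exact hi θ₁ θ₂
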